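/- Let $P=\{x\in\mathbb{R}^n : l_k(x)=\langle x,\nu_k\rangle-\lambda_k\ge 0,\ k=1,\dots,N\}$ be a compact Delzant polytope with nonempty interior $P_0$, where there is one $l_k$ for each facet, $\lambda_k \in \mathbb{R}$, and at each vertex the normals $\nu_k\in\mathbb{Z}^n$ of the facets through it form a $\mathbb{Z}$-basis of $\mathbb{Z}^n$. Let $u$ be a symplectic potential on $P$: $u-\frac12\sum_k l_k\log l_k$ is smooth up to the boundary of $P$, and the restriction of $u$ to the relative interior of every face of $P$ (including $P_0$) has positive definite Hessian (the Guillemin boundary conditions). Let $(u^{ij})$ be the inverse of the Hessian matrix $(u_{ij})$, let $F^{ab}_{kl}=-\partial^2u^{ab}/\partial x_k\partial x_l$, and let $|F|\ge 0$ be defined by $|F|^2=F^{ij}_{kl}F^{ab}_{cd}u_{ia}u_{jb}u^{kc}u^{ld}$. Let $g=\sum u_{ij}\,dx_i\,dx_j$ on $P_0$, let $\mathrm{Dist}_g(p,q)$ be the Riemannian distance of $p,q\in P_0$, and let $\mathrm{Dist}_g(p,\partial P)$ be the infimum of the $g$-lengths of curves that run from $p$ in $P_0$ to a point of $\partial P$.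 Suppose that $|F|\le 1$ on $P_0$ and that $p\in P_0$ satisfies $\mathrm{Dist}_g(p,\partial P)\ge\alpha>0$. (1) If $q\in P_0$ and $\mathrm{Dist}_g(p,q)=d$, then, as quadratic forms, $$(u^{ij}(q))\le\frac{\sinh^2(\alpha+d)}{\sinh^2\alpha}\,(u^{ij}(p)),$$ and if moreover $d<\alpha$, then $$(u^{ij}(q))\ge\frac{\sinh^2(\alpha-d)}{\sinh^2\alpha}\,(u^{ij}(p)).$$ (2) For $r>0$ let $E(p,r)=\{x\in\mathbb{R}^n : \sum u_{ij}(p)(x_i-p_i)(x_j-p_j)\le r^2\}$, and let $B_g(p,r)$ and $\overline{B}_g(p,r)$ be the sets of those $q\in P_0$ with $\mathrm{Dist}_g(p,q)<r$ and $\mathrm{Dist}_g(p,q)\le r$, respectively. For every $0<\beta<\alpha$, $$E(p,c\beta)\subset B_g(p,\beta)\subset\overline{B}_g(p,\beta)\subset E(p,C\beta),\qquad c=\frac{\sinh(\alpha-\beta)}{\sinh\alpha},\quad C=\frac{\sinh(\alpha+\beta)}{\sinh\alpha}.$$ In particular, the Euclidean volume of $B_g(p,\beta)$ is at least $c^n\beta^n\omega_n\det(u_{ij}(p))^{-1/2}$,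 where $\omega_n$ is the volume of the unit ball of $\mathbb{R}^n$. -/

import Mathlib

open MeasureTheory Set
open scoped ENNReal ContDiff

noncomputable section

namespace Toric

/-- Euclidean `n`-space. -/
abbrev E (n : ℕ) : Type := EuclideanSpace ℝ (Fin n)

/-- The affine function `l_k(x) = ⟨x, ν_k⟩ - c_k` attached to integer normals `ν` and offsets `c`. -/
def facetFn {n N : ℕ} (ν : Fin N → Fin n → ℤ) (c : Fin N → ℝ) (k : Fin N) (x : E n) : ℝ :=
  ∑ i, (ν k i : ℝ) * x i - c k

/-- A Delzant polytope in `ℝⁿ`, given by its facets: the compact set `{x | l_k(x) ≥ 0 for all k}`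
with nonempty interior, one `l_k` for each facet, such that the normals of the facets through
any of its points (equivalently, through any of its vertices) are part of a `ℤ`-basis of `ℤⁿ`. In
particular every normal is a primitive lattice vector. -/
structure DelzantPolytope (n : ℕ) where
  /-- the number of facets -/
  numFacets : ℕ
  /-- the inward normals of the facets -/
  normal : Fin numFacets → Fin n → ℤ
  /-- the offsets of the facets -/
  offset : Fin numFacets → ℝ
  bounded : Bornology.IsBounded {x : E n | ∀ k, 0 ≤ facetFn normal offset k x}
  nonempty_interior : ∃ x : E n, ∀ k, 0 < facetFn normal offset k x
  facet : ∀ k, ∃ x : E n, facetFn normal offset k x = 0 ∧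
    ∀ j, j ≠ k → 0 < facetFn normal offset j x
  smooth : ∀ x : E n, (∀ k, 0 ≤ facetFn normal offset k x) →
    ∃ b : Module.Basis (Fin n) ℤ (Fin n → ℤ),
      ∀ k, facetFn normal offset k x = 0 → normal k ∈ Set.range b

namespace DelzantPolytope

variable {n : ℕ} (P : DelzantPolytope n)

/-- The defining function `l_k` of the `k`-th facet. -/
def l (k : Fin P.numFacets) (x : E n) : ℝ := facetFn P.normal P.offset k x

/-- The closed polytope. -/
def closed : Set (E n) := {x | ∀ k, 0 ≤ P.l k x}

/-- The open polytope (the interior of the closed one). -/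
def inner : Set (E n) := {x | ∀ k, 0 < P.l k x}

/-- The boundary of the polytope. -/
def boundary : Set (E n) := P.closed \ P.inner

/-- The function `u₀ = ½ ∑ l_k log l_k`, with `0 log 0 = 0`. -/
def guilleminPotential (x : E n) : ℝ := (1 / 2) * ∑ k, P.l k x * Real.log (P.l k x)

/-- The vector `w` is tangent to the smallest face of the polytope that contains `x`. -/
def TangentToFace (x w : E n) : Prop :=
  ∀ k, P.l k x = 0 → ∑ i, (P.normal k i : ℝ) * w i = 0

/-- The Guillemin boundary conditions: `u - u₀` is smooth up to the boundary, and the restriction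
of `u` to the relative interior of each face, the open polytope included, is strictly convex
(that is, its Hessian is positive definite). -/
structure Guillemin (u : E n → ℝ) : Prop where
  smooth : ∃ v : E n → ℝ, ContDiff ℝ ∞ v ∧ ∀ x ∈ P.closed, u x = P.guilleminPotential x + v x
  convex : ∀ x ∈ P.closed, ∀ w : E n, w ≠ 0 → P.TangentToFace x w →
    0 < iteratedDeriv 2 (fun t : ℝ => u (x + t • w)) 0

end DelzantPolytope

section Geometry

variable {n : ℕ}

/-- The partial derivative `∂f/∂xᵢ`. -/
def partialDeriv (i : Fin n) (f : E n → ℝ) (x : E n) : ℝ :=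
  fderiv ℝ f x (EuclideanSpace.single i 1)

/-- The Hessian matrix `(u_{ij})`. -/
def hess (u : E n → ℝ) (x : E n) : Matrix (Fin n) (Fin n) ℝ :=
  Matrix.of fun i j => partialDeriv i (partialDeriv j u) x

/-- The inverse Hessian matrix `(u^{ij})`. -/
def invHess (u : E n → ℝ) (x : E n) : Matrix (Fin n) (Fin n) ℝ := (hess u x)⁻¹

/-- The tensor `F^{ab}_{kl} = - ∂²u^{ab} / ∂x_k ∂x_l`. -/
def tensorF (u : E n → ℝ) (x : E n) (a b k l : Fin n) : ℝ :=
  - partialDeriv k (partialDeriv l fun y => invHess u y a b) x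

/-- The norm `|F|` in the metric `u_{ij}`:
`|F|² = F^{ij}_{kl} F^{ab}_{cd} u_{ia} u_{jb} u^{kc} u^{ld}`. -/
def normF (u : E n → ℝ) (x : E n) : ℝ :=
  Real.sqrt (∑ i, ∑ j, ∑ k, ∑ l, ∑ a, ∑ b, ∑ c, ∑ d,
    tensorF u x i j k l * tensorF u x a b c d *
      hess u x i a * hess u x j b * invHess u x k c * invHess u x l d)

/-- The quadratic form `g_x(w, w) = u_{ij}(x) wⁱ wʲ`. -/
def metricForm (u : E n → ℝ) (x w : E n) : ℝ := ∑ i, ∑ j, hess u x i j * w i * w j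

/-- The length of `γ` between the parameters `a` and `b` in the metric `g = u_{ij} dxᵢ dxⱼ`. -/
def gLength (u : E n → ℝ) (γ : ℝ → E n) (a b : ℝ) : ℝ≥0∞ :=
  ∫⁻ t in Ioo a b, ENNReal.ofReal (Real.sqrt (metricForm u (γ t) (deriv γ t)))

/-- `γ` is a piecewise `C¹` curve on `[a, b]`: it is continuous, and `C¹` on each closed
subinterval that has none of finitely many break points in its interior. -/
def PiecewiseC1On (γ : ℝ → E n) (a b : ℝ) : Prop :=
  ContinuousOn γ (Icc a b) ∧ ∃ s : Finset ℝ, ∀ x y : ℝ, a ≤ x → x < y → y ≤ b →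
    (∀ t ∈ s, t ∉ Ioo x y) → ContDiffOn ℝ 1 γ (Icc x y)

/-- The Riemannian distance `Dist_g(p, q)` in the open polytope. -/
def gDist (P : DelzantPolytope n) (u : E n → ℝ) (p q : E n) : ℝ≥0∞ :=
  ⨅ (γ : ℝ → E n) (_ : PiecewiseC1On γ 0 1 ∧ γ 0 = p ∧ γ 1 = q ∧ ∀ t ∈ Icc (0 : ℝ) 1, γ t ∈ P.inner),
    gLength u γ 0 1

/-- The Riemannian distance `Dist_g(p, ∂P)`: the infimum of the lengths of the curves that start
at `p`, run in the open polytope and end at a point of its boundary. The metric is only defined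
in the open polytope, so the curve is asked to be piecewise `C¹` before it ends. -/
def gDistBoundary (P : DelzantPolytope n) (u : E n → ℝ) (p : E n) : ℝ≥0∞ :=
  ⨅ (γ : ℝ → E n) (_ : ContinuousOn γ (Icc 0 1) ∧ (∀ b ∈ Ioo (0 : ℝ) 1, PiecewiseC1On γ 0 b) ∧
      γ 0 = p ∧ γ 1 ∈ P.boundary ∧ ∀ t ∈ Ico (0 : ℝ) 1, γ t ∈ P.inner),
    gLength u γ 0 1

/-- The open `g`-ball in the open polytope. -/
def gBall (P : DelzantPolytope n) (u : E n → ℝ) (p : E n) (r : ℝ) : Set (E n) :=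
  {q | q ∈ P.inner ∧ gDist P u p q < ENNReal.ofReal r}

/-- The closed `g`-ball in the open polytope. -/
def gClosedBall (P : DelzantPolytope n) (u : E n → ℝ) (p : E n) (r : ℝ) : Set (E n) :=
  {q | q ∈ P.inner ∧ gDist P u p q ≤ ENNReal.ofReal r}

/-- The ellipsoid `E(p, r) = {x | u_{ij}(p) (xᵢ - pᵢ) (xⱼ - pⱼ) ≤ r²}`. -/
def ellipsoid (u : E n → ℝ) (p : E n) (r : ℝ) : Set (E n) :=
  {x | metricForm u p (x - p) ≤ r ^ 2}

end Geometry

end Toric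

end

/-! ### Calculus off finitely many points; arc length of piecewise C¹ curves. -/

namespace Toric

open Filter Topology

/-! Fix a constant vector w and put f = (u_ij w^i w^j)^(-1/2). Averaging the bounds on the
contractions F(w,w;v,v) and F(w,v;v,w) bounds the fourth derivative of u from below, and -1/2 is an
exponent for which the remaining squares of third derivatives cancel by Cauchy-Schwarz. The outcome
is that |F| ≤ 1 forces Hess f ≤ f g (`curvature_le`, `sinhConcave_traceForm`). So f'' ≤ f along unit
speed geodesics, and the rest is Sturm comparison of a positive function with sinh.

If |∇f| exceeded f coth α at p, then f would fall to 0 within distance less than α, before the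
boundary; hence |∇f| ≤ f coth α (`gradient_le`). At a point at distance s < α from p this holds with
α - s, and integration gives f(q) ≥ f(p) sinh(α-d)/sinh α for d < α (`mul_sinh_le_of_conn`). On a
shortest curve f lies above the solution of φ'' = φ with the same end values; together with the
bound on the slope at p this gives f(q) ≤ f(p) sinh(α+d)/sinh α for every d (`mul_sinh_le`). Since
f^(-2) = u_ij w^i w^j, these are comparisons of the Hessians at p and q, and inverting the matrices
reverses them.

The metric is incomplete and shortest geodesics need not exist, so none are used. For the gradient
bound, the flow of steepest descent is replaced by a minimum of artanh(f/|∇f|) plus a small multiple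
of the distance to p. For Sturm comparison, a curve is displaced along ∇f by t φ(arc length) with
φ'' = φ; its length grows by at most t times the increment of φ' f, up to O(t²)
(`exists_curve_variation`). With a Green's function for φ the ends stay fixed, and a nearly shortest
curve cannot become much shorter (`exists_curve_variation_green`). For a uniform O(t²) the nearly
shortest curves must lie in one compact set. The same comparison provides it
(`exists_compact_conn`), applied to (trace u_ij)^(-1/2), which satisfies the same Hessian inequality
and has compact superlevel sets by the Guillemin conditions. These conditions also give short paths
from points near a facet to the boundary, so that balls of radius less than α stay in a compact part
of the open polytope (`exists_mem_core`).

For (2), the metric comparison is integrated along straight segments for the inner ellipsoid, and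
along arbitrary curves for the outer one. -/

theorem piecewise_induction {Q : ℝ → ℝ → Prop} {a b : ℝ} (s : Finset ℝ)
    (hbase : ∀ x y, a ≤ x → x < y → y ≤ b → (∀ t ∈ s, t ∉ Ioo x y) → Q x y)
    (htrans : ∀ x y z, a ≤ x → x < y → y < z → z ≤ b → Q x y → Q y z → Q x z) :
    ∀ x y, a ≤ x → x < y → y ≤ b → Q x y := by
  -- Induction on the number of break points inside the interval: cutting at one of them leaves
  -- fewer in each half.
  suffices H : ∀ m : ℕ, ∀ x y, a ≤ x → x < y → y ≤ b →
      (s.filter (fun t => t ∈ Ioo x y)).card ≤ m → Q x y from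
    fun x y hx hxy hy => H _ x y hx hxy hy le_rfl
  intro m
  induction m with
  | zero =>
    intro x y hx hxy hy hc
    refine hbase x y hx hxy hy fun t ht hti => ?_
    have : t ∈ s.filter (fun t => t ∈ Ioo x y) := by simp only [Finset.mem_filter]; exact ⟨ht, hti⟩
    rw [Finset.card_eq_zero.mp (Nat.le_zero.mp hc)] at this
    simp at this
  | succ m ih =>
    intro x y hx hxy hy hc
    by_cases h : ∀ t ∈ s, t ∉ Ioo x y
    · exact hbase x y hx hxy hy h
    · push Not at h
      obtain ⟨t, hts, ht⟩ := h
      have hmem : t ∈ s.filter (fun t => t ∈ Ioo x y) := by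
        simp only [Finset.mem_filter]; exact ⟨hts, ht⟩
      have key : ∀ x' y', x ≤ x' → y' ≤ y → t ∉ Ioo x' y' →
          (s.filter (fun t => t ∈ Ioo x' y')).card ≤ m := by
        intro x' y' hx' hy' ht'
        have : (s.filter (fun t => t ∈ Ioo x' y')) ⊂ (s.filter (fun t => t ∈ Ioo x y)) := by
          rw [Finset.ssubset_iff_of_subset]
          · exact ⟨t, hmem, by simp only [Finset.mem_filter]; exact fun h => ht' h.2⟩
          · intro r hr
            simp only [Finset.mem_filter] at hr ⊢
            exact ⟨hr.1, lt_of_le_of_lt hx' hr.2.1, lt_of_lt_of_le hr.2.2 hy'⟩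
        have := Finset.card_lt_card this
        omega
      exact htrans x t y hx ht.1 ht.2 hy
        (ih x t hx ht.1 (ht.2.le.trans hy) (key x t le_rfl ht.2.le (fun h => lt_irrefl _ h.2)))
        (ih t y (hx.trans ht.1.le) ht.2 hy (key t y ht.1.le le_rfl (fun h => lt_irrefl _ h.1)))

/-- The exceptional set will be the break points of a curve; continuity carries monotonicity across
them. -/
theorem le_of_hasDerivAt_nonneg_off_finset {h h' : ℝ → ℝ} {a b : ℝ} (s : Finset ℝ)
    (hc : ContinuousOn h (Icc a b))
    (hd : ∀ t ∈ Ioo a b, t ∉ s → HasDerivAt h (h' t) t ∧ 0 ≤ h' t) :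
    MonotoneOn h (Icc a b) := by
  have H : ∀ x y, a ≤ x → x < y → y ≤ b → h x ≤ h y := by
    refine piecewise_induction s ?_ ?_
    · intro x y hx hxy hy hs
      have hsub : Icc x y ⊆ Icc a b := Icc_subset_Icc hx hy
      have hd' : ∀ t ∈ Ioo x y, HasDerivAt h (h' t) t ∧ 0 ≤ h' t := fun t ht =>
        hd t ⟨lt_of_le_of_lt hx ht.1, lt_of_lt_of_le ht.2 hy⟩ (fun hts => hs t hts ht)
      refine (monotoneOn_of_deriv_nonneg (convex_Icc x y) (hc.mono hsub) ?_ ?_)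
        (left_mem_Icc.2 hxy.le) (right_mem_Icc.2 hxy.le) hxy.le
      · rw [interior_Icc]
        exact fun t ht => (hd' t ht).1.differentiableAt.differentiableWithinAt
      · rw [interior_Icc]
        intro t ht
        rw [(hd' t ht).1.deriv]
        exact (hd' t ht).2
    · intro x y z _ _ _ _ h1 h2
      exact h1.trans h2
  intro x hx y hy hxy
  rcases hxy.eq_or_lt with rfl | hlt
  · exact le_rfl
  · exact H x y hx.1 hlt hy.2

theorem ae_notMem_finset (s : Finset ℝ) : ∀ᵐ t : ℝ, t ∉ s := by
  have := (s.finite_toSet.countable).ae_notMem (volume : Measure ℝ)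
  simpa using this

/-- Integrability of the derivative is not assumed: `h` is monotone, and a monotone function has ∫
h' ≤ h b - h a. So the speed may be unbounded at the ends, as on a path that runs into the boundary.
-/
theorem lintegral_le_of_hasDerivAt_off_finset {h h' k : ℝ → ℝ} {a b : ℝ} (hab : a ≤ b)
    (s : Finset ℝ) (hc : ContinuousOn h (Icc a b))
    (hd : ∀ t ∈ Ioo a b, t ∉ s → HasDerivAt h (h' t) t ∧ 0 ≤ k t ∧ k t ≤ h' t) :
    ∫⁻ t in Ioo a b, ENNReal.ofReal (k t) ≤ ENNReal.ofReal (h b - h a) := by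
  have hmono : MonotoneOn h (Icc a b) := le_of_hasDerivAt_nonneg_off_finset s hc
    (fun t ht hts => ⟨(hd t ht hts).1, (hd t ht hts).2.1.trans (hd t ht hts).2.2⟩)
  have hmono' : MonotoneOn h (uIcc a b) := by rwa [uIcc_of_le hab]
  have hint := hmono'.intervalIntegrable_deriv
  have hI := hmono'.intervalIntegral_deriv_mem_uIcc
  have hba : 0 ≤ h b - h a := by
    have := hmono (left_mem_Icc.2 hab) (right_mem_Icc.2 hab) hab
    linarith
  rw [uIcc_of_le hba] at hI
  rw [intervalIntegrable_iff_integrableOn_Ioo_of_le hab] at hint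
  have hae : ∀ᵐ t ∂(volume.restrict (Ioo a b)), 0 ≤ k t ∧ k t ≤ deriv h t := by
    rw [ae_restrict_iff' measurableSet_Ioo]
    filter_upwards [ae_notMem_finset s] with t hts ht
    have := hd t ht hts
    rw [this.1.deriv]
    exact this.2
  calc ∫⁻ t in Ioo a b, ENNReal.ofReal (k t)
      ≤ ∫⁻ t in Ioo a b, ENNReal.ofReal (deriv h t) := by
        refine lintegral_mono_ae ?_
        filter_upwards [hae] with t ht
        exact ENNReal.ofReal_le_ofReal ht.2
    _ = ENNReal.ofReal (∫ t in Ioo a b, deriv h t) := by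
        rw [ofReal_integral_eq_lintegral_ofReal hint]
        filter_upwards [hae] with t ht
        exact ht.1.trans ht.2
    _ ≤ _ := by
        apply ENNReal.ofReal_le_ofReal
        rw [← integral_Ioc_eq_integral_Ioo, ← intervalIntegral.integral_of_le hab]
        exact hI.2

variable {n : ℕ}

/-- The open set `U` carries a continuous positive semidefinite metric `u_{ij}`. -/
structure MetricOn (u : E n → ℝ) (U : Set (E n)) : Prop where
  isOpen : IsOpen U
  cont : ContinuousOn (fun z : E n × E n => metricForm u z.1 z.2) (U ×ˢ univ)
  nonneg : ∀ x ∈ U, ∀ w, 0 ≤ metricForm u x w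

/-- The speed of a curve in the metric `u_{ij}`. -/
noncomputable def speed (u : E n → ℝ) (γ : ℝ → E n) (t : ℝ) : ℝ :=
  Real.sqrt (metricForm u (γ t) (deriv γ t))

theorem metricForm_smul (u : E n → ℝ) (x w : E n) (c : ℝ) :
    metricForm u x (c • w) = c ^ 2 * metricForm u x w := by
  simp only [metricForm, Finset.mul_sum, PiLp.smul_apply, smul_eq_mul]
  refine Finset.sum_congr rfl fun i _ => Finset.sum_congr rfl fun j _ => by ring

theorem sqrt_metricForm_smul (u : E n → ℝ) (x w : E n) {c : ℝ} (hc : 0 ≤ c) :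
    Real.sqrt (metricForm u x (c • w)) = c * Real.sqrt (metricForm u x w) := by
  rw [metricForm_smul, Real.sqrt_mul (sq_nonneg c), Real.sqrt_sq hc]

theorem PiecewiseC1On.mono {γ : ℝ → E n} {a b a' b' : ℝ} (h : PiecewiseC1On γ a b)
    (ha : a ≤ a') (hb : b' ≤ b) : PiecewiseC1On γ a' b' := by
  obtain ⟨hc, s, hs⟩ := h
  exact ⟨hc.mono (Icc_subset_Icc ha hb), s, fun x y hx hxy hy hxs =>
    hs x y (ha.trans hx) hxy (hy.trans hb) hxs⟩

theorem exists_Ioo_off_finset {a b : ℝ} (s : Finset ℝ) {t : ℝ} (ht : t ∈ Ioo a b) (hts : t ∉ s) :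
    ∃ x y, a ≤ x ∧ x < t ∧ t < y ∧ y ≤ b ∧ ∀ r ∈ s, r ∉ Ioo x y := by
  have h1 : Ioo a b ∩ (↑s : Set ℝ)ᶜ ∈ 𝓝 t :=
    inter_mem (isOpen_Ioo.mem_nhds ht) (s.finite_toSet.isClosed.isOpen_compl.mem_nhds (by simpa))
  obtain ⟨x, y, hxy, hsub⟩ := mem_nhds_iff_exists_Ioo_subset.1 h1
  refine ⟨max a x, min b y, le_max_left _ _, max_lt ht.1 hxy.1, lt_min ht.2 hxy.2,
    min_le_left _ _, fun r hr hri => ?_⟩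
  have : r ∈ Ioo x y := ⟨lt_of_le_of_lt (le_max_right _ _) hri.1,
    lt_of_lt_of_le hri.2 (min_le_right _ _)⟩
  exact (hsub this).2 (by simpa using hr)

theorem contDiffAt_of_piecewise {γ : ℝ → E n} {a b : ℝ} {s : Finset ℝ}
    (hs : ∀ x y : ℝ, a ≤ x → x < y → y ≤ b → (∀ t ∈ s, t ∉ Ioo x y) → ContDiffOn ℝ 1 γ (Icc x y))
    {t : ℝ} (ht : t ∈ Ioo a b) (hts : t ∉ s) : ContDiffAt ℝ 1 γ t := by
  obtain ⟨x, y, hx, hxt, hty, hy, hr⟩ := exists_Ioo_off_finset s ht hts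
  exact (hs x y hx (hxt.trans hty) hy hr).contDiffAt (Icc_mem_nhds hxt hty)

variable {u : E n → ℝ} {U : Set (E n)}

theorem MetricOn.continuousOn_sqrt (hU : MetricOn u U) {T : Set ℝ} {γ δ : ℝ → E n}
    (hγ : ContinuousOn γ T) (hδ : ContinuousOn δ T) (hm : MapsTo γ T U) :
    ContinuousOn (fun t => Real.sqrt (metricForm u (γ t) (δ t))) T :=
  (ContinuousOn.comp (g := fun z : E n × E n => metricForm u z.1 z.2)
    (f := fun t => (γ t, δ t)) (t := U ×ˢ univ) hU.cont (hγ.prodMk hδ)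
    (fun t ht => ⟨hm ht, mem_univ _⟩)).sqrt

theorem MetricOn.continuousAt_speed (hU : MetricOn u U) {γ : ℝ → E n} {t : ℝ}
    (hγ : ContDiffAt ℝ 1 γ t) (ht : γ t ∈ U) : ContinuousAt (speed u γ) t := by
  have h1 : ContinuousAt (deriv γ) t := by
    obtain ⟨v, hv, hcd⟩ := (hγ.contDiffOn le_rfl (by simp))
    obtain ⟨o, ho, hoo, hto⟩ := mem_nhds_iff.1 hv
    exact ((hcd.mono ho).continuousOn_deriv_of_isOpen hoo le_rfl).continuousAt (hoo.mem_nhds hto)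
  have h2 := hU.cont.continuousAt ((hU.isOpen.prod isOpen_univ).mem_nhds
    (show (γ t, deriv γ t) ∈ U ×ˢ univ from ⟨ht, mem_univ _⟩))
  exact (ContinuousAt.comp (g := fun z : E n × E n => metricForm u z.1 z.2)
    (f := fun t => (γ t, deriv γ t)) h2 (hγ.continuousAt.prodMk h1)).sqrt

/-- On an interval without break points the speed agrees with a continuous function. -/
theorem MetricOn.speed_eq_on_Ioo (hU : MetricOn u U) {γ : ℝ → E n} {x y : ℝ} (hxy : x < y)
    (hγ : ContDiffOn ℝ 1 γ (Icc x y)) (hm : MapsTo γ (Icc x y) U) :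
    ∃ ρ : ℝ → ℝ, Continuous ρ ∧ ∀ t ∈ Ioo x y, speed u γ t = ρ t := by
  -- At the ends `deriv γ` may be a default value; the one-sided derivative supplies the continuous
  -- extension, and agreement is needed only inside.
  have hd : ContinuousOn (derivWithin γ (Icc x y)) (Icc x y) :=
    hγ.continuousOn_derivWithin (uniqueDiffOn_Icc hxy) le_rfl
  have hc := hU.continuousOn_sqrt hγ.continuousOn hd hm
  refine ⟨_, hc.domRestrict.Icc_extend' (h := hxy.le), fun t ht => ?_⟩
  rw [IccExtend_of_mem _ _ (Ioo_subset_Icc_self ht)]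
  simp only [speed, domRestrict_apply]
  rw [derivWithin_of_mem_nhds (Icc_mem_nhds ht.1 ht.2)]

theorem MetricOn.intervalIntegrable_speed (hU : MetricOn u U) {γ : ℝ → E n} {a b : ℝ} (hab : a < b)
    (hγ : PiecewiseC1On γ a b) (hm : MapsTo γ (Icc a b) U) :
    IntervalIntegrable (speed u γ) volume a b := by
  obtain ⟨hc, s, hs⟩ := hγ
  refine piecewise_induction (Q := fun x y => IntervalIntegrable (speed u γ) volume x y)
    s ?_ ?_ a b le_rfl hab le_rfl
  · intro x y hx hxy hy hxs
    obtain ⟨ρ, hρ, he⟩ := hU.speed_eq_on_Ioo hxy (hs x y hx hxy hy hxs)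
      (hm.mono_left (Icc_subset_Icc hx hy))
    rw [intervalIntegrable_iff_integrableOn_Ioo_of_le hxy.le]
    have := (intervalIntegrable_iff_integrableOn_Ioo_of_le (μ := volume) hxy.le).1 (hρ.intervalIntegrable x y)
    exact this.congr_fun (fun t ht => (he t ht).symm) measurableSet_Ioo
  · intro x y z _ _ _ _ h1 h2
    exact h1.trans h2

/-- The arc length function of a curve. -/
noncomputable def arc (u : E n → ℝ) (γ : ℝ → E n) (a t : ℝ) : ℝ := ∫ r in a..t, speed u γ r

theorem speed_nonneg (u : E n → ℝ) (γ : ℝ → E n) (t : ℝ) : 0 ≤ speed u γ t := Real.sqrt_nonneg _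

theorem arc_self (u : E n → ℝ) (γ : ℝ → E n) (a : ℝ) : arc u γ a a = 0 := by simp [arc]

theorem MetricOn.continuousOn_arc (hU : MetricOn u U) {γ : ℝ → E n} {a b : ℝ} (hab : a < b)
    (hγ : PiecewiseC1On γ a b) (hm : MapsTo γ (Icc a b) U) :
    ContinuousOn (arc u γ a) (Icc a b) := by
  have := hU.intervalIntegrable_speed hab hγ hm
  have h2 := intervalIntegral.continuousOn_primitive_interval'
    (f := speed u γ) (a := a) this left_mem_uIcc
  rwa [uIcc_of_le hab.le] at h2

theorem MetricOn.hasDerivAt_arc (hU : MetricOn u U) {γ : ℝ → E n} {a b : ℝ}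
    (hγ : PiecewiseC1On γ a b) (hm : MapsTo γ (Icc a b) U) {t : ℝ} (ht : t ∈ Ioo a b)
    (hcd : ContDiffAt ℝ 1 γ t) : HasDerivAt (arc u γ a) (speed u γ t) t := by
  have hint := hU.intervalIntegrable_speed (ht.1.trans ht.2) hγ hm
  have hat : IntervalIntegrable (speed u γ) volume a t := hint.mono_set (by
    rw [uIcc_of_le ht.1.le, uIcc_of_le (ht.1.trans ht.2).le]
    exact Icc_subset_Icc le_rfl ht.2.le)
  have hmt : γ t ∈ U := hm ⟨ht.1.le, ht.2.le⟩
  refine intervalIntegral.integral_hasDerivAt_right hat ?_ (hU.continuousAt_speed hcd hmt)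
  refine ⟨Ioo a b, isOpen_Ioo.mem_nhds ht, ?_⟩
  exact ((intervalIntegrable_iff_integrableOn_Ioo_of_le (ht.1.trans ht.2).le).1 hint).1

theorem MetricOn.contDiffOn_arc (hU : MetricOn u U) {γ : ℝ → E n} {a b : ℝ} (hab : a < b)
    (hγ : PiecewiseC1On γ a b) (hm : MapsTo γ (Icc a b) U) {x y : ℝ} (hx : a ≤ x) (hxy : x < y)
    (hy : y ≤ b) (hcd : ContDiffOn ℝ 1 γ (Icc x y)) : ContDiffOn ℝ 1 (arc u γ a) (Icc x y) := by
  obtain ⟨ρ, hρ, he⟩ := hU.speed_eq_on_Ioo hxy hcd (hm.mono_left (Icc_subset_Icc hx hy))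
  have h1 : ContDiff ℝ 1 (fun t => arc u γ a x + ∫ r in x..t, ρ r) := by
    refine contDiff_const.add ?_
    rw [contDiff_one_iff_deriv]
    have hd : ∀ t, HasDerivAt (fun t => ∫ r in x..t, ρ r) (ρ t) t := fun t =>
      intervalIntegral.integral_hasDerivAt_right (hρ.intervalIntegrable _ _)
        hρ.stronglyMeasurable.stronglyMeasurableAtFilter hρ.continuousAt
    exact ⟨fun t => (hd t).differentiableAt, by
      have : deriv (fun t => ∫ r in x..t, ρ r) = ρ := funext fun t => (hd t).deriv
      rwa [this]⟩
  refine h1.contDiffOn.congr fun t ht => ?_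
  have hint := hU.intervalIntegrable_speed hab hγ hm
  have hmono : ∀ p q, p ∈ Icc a b → q ∈ Icc a b → IntervalIntegrable (speed u γ) volume p q := by
    intro p q hp hq
    refine hint.mono_set ?_
    rw [uIcc_of_le hab.le]
    exact uIcc_subset_Icc hp hq
  have hxI : x ∈ Icc a b := ⟨hx, hxy.le.trans hy⟩
  have htI : t ∈ Icc a b := ⟨hx.trans ht.1, ht.2.trans hy⟩
  rw [arc, ← intervalIntegral.integral_add_adjacent_intervals
    (hmono a x (left_mem_Icc.2 hab.le) hxI) (hmono x t hxI htI)]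
  simp only [arc, add_right_inj]
  rw [intervalIntegral.integral_of_le ht.1, intervalIntegral.integral_of_le ht.1,
    integral_Ioc_eq_integral_Ioo, integral_Ioc_eq_integral_Ioo]
  exact setIntegral_congr_fun measurableSet_Ioo
    (fun r hr => he r ⟨hr.1, lt_of_lt_of_le hr.2 ht.2⟩)

theorem MetricOn.gLength_eq_arc (hU : MetricOn u U) {γ : ℝ → E n} {a b : ℝ} (hab : a < b)
    (hγ : PiecewiseC1On γ a b) (hm : MapsTo γ (Icc a b) U) :
    gLength u γ a b = ENNReal.ofReal (arc u γ a b) := by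
  have hint := hU.intervalIntegrable_speed hab hγ hm
  rw [arc, intervalIntegral.integral_of_le hab.le, integral_Ioc_eq_integral_Ioo,
    ofReal_integral_eq_lintegral_ofReal
      ((intervalIntegrable_iff_integrableOn_Ioo_of_le hab.le).1 hint)
      (Eventually.of_forall fun t => speed_nonneg u γ t)]
  rfl

theorem MetricOn.monotoneOn_arc (hU : MetricOn u U) {γ : ℝ → E n} {a b : ℝ} (hab : a < b)
    (hγ : PiecewiseC1On γ a b) (hm : MapsTo γ (Icc a b) U) :
    MonotoneOn (arc u γ a) (Icc a b) := by
  have hγ' := hγ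
  obtain ⟨hc, s, hs⟩ := hγ'
  exact le_of_hasDerivAt_nonneg_off_finset s (hU.continuousOn_arc hab hγ hm)
    (h' := speed u γ) fun t ht hts =>
    ⟨hU.hasDerivAt_arc hγ hm ht (contDiffAt_of_piecewise hs ht hts), speed_nonneg u γ t⟩

end Toric

/-! ### Gluing and reparametrising curves; the two distances. -/

namespace Toric

open Filter Topology

variable {n : ℕ} {u : E n → ℝ} {U : Set (E n)}

/-- The curve that follows `γ` up to the time `c` and then `δ`. -/
noncomputable def glue (γ δ : ℝ → E n) (c t : ℝ) : E n := if t ≤ c then γ t else δ t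

theorem glue_of_le {γ δ : ℝ → E n} {c t : ℝ} (h : t ≤ c) : glue γ δ c t = γ t := if_pos h

theorem glue_of_ge {γ δ : ℝ → E n} {c t : ℝ} (hc : γ c = δ c) (h : c ≤ t) :
    glue γ δ c t = δ t := by
  rcases h.eq_or_lt with rfl | h
  · rw [glue_of_le le_rfl, hc]
  · exact if_neg (not_le.2 h)

theorem continuousOn_glue {γ δ : ℝ → E n} {a b c : ℝ} (hac : a ≤ c) (hcb : c ≤ b) (hc : γ c = δ c)
    (hγ : ContinuousOn γ (Icc a c)) (hδ : ContinuousOn δ (Icc c b)) :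
    ContinuousOn (glue γ δ c) (Icc a b) := by
  rw [← Icc_union_Icc_eq_Icc hac hcb]
  refine ContinuousOn.union_of_isClosed ?_ ?_ isClosed_Icc isClosed_Icc
  · exact hγ.congr fun t ht => glue_of_le ht.2
  · exact hδ.congr fun t ht => glue_of_ge hc ht.1

theorem PiecewiseC1On.glue {γ δ : ℝ → E n} {a b c : ℝ} (hac : a ≤ c) (hcb : c ≤ b) (hc : γ c = δ c)
    (hγ : PiecewiseC1On γ a c) (hδ : PiecewiseC1On δ c b) :
    PiecewiseC1On (glue γ δ c) a b := by
  classical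
  obtain ⟨hγc, s, hs⟩ := hγ
  obtain ⟨hδc, r, hr⟩ := hδ
  refine ⟨continuousOn_glue hac hcb hc hγc hδc, insert c (s ∪ r), fun x y hx hxy hy hxs => ?_⟩
  have hcn : c ∉ Ioo x y := hxs c (by simp)
  rcases le_or_gt y c with hyc | hyc
  · exact (hs x y hx hxy hyc fun t ht => hxs t (by simp [ht])).congr
      fun t ht => glue_of_le (ht.2.trans hyc)
  · have hcx : c ≤ x := by
      by_contra h
      exact hcn ⟨not_le.1 h, hyc⟩
    exact (hr x y hcx hxy hy fun t ht => hxs t (by simp [ht])).congr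
      fun t ht => glue_of_ge hc (hcx.trans ht.1)

theorem gLength_congr {γ δ : ℝ → E n} {a b : ℝ} (h : EqOn γ δ (Ioo a b)) :
    gLength u γ a b = gLength u δ a b := by
  refine setLIntegral_congr_fun measurableSet_Ioo fun t ht => ?_
  have : γ =ᶠ[𝓝 t] δ := h.eventuallyEq_of_mem (isOpen_Ioo.mem_nhds ht)
  simp only [this.deriv_eq, h ht]

theorem gLength_glue {γ δ : ℝ → E n} {a b c : ℝ} (hac : a ≤ c) (hcb : c ≤ b) (hc : γ c = δ c) :
    gLength u (glue γ δ c) a b = gLength u γ a c + gLength u δ c b := by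
  have h1 : gLength u (glue γ δ c) a c = gLength u γ a c :=
    gLength_congr fun t ht => glue_of_le ht.2.le
  have h2 : gLength u (glue γ δ c) c b = gLength u δ c b :=
    gLength_congr fun t ht => glue_of_ge hc ht.1.le
  rw [← h1, ← h2]
  simp only [gLength]
  rw [setLIntegral_congr (Ioo_ae_eq_Ioc (μ := volume) (a := a) (b := b)),
    setLIntegral_congr (Ioo_ae_eq_Ioc (μ := volume) (a := a) (b := c)),
    setLIntegral_congr (Ioo_ae_eq_Ioc (μ := volume) (a := c) (b := b)),
    ← Ioc_union_Ioc_eq_Ioc hac hcb,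
    lintegral_union measurableSet_Ioc (by
      rw [Set.disjoint_left]
      exact fun t ht ht' => absurd ht'.1 (not_lt.2 ht.2))]

theorem affine_image_Icc {m : ℝ} (hm : 0 < m) (k a b : ℝ) :
    MapsTo (fun t => m * t + k) (Icc a b) (Icc (m * a + k) (m * b + k)) := by
  intro t ht
  exact ⟨by nlinarith [ht.1], by nlinarith [ht.2]⟩

theorem PiecewiseC1On.comp_affine {γ : ℝ → E n} {m : ℝ} (hm : 0 < m) (k a b : ℝ)
    (hγ : PiecewiseC1On γ (m * a + k) (m * b + k)) :
    PiecewiseC1On (fun t => γ (m * t + k)) a b := by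
  classical
  obtain ⟨hc, s, hs⟩ := hγ
  refine ⟨hc.comp (by fun_prop) (affine_image_Icc hm k a b),
    s.image (fun r => (r - k) / m), fun x y hx hxy hy hxs => ?_⟩
  refine (hs (m * x + k) (m * y + k) (by nlinarith) (by nlinarith) (by nlinarith)
    fun t ht hti => ?_).comp (by fun_prop) (affine_image_Icc hm k x y)
  refine hxs ((t - k) / m) (Finset.mem_image_of_mem _ ht) ⟨?_, ?_⟩
  · rw [lt_div_iff₀ hm]; nlinarith [hti.1]
  · rw [div_lt_iff₀ hm]; nlinarith [hti.2]

theorem gLength_comp_affine (γ : ℝ → E n) {m : ℝ} (hm : 0 < m) (k a b : ℝ) :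
    gLength u (fun t => γ (m * t + k)) a b = gLength u γ (m * a + k) (m * b + k) := by
  have himg : (fun t => m * t + k) '' Ioo a b = Ioo (m * a + k) (m * b + k) := by
    ext y
    constructor
    · rintro ⟨t, ht, rfl⟩
      exact ⟨by nlinarith [ht.1], by nlinarith [ht.2]⟩
    · intro hy
      refine ⟨(y - k) / m, ⟨?_, ?_⟩, ?_⟩
      · rw [lt_div_iff₀ hm]; nlinarith [hy.1]
      · rw [div_lt_iff₀ hm]; nlinarith [hy.2]
      · field_simp; ring
  rw [gLength, gLength, ← himg, lintegral_image_eq_lintegral_abs_deriv_mul (f' := fun _ => m)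
    measurableSet_Ioo]
  · refine setLIntegral_congr_fun measurableSet_Ioo fun t _ => ?_
    have hd : deriv (fun t => γ (m * t + k)) t = m • deriv γ (m * t + k) := by
      have h1 := deriv_comp_mul_left m (fun s => γ (s + k)) t
      rw [h1, deriv_comp_add_const]
    simp only [hd]
    rw [sqrt_metricForm_smul _ _ _ hm.le, abs_of_pos hm, ENNReal.ofReal_mul hm.le]
  · intro t _
    exact (((hasDerivAt_id t).const_mul m).add_const k).hasDerivWithinAt.congr_deriv (by simp)
  · intro x _ y _ hxy
    have : m * x = m * y := by simpa using hxy
    exact mul_left_cancel₀ hm.ne' this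

/-- The points `x` and `y` are joined by a curve in `K` of length at most `ℓ`. -/
def Conn (u : E n → ℝ) (K : Set (E n)) (x y : E n) (ℓ : ℝ≥0∞) : Prop :=
  ∃ (γ : ℝ → E n) (a b : ℝ), a < b ∧ PiecewiseC1On γ a b ∧ γ a = x ∧ γ b = y ∧
    MapsTo γ (Icc a b) K ∧ gLength u γ a b ≤ ℓ

theorem Conn.mono {K K' : Set (E n)} {x y : E n} {ℓ ℓ' : ℝ≥0∞} (h : Conn u K x y ℓ) (hK : K ⊆ K')
    (hℓ : ℓ ≤ ℓ') : Conn u K' x y ℓ' := by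
  obtain ⟨γ, a, b, hab, h1, h2, h3, h4, h5⟩ := h
  exact ⟨γ, a, b, hab, h1, h2, h3, h4.mono_right hK, h5.trans hℓ⟩

theorem Conn.reparam {K : Set (E n)} {x y : E n} {ℓ : ℝ≥0∞} (h : Conn u K x y ℓ) {a' b' : ℝ}
    (hab' : a' < b') : ∃ γ : ℝ → E n, PiecewiseC1On γ a' b' ∧ γ a' = x ∧ γ b' = y ∧
    MapsTo γ (Icc a' b') K ∧ gLength u γ a' b' ≤ ℓ := by
  obtain ⟨γ, a, b, hab, h1, h2, h3, h4, h5⟩ := h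
  set m := (b - a) / (b' - a') with hm
  have hba : 0 < b' - a' := by linarith
  have hmp : 0 < m := div_pos (by linarith) hba
  have ha : m * a' + (a - m * a') = a := by ring
  have hb : m * b' + (a - m * a') = b := by rw [hm]; field_simp; ring
  refine ⟨fun t => γ (m * t + (a - m * a')), ?_, ?_, ?_, ?_, ?_⟩
  · apply PiecewiseC1On.comp_affine hmp
    rwa [ha, hb]
  · simp only [ha, h2]
  · simp only [hb, h3]
  · have := affine_image_Icc hmp (a - m * a') a' b'
    rw [ha, hb] at this
    exact h4.comp this
  · rwa [gLength_comp_affine γ hmp, ha, hb]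

theorem Conn.trans {K : Set (E n)} {x y z : E n} {ℓ ℓ' : ℝ≥0∞} (h : Conn u K x y ℓ)
    (h' : Conn u K y z ℓ') : Conn u K x z (ℓ + ℓ') := by
  obtain ⟨γ, h1, h2, h3, h4, h5⟩ := h.reparam (show (0 : ℝ) < 1 by norm_num)
  obtain ⟨δ, k1, k2, k3, k4, k5⟩ := h'.reparam (show (1 : ℝ) < 2 by norm_num)
  have hc : γ 1 = δ 1 := h3.trans k2.symm
  refine ⟨glue γ δ 1, 0, 2, by norm_num, h1.glue (by norm_num) (by norm_num) hc k1, ?_, ?_, ?_, ?_⟩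
  · rw [glue_of_le (by norm_num), h2]
  · rw [glue_of_ge hc (by norm_num), k3]
  · intro t ht
    rcases le_total t 1 with h | h
    · rw [glue_of_le h]; exact h4 ⟨ht.1, h⟩
    · rw [glue_of_ge hc h]; exact k4 ⟨h, ht.2⟩
  · rw [gLength_glue (by norm_num) (by norm_num) hc]
    exact add_le_add h5 k5

theorem Conn.of_curve {K : Set (E n)} {γ : ℝ → E n} {a b : ℝ} (hab : a < b)
    (hγ : PiecewiseC1On γ a b) (hm : MapsTo γ (Icc a b) K) :
    Conn u K (γ a) (γ b) (gLength u γ a b) :=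
  ⟨γ, a, b, hab, hγ, rfl, rfl, hm, le_rfl⟩

theorem ContDiffOn.piecewiseC1On {γ : ℝ → E n} {a b : ℝ} (h : ContDiffOn ℝ 1 γ (Icc a b)) :
    PiecewiseC1On γ a b :=
  ⟨h.continuousOn, ∅, fun _ _ hx _ hy _ => h.mono (Icc_subset_Icc hx hy)⟩

theorem Conn.segment {K : Set (E n)} {x v : E n} {k : ℝ}
    (hK : ∀ t ∈ Icc (0 : ℝ) 1, x + t • v ∈ K)
    (hk : ∀ t ∈ Icc (0 : ℝ) 1, Real.sqrt (metricForm u (x + t • v) v) ≤ k) :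
    Conn u K x (x + v) (ENNReal.ofReal k) := by
  refine ⟨fun t => x + t • v, 0, 1, by norm_num, ?_, by simp, by simp, hK, ?_⟩
  · exact ContDiffOn.piecewiseC1On (by fun_prop)
  · have hd : ∀ t : ℝ, deriv (fun t : ℝ => x + t • v) t = v := fun t => by
      have := ((hasDerivAt_id t).smul_const v).const_add x
      simpa using this.deriv
    calc gLength u (fun t => x + t • v) 0 1
        ≤ ∫⁻ t in Ioo (0 : ℝ) 1, ENNReal.ofReal k := by
          refine setLIntegral_mono measurable_const fun t ht => ?_
          rw [hd]
          exact ENNReal.ofReal_le_ofReal (hk t (Ioo_subset_Icc_self ht))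
      _ = _ := by simp

theorem Conn.refl {K : Set (E n)} {x : E n} (hx : x ∈ K) : Conn u K x x 0 := by
  have := Conn.segment (u := u) (K := K) (x := x) (v := 0) (k := 0) (fun t _ => by simpa using hx)
    (fun t _ => by simp [metricForm])
  simpa using this

section Distance

variable {P : DelzantPolytope n} {x y z : E n}

theorem gDist_le_of_conn {ℓ : ℝ≥0∞} (h : Conn u P.inner x y ℓ) : gDist P u x y ≤ ℓ := by
  obtain ⟨γ, h1, h2, h3, h4, h5⟩ := h.reparam (show (0 : ℝ) < 1 by norm_num)
  exact (iInf₂_le γ ⟨h1, h2, h3, h4⟩).trans h5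

theorem conn_of_gDist_lt {ℓ : ℝ≥0∞} (h : gDist P u x y < ℓ) : Conn u P.inner x y ℓ := by
  simp only [gDist, iInf_lt_iff] at h
  obtain ⟨γ, ⟨h1, h2, h3, h4⟩, h5⟩ := h
  exact ⟨γ, 0, 1, by norm_num, h1, h2, h3, h4, h5.le⟩

theorem gDist_self (hx : x ∈ P.inner) : gDist P u x x = 0 :=
  le_antisymm (gDist_le_of_conn (Conn.refl hx)) bot_le

theorem gDist_triangle : gDist P u x z ≤ gDist P u x y + gDist P u y z := by
  refine ENNReal.le_of_forall_pos_le_add fun ε hε hlt => ?_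
  have hε2 : (0 : ℝ≥0∞) < ε / 2 := by simpa using hε.ne'
  have h1 : gDist P u x y < gDist P u x y + ε / 2 :=
    ENNReal.lt_add_right (lt_of_le_of_lt le_self_add hlt).ne hε2.ne'
  have h2 : gDist P u y z < gDist P u y z + ε / 2 :=
    ENNReal.lt_add_right (lt_of_le_of_lt le_add_self hlt).ne hε2.ne'
  refine (gDist_le_of_conn ((conn_of_gDist_lt h1).trans (conn_of_gDist_lt h2))).trans_eq ?_
  rw [add_add_add_comm, ENNReal.add_halves]

/-- The point `x` is joined to the boundary by a curve of length at most `ℓ`. -/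
def ConnBoundary (P : DelzantPolytope n) (u : E n → ℝ) (x : E n) (ℓ : ℝ≥0∞) : Prop :=
  ∃ γ : ℝ → E n, (ContinuousOn γ (Icc 0 1) ∧ (∀ b ∈ Ioo (0 : ℝ) 1, PiecewiseC1On γ 0 b) ∧
      γ 0 = x ∧ γ 1 ∈ P.boundary ∧ ∀ t ∈ Ico (0 : ℝ) 1, γ t ∈ P.inner) ∧ gLength u γ 0 1 ≤ ℓ

theorem ConnBoundary.gDistBoundary_le {ℓ : ℝ≥0∞} (h : ConnBoundary P u x ℓ) :
    gDistBoundary P u x ≤ ℓ := by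
  obtain ⟨γ, h1, h2⟩ := h
  exact (iInf₂_le γ h1).trans h2

theorem Conn.connBoundary {ℓ ℓ' : ℝ≥0∞} (h : Conn u P.inner x y ℓ) (h' : ConnBoundary P u y ℓ') :
    ConnBoundary P u x (ℓ + ℓ') := by
  obtain ⟨γ, h1, h2, h3, h4, h5⟩ := h.reparam (show (0 : ℝ) < 1 / 2 by norm_num)
  obtain ⟨δ, ⟨k1, k2, k3, k4, k5⟩, k6⟩ := h'
  set ε : ℝ → E n := fun t => δ (2 * t + (-1)) with hε
  have e0 : (2 : ℝ) * (1 / 2) + (-1) = 0 := by norm_num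
  have e1 : (2 : ℝ) * 1 + (-1) = 1 := by norm_num
  have hc : γ (1 / 2) = ε (1 / 2) := by simp only [hε, e0]; rw [h3, k3]
  have hmaps := affine_image_Icc (show (0 : ℝ) < 2 by norm_num) (-1) (1 / 2) 1
  rw [e0, e1] at hmaps
  refine ⟨Toric.glue γ ε (1 / 2), ⟨?_, ?_, ?_, ?_, ?_⟩, ?_⟩
  · exact continuousOn_glue (by norm_num) (by norm_num) hc h1.1
      (k1.comp (by fun_prop) hmaps)
  -- The second piece is piecewise C¹ only before it reaches the boundary, so regularity is checked
  -- on each `[0, b]` with `b < 1`.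
  · intro b hb
    rcases le_or_gt b (1 / 2) with hb2 | hb2
    · obtain ⟨hc1, s, hs⟩ := h1.mono le_rfl hb2
      refine ⟨hc1.congr fun t ht => glue_of_le (ht.2.trans hb2), s, fun x y hx hxy hy hxs => ?_⟩
      exact (hs x y hx hxy hy hxs).congr fun t ht => glue_of_le (ht.2.trans (hy.trans hb2))
    · refine h1.glue (by norm_num) hb2.le hc (PiecewiseC1On.comp_affine (by norm_num) _ _ _ ?_)
      rw [e0]
      exact k2 _ ⟨by linarith, by linarith [hb.2]⟩
  · rw [glue_of_le (by norm_num), h2]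
  · rw [glue_of_ge hc (by norm_num)]
    simpa only [hε, e1] using k4
  · intro t ht
    rcases le_total t (1 / 2) with h | h
    · rw [glue_of_le h]; exact h4 ⟨ht.1, h⟩
    · rw [glue_of_ge hc h]
      exact k5 _ ⟨by linarith, by linarith [ht.2]⟩
  · rw [gLength_glue (by norm_num) (by norm_num) hc]
    refine add_le_add h5 ?_
    rw [hε, gLength_comp_affine δ (by norm_num), e0, e1]
    exact k6

/-- In this form a lower bound α on the distance to the boundary passes to the end of a curve of
length ℓ, as α - ℓ. -/
theorem gDistBoundary_le_add {ℓ : ℝ≥0∞} (h : Conn u P.inner x y ℓ) :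
    gDistBoundary P u x ≤ ℓ + gDistBoundary P u y := by
  refine ENNReal.le_of_forall_pos_le_add fun ε hε hlt => ?_
  have hy : gDistBoundary P u y < gDistBoundary P u y + ε := by
    refine ENNReal.lt_add_right ?_ (by exact_mod_cast hε.ne')
    exact (lt_of_le_of_lt le_add_self hlt).ne
  have hy' := hy
  conv_lhs at hy => rw [gDistBoundary]
  simp only [iInf_lt_iff] at hy
  obtain ⟨γ, h1, h2⟩ := hy
  have := (h.connBoundary ⟨γ, h1, h2.le⟩).gDistBoundary_le
  rwa [← add_assoc] at this

end Distance

end Toric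

/-! ### Uniform Taylor bounds; variation of tangent vectors along a gradient field. -/

namespace Toric

open Filter Topology

theorem natCast_le_infty (m : ℕ) : (m : WithTop ℕ∞) ≤ (∞ : WithTop ℕ∞) := by
  exact WithTop.coe_le_coe.2 le_top

/-- A C² function has a locally Lipschitz derivative, and the mean value inequality on the segment
from `(0, z)` to `(t, z)` then bounds the remainder uniformly for `z` near `z₀`. -/
theorem exists_taylor_bound_nhds {Z : Type*} [NormedAddCommGroup Z] [NormedSpace ℝ Z]
    {Φ : ℝ × Z → ℝ} {z₀ : Z} (h : ContDiffAt ℝ 2 Φ (0, z₀)) :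
    ∃ N ∈ 𝓝 z₀, ∃ C t₀ : ℝ, 0 ≤ C ∧ 0 < t₀ ∧ ∀ z ∈ N, ∀ t : ℝ, |t| ≤ t₀ →
      ∀ d, HasDerivAt (fun t => Φ (t, z)) d 0 → |Φ (t, z) - Φ (0, z) - t * d| ≤ C * t ^ 2 := by
  have h1 : ContDiffAt ℝ 1 (fderiv ℝ Φ) (0, z₀) := h.fderiv_right (by norm_num)
  obtain ⟨C, T, hT, hlip⟩ := h1.exists_lipschitzOnWith
  have hdiff : ∀ᶠ y in 𝓝 ((0 : ℝ), z₀), DifferentiableAt ℝ Φ y := by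
    filter_upwards [h.eventually (by simp)] with y hy using hy.differentiableAt (by norm_num)
  obtain ⟨r, hr, hball⟩ := Metric.mem_nhds_iff.1 (inter_mem hT hdiff)
  refine ⟨Metric.ball z₀ r, Metric.ball_mem_nhds _ hr, C, r / 2, C.2, by linarith, ?_⟩
  intro z hz t ht d hd
  have hmem : ∀ s : ℝ, |s| ≤ r / 2 → ((s, z) : ℝ × Z) ∈ T ∩ {y | DifferentiableAt ℝ Φ y} := by
    intro s hs
    apply hball
    rw [Metric.mem_ball, Prod.dist_eq, max_lt_iff]
    exact ⟨by simp only [dist_zero_right, Real.norm_eq_abs]; linarith, hz⟩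
  have h0 := hmem 0 (by simp; linarith)
  have hd' : fderiv ℝ Φ (0, z) (1, 0) = d := by
    have h2 : HasDerivAt (fun t : ℝ => ((t, z) : ℝ × Z)) (1, 0) 0 :=
      (hasDerivAt_id (0 : ℝ)).prodMk (hasDerivAt_const _ _)
    have h3 := (h0.2.hasFDerivAt).comp_hasDerivAt (0 : ℝ) h2
    exact h3.unique hd
  have hseg : Convex ℝ ((fun s : ℝ => ((s, z) : ℝ × Z)) '' Icc (-|t|) |t|) := by
    have : ((fun s : ℝ => ((s, z) : ℝ × Z)) '' Icc (-|t|) |t|) = Icc (-|t|) |t| ×ˢ {z} := by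
      ext ⟨a, b⟩; simp [and_comm, eq_comm]
    rw [this]
    exact (convex_Icc _ _).prod (convex_singleton _)
  have key := hseg.norm_image_sub_le_of_norm_hasFDerivWithin_le' (f := Φ) (f' := fderiv ℝ Φ)
    (φ := fderiv ℝ Φ (0, z)) (C := C * |t|) (x := (0, z)) (y := (t, z)) ?_ ?_
    ⟨0, by simp, rfl⟩ ⟨t, ⟨neg_abs_le t, le_abs_self t⟩, rfl⟩
  · have e : ((t, z) : ℝ × Z) - (0, z) = t • (1, 0) := by simp
    rw [e, map_smul, hd', smul_eq_mul, Real.norm_eq_abs, norm_smul] at key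
    refine key.trans_eq ?_
    simp only [Real.norm_eq_abs, Prod.norm_def, norm_one, norm_zero]
    rw [max_eq_left (by norm_num), mul_one, mul_assoc, ← sq, sq_abs]
  · rintro _ ⟨s, hs, rfl⟩
    exact (hmem s ((abs_le.2 hs).trans ht)).2.hasFDerivAt.hasFDerivWithinAt
  · rintro _ ⟨s, hs, rfl⟩
    have hs' := abs_le.2 hs
    have := hlip.norm_sub_le (hmem s (hs'.trans ht)).1 h0.1
    refine this.trans ?_
    have e : ((s, z) : ℝ × Z) - (0, z) = (s, 0) := by simp
    rw [e]
    gcongr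
    simpa [Prod.norm_def] using hs'

/-- Taylor's formula of first order, with a remainder uniform over a compact set of parameters. -/
theorem exists_taylor_bound {Z : Type*} [NormedAddCommGroup Z] [NormedSpace ℝ Z]
    {Φ : ℝ × Z → ℝ} {K : Set Z} (hK : IsCompact K) (h : ∀ z ∈ K, ContDiffAt ℝ 2 Φ (0, z)) :
    ∃ C t₀ : ℝ, 0 ≤ C ∧ 0 < t₀ ∧ ∀ z ∈ K, ∀ t : ℝ, |t| ≤ t₀ →
      ∀ d, HasDerivAt (fun t => Φ (t, z)) d 0 → |Φ (t, z) - Φ (0, z) - t * d| ≤ C * t ^ 2 := by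
  refine hK.induction_on (p := fun K => ∃ C t₀ : ℝ, 0 ≤ C ∧ 0 < t₀ ∧ ∀ z ∈ K, ∀ t : ℝ, |t| ≤ t₀ →
      ∀ d, HasDerivAt (fun t => Φ (t, z)) d 0 → |Φ (t, z) - Φ (0, z) - t * d| ≤ C * t ^ 2) ?_ ?_ ?_ ?_
  · exact ⟨0, 1, le_rfl, one_pos, by simp⟩
  · rintro s t hst ⟨C, t₀, h1, h2, h3⟩
    exact ⟨C, t₀, h1, h2, fun z hz => h3 z (hst hz)⟩
  · rintro s s' ⟨C, t₀, h1, h2, h3⟩ ⟨C', t₀', h1', h2', h3'⟩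
    refine ⟨max C C', min t₀ t₀', le_max_of_le_left h1, lt_min h2 h2', ?_⟩
    rintro z (hz | hz) t ht d hd
    · refine (h3 z hz t (ht.trans (min_le_left _ _)) d hd).trans ?_
      gcongr
      exact le_max_left _ _
    · refine (h3' z hz t (ht.trans (min_le_right _ _)) d hd).trans ?_
      gcongr
      exact le_max_right _ _
  · intro z hz
    obtain ⟨N, hN, h1⟩ := exists_taylor_bound_nhds (h z hz)
    exact ⟨N, mem_nhdsWithin_of_mem_nhds hN, h1⟩

variable {n : ℕ} {u : E n → ℝ} {U : Set (E n)}

/-- The metric `u_{ij}` on `U` is given by the smooth field `G` of inner products. -/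
structure HessMetric (u : E n → ℝ) (U : Set (E n)) (G : E n → E n →L[ℝ] E n →L[ℝ] ℝ) : Prop where
  isOpen : IsOpen U
  smooth : ContDiffOn ℝ ∞ G U
  symm : ∀ x ∈ U, ∀ v w, G x v w = G x w v
  pos : ∀ x ∈ U, ∀ v, v ≠ 0 → 0 < G x v v
  eq : ∀ x ∈ U, ∀ w, metricForm u x w = G x w w

variable {G : E n → E n →L[ℝ] E n →L[ℝ] ℝ}

theorem HessMetric.nonneg (hG : HessMetric u U G) {x : E n} (hx : x ∈ U) (v : E n) :
    0 ≤ G x v v := by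
  rcases eq_or_ne v 0 with rfl | hv
  · simp
  · exact (hG.pos x hx v hv).le

theorem HessMetric.contOn (hG : HessMetric u U G) :
    ContinuousOn (fun z : E n × E n => G z.1 z.2 z.2) (U ×ˢ univ) := by
  have h1 : ContinuousOn (fun z : E n × E n => G z.1) (U ×ˢ univ) :=
    hG.smooth.continuousOn.comp continuousOn_fst fun z hz => hz.1
  exact (h1.clm_apply continuousOn_snd).clm_apply continuousOn_snd

theorem HessMetric.metricOn (hG : HessMetric u U G) : MetricOn u U where
  isOpen := hG.isOpen
  cont := hG.contOn.congr fun z hz => hG.eq z.1 hz.1 z.2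
  nonneg x hx w := by rw [hG.eq x hx]; exact hG.nonneg hx w

theorem HessMetric.sq_le (hG : HessMetric u U G) {x : E n} (hx : x ∈ U) (v w : E n) :
    (G x v w) ^ 2 ≤ G x v v * G x w w := by
  have key : ∀ s : ℝ, 0 ≤ G x w w * (s * s) + (2 * G x v w) * s + G x v v := by
    intro s
    have := hG.nonneg hx (v + s • w)
    simp only [map_add, map_smul, add_apply, smul_apply,
      smul_eq_mul] at this
    rw [hG.symm x hx w v] at this
    linarith
  have := discrim_le_zero key
  rw [discrim] at this
  nlinarith

theorem HessMetric.exists_bounds (hG : HessMetric u U G) {K : Set (E n)} (hK : IsCompact K)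
    (hKU : K ⊆ U) : ∃ c R : ℝ, 0 < c ∧ 0 ≤ R ∧ ∀ x ∈ K, ∀ v : E n, ‖v‖ = 1 →
      c ≤ G x v v ∧ G x v v ≤ R := by
  have hS : IsCompact (K ×ˢ Metric.sphere (0 : E n) 1) := hK.prod (isCompact_sphere 0 1)
  have hcont : ContinuousOn (fun z : E n × E n => G z.1 z.2 z.2) (K ×ˢ Metric.sphere (0 : E n) 1) :=
    hG.contOn.mono (prod_mono hKU (subset_univ _))
  rcases (K ×ˢ Metric.sphere (0 : E n) 1).eq_empty_or_nonempty with he | hne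
  · refine ⟨1, 0, one_pos, le_rfl, fun x hx v hv => ?_⟩
    have : (x, v) ∈ K ×ˢ Metric.sphere (0 : E n) 1 := ⟨hx, by simpa using hv⟩
    rw [he] at this
    exact this.elim
  · obtain ⟨z, hz, hmin⟩ := hS.exists_isMinOn hne hcont
    obtain ⟨y, hy, hmax⟩ := hS.exists_isMaxOn hne hcont
    have hz2 : z.2 ≠ 0 := by
      intro h
      have := hz.2
      simp [h] at this
    refine ⟨G z.1 z.2 z.2, G y.1 y.2 y.2, hG.pos _ (hKU hz.1) _ hz2, hG.nonneg (hKU hy.1) _,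
      fun x hx v hv => ?_⟩
    have hm : (x, v) ∈ K ×ˢ Metric.sphere (0 : E n) 1 := ⟨hx, by simpa using hv⟩
    exact ⟨hmin hm, hmax hm⟩

/-- First variation of the squared length of a tangent vector under the flow direction `X`. -/
theorem HessMetric.exists_variation_bound (hG : HessMetric u U G) {X : E n → E n}
    (hX : ContDiffOn ℝ ∞ X U) {K : Set (E n)} (hK : IsCompact K) (hKU : K ⊆ U) (M : ℝ) :
    ∃ C t₀ : ℝ, 0 ≤ C ∧ 0 < t₀ ∧ ∀ x ∈ K, ∀ a ∈ Icc (-M) M, ∀ b ∈ Icc (-M) M, ∀ v : E n,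
      ∀ t ∈ Icc 0 t₀, x + (t * a) • X x ∈ U ∧
      G (x + (t * a) • X x) (v + t • ((b * √(G x v v)) • X x + a • fderiv ℝ X x v))
        (v + t • ((b * √(G x v v)) • X x + a • fderiv ℝ X x v)) ≤
      G x v v + 2 * t * (b * √(G x v v) * G x (X x) v +
        a * (1 / 2 * fderiv ℝ G x (X x) v v + G x v (fderiv ℝ X x v))) + C * t ^ 2 * G x v v := by
  obtain ⟨c, R, hc, hR, hcR⟩ := hG.exists_bounds hK hKU
  -- After `v` is scaled to a unit vector `e`, the coefficient of `X x` is `b * √(G x e e)`, which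
  -- ranges over a compact interval; it replaces `b` as parameter because the square root need not
  -- be smooth in `v`.
  set B := |M| * √R with hB
  -- parameters `(x, v, a, b)`
  let Kz : Set (E n × E n × ℝ × ℝ) :=
    K ×ˢ Metric.sphere (0 : E n) 1 ×ˢ Icc (-M) M ×ˢ Icc (-B) B
  have hKz : IsCompact Kz := hK.prod ((isCompact_sphere 0 1).prod (isCompact_Icc.prod isCompact_Icc))
  let pt : ℝ × E n × E n × ℝ × ℝ → E n := fun q => q.2.1 + (q.1 * q.2.2.2.1) • X q.2.1
  let vec : ℝ × E n × E n × ℝ × ℝ → E n := fun q =>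
    q.2.2.1 + q.1 • (q.2.2.2.2 • X q.2.1 + q.2.2.2.1 • fderiv ℝ X q.2.1 q.2.2.1)
  have hXat : ∀ x ∈ U, ContDiffAt ℝ ∞ X x := fun x hx => hX.contDiffAt (hG.isOpen.mem_nhds hx)
  have hGat : ∀ x ∈ U, ContDiffAt ℝ ∞ G x := fun x hx => hG.smooth.contDiffAt (hG.isOpen.mem_nhds hx)
  have hXc : ∀ z : E n × E n × ℝ × ℝ, z.1 ∈ U → ContDiffAt ℝ 2
      (fun q : ℝ × E n × E n × ℝ × ℝ => X q.2.1) (0, z) := fun z hz =>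
    ContDiffAt.comp (f := fun q : ℝ × E n × E n × ℝ × ℝ => q.2.1) (0, z)
      ((hXat z.1 hz).of_le (natCast_le_infty 2)) (by fun_prop)
  have hDX : ∀ z : E n × E n × ℝ × ℝ, z.1 ∈ U → ContDiffAt ℝ 2
      (fun q : ℝ × E n × E n × ℝ × ℝ => fderiv ℝ X q.2.1) (0, z) := fun z hz =>
    ContDiffAt.comp (f := fun q : ℝ × E n × E n × ℝ × ℝ => q.2.1) (0, z)
      ((hXat z.1 hz).fderiv_right (m := 2) (natCast_le_infty 3)) (by fun_prop)
  have hpt : ∀ z : E n × E n × ℝ × ℝ, z.1 ∈ U → ContDiffAt ℝ 2 pt (0, z) := fun z hz => by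
    have := hXc z hz
    have h2 : ContDiffAt ℝ 2 (fun q : ℝ × E n × E n × ℝ × ℝ => q.1 * q.2.2.2.1) (0, z) := by fun_prop
    exact ContDiffAt.add (by fun_prop) (h2.smul this)
  have hvec : ∀ z : E n × E n × ℝ × ℝ, z.1 ∈ U → ContDiffAt ℝ 2 vec (0, z) := fun z hz => by
    have h1 := hXc z hz
    have h2 : ContDiffAt ℝ 2 (fun q : ℝ × E n × E n × ℝ × ℝ => fderiv ℝ X q.2.1 q.2.2.1) (0, z) :=
      (hDX z hz).clm_apply (by fun_prop)
    have g1 : ContDiffAt ℝ 2 (fun q : ℝ × E n × E n × ℝ × ℝ => q.2.2.1) (0, z) := by fun_prop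
    have g2 : ContDiffAt ℝ 2 (fun q : ℝ × E n × E n × ℝ × ℝ => q.1) (0, z) := by fun_prop
    have g3 : ContDiffAt ℝ 2 (fun q : ℝ × E n × E n × ℝ × ℝ => q.2.2.2.2) (0, z) := by fun_prop
    have g4 : ContDiffAt ℝ 2 (fun q : ℝ × E n × E n × ℝ × ℝ => q.2.2.2.1) (0, z) := by fun_prop
    exact g1.add (g2.smul ((g3.smul h1).add (g4.smul h2)))
  let Φ : ℝ × E n × E n × ℝ × ℝ → ℝ := fun q => G (pt q) (vec q) (vec q)
  have hpt0 : ∀ z, pt (0, z) = z.1 := fun z => by simp [pt]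
  have hΦ : ∀ z ∈ Kz, ContDiffAt ℝ 2 Φ (0, z) := fun z hz => by
    have hzU := hKU hz.1
    have h1 : ContDiffAt ℝ 2 (fun q => G (pt q)) (0, z) :=
      ContDiffAt.comp (f := pt) (0, z)
        (by rw [hpt0]; exact (hGat z.1 hzU).of_le (natCast_le_infty 2)) (hpt z hzU)
    exact (h1.clm_apply (hvec z hzU)).clm_apply (hvec z hzU)
  obtain ⟨C, t₁, hC, ht₁, hmain⟩ := exists_taylor_bound hKz hΦ
  -- the displaced points stay in `U`
  have hstay : ∃ t₂ > 0, ∀ x ∈ K, ∀ s : ℝ, |s| ≤ t₂ → x + s • X x ∈ U := by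
    have hXK : ContinuousOn X K := hX.continuousOn.mono hKU
    obtain ⟨D, hD⟩ := hK.exists_bound_of_continuousOn hXK
    obtain ⟨δ, hδ, hsub⟩ := hK.exists_thickening_subset_open hG.isOpen hKU
    refine ⟨δ / (2 * (|D| + 1)), by positivity, fun x hx s hs => hsub ?_⟩
    rw [Metric.mem_thickening_iff]
    refine ⟨x, hx, ?_⟩
    rw [dist_eq_norm, add_sub_cancel_left, norm_smul, Real.norm_eq_abs]
    have h1 : ‖X x‖ ≤ |D| + 1 := (hD x hx).trans ((le_abs_self D).trans (by linarith))
    calc |s| * ‖X x‖ ≤ δ / (2 * (|D| + 1)) * (|D| + 1) := by gcongr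
      _ = δ / 2 := by field_simp
      _ < δ := by linarith
  obtain ⟨t₂, ht₂, hst⟩ := hstay
  -- Dividing by the least value `c` of the metric on unit vectors makes the error proportional to
  -- `G x v v`.
  refine ⟨C / c, min t₁ (t₂ / (|M| + 1)), by positivity, by positivity, ?_⟩
  intro x hx a ha b hb v t ht
  have hxU := hKU hx
  have haM : |a| ≤ |M| := (abs_le.2 ha).trans (le_abs_self M)
  have hbM : |b| ≤ |M| := (abs_le.2 hb).trans (le_abs_self M)
  have htt : |t| ≤ t₁ := by rw [abs_of_nonneg ht.1]; exact ht.2.trans (min_le_left _ _)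
  refine ⟨?_, ?_⟩
  · apply hst x hx
    rw [abs_mul, abs_of_nonneg ht.1]
    calc t * |a| ≤ t₂ / (|M| + 1) * (|M| + 1) := by
          gcongr
          · exact ht.2.trans (min_le_right _ _)
          · linarith
      _ = t₂ := by field_simp
  rcases eq_or_ne v 0 with rfl | hv
  · simp
  -- reduce to unit vectors by homogeneity
  have hvn : 0 < ‖v‖ := norm_pos_iff.2 hv
  set e : E n := ‖v‖⁻¹ • v with he
  have hen : ‖e‖ = 1 := by rw [he, norm_smul, norm_inv, norm_norm, inv_mul_cancel₀ hvn.ne']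
  have hve : v = ‖v‖ • e := by rw [he, smul_smul, mul_inv_cancel₀ hvn.ne', one_smul]
  obtain ⟨hce, hRe⟩ := hcR x hx e hen
  set ρ := √(G x e e) with hρ
  have hz : (x, e, a, b * ρ) ∈ Kz := by
    refine ⟨hx, by simpa using hen, ha, ?_⟩
    refine abs_le.1 ?_
    rw [abs_mul, abs_of_nonneg (Real.sqrt_nonneg _), hB]
    gcongr
  have hcd : HasDerivAt (fun t => Φ (t, x, e, a, b * ρ)) (2 * (b * ρ * G x (X x) e +
        a * (1 / 2 * fderiv ℝ G x (X x) e e + G x e (fderiv ℝ X x e)))) 0 := by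
    have h1 : HasDerivAt (fun t : ℝ => pt (t, x, e, a, b * ρ)) (a • X x) 0 := by
      have := (((hasDerivAt_id (0 : ℝ)).mul_const a).smul_const (X x)).const_add x
      simpa [pt] using this
    have h2 : HasDerivAt (fun t : ℝ => vec (t, x, e, a, b * ρ))
        ((b * ρ) • X x + a • fderiv ℝ X x e) 0 := by
      have := ((hasDerivAt_id (0 : ℝ)).smul_const ((b * ρ) • X x + a • fderiv ℝ X x e)).const_add e
      simpa [vec] using this
    have h3 : HasDerivAt (fun t : ℝ => G (pt (t, x, e, a, b * ρ))) (fderiv ℝ G x (a • X x)) 0 := by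
      have hg : HasFDerivAt G (fderiv ℝ G x) (pt (0, x, e, a, b * ρ)) := by
        rw [hpt0]
        exact ((hGat x hxU).differentiableAt (by simp)).hasFDerivAt
      exact HasFDerivAt.comp_hasDerivAt (E := E n →L[ℝ] E n →L[ℝ] ℝ) (0 : ℝ) hg h1
    have h4 := (h3.clm_apply h2).clm_apply h2
    refine h4.congr_deriv ?_
    have e1 : pt (0, x, e, a, b * ρ) = x := hpt0 _
    have e2 : vec (0, x, e, a, b * ρ) = e := by simp [vec]
    simp only [e1, e2, add_apply, map_add, map_smul,
      smul_apply, smul_eq_mul]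
    rw [hG.symm x hxU e (X x), hG.symm x hxU (fderiv ℝ X x e) e]
    ring
  have hk := hmain _ hz t htt _ hcd
  have hk' := (abs_le.1 hk).2
  have hΦ0 : Φ (0, x, e, a, b * ρ) = G x e e := by simp [Φ, pt, vec]
  have hvv : G x v v = ‖v‖ ^ 2 * G x e e := by
    conv_lhs => rw [hve]
    simp only [map_smul, smul_apply, smul_eq_mul]; ring
  have hsq : √(G x v v) = ‖v‖ * ρ := by
    rw [hvv, Real.sqrt_mul (sq_nonneg _), Real.sqrt_sq hvn.le]
  have hvec' : v + t • ((b * √(G x v v)) • X x + a • fderiv ℝ X x v) =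
      ‖v‖ • vec (t, x, e, a, b * ρ) := by
    rw [hsq]
    have : fderiv ℝ X x v = ‖v‖ • fderiv ℝ X x e := by
      conv_lhs => rw [hve]
      rw [map_smul]
    rw [this]
    conv_lhs => enter [1]; rw [hve]
    simp only [vec]
    module
  rw [hvec', hsq, hvv]
  have hL : G (x + (t * a) • X x) (‖v‖ • vec (t, x, e, a, b * ρ)) (‖v‖ • vec (t, x, e, a, b * ρ)) =
      ‖v‖ ^ 2 * Φ (t, x, e, a, b * ρ) := by
    simp only [map_smul, smul_apply, smul_eq_mul, Φ, pt]; ring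
  have hR1 : b * (‖v‖ * ρ) * G x (X x) v +
        a * (1 / 2 * fderiv ℝ G x (X x) v v + G x v (fderiv ℝ X x v)) = ‖v‖ ^ 2 *
      (b * ρ * G x (X x) e + a * (1 / 2 * fderiv ℝ G x (X x) e e + G x e (fderiv ℝ X x e))) := by
    have : ∀ w : E n, ‖v‖ • e = w → b * (‖v‖ * ρ) * G x (X x) w +
        a * (1 / 2 * fderiv ℝ G x (X x) w w + G x w (fderiv ℝ X x w)) = ‖v‖ ^ 2 *
      (b * ρ * G x (X x) e + a * (1 / 2 * fderiv ℝ G x (X x) e e + G x e (fderiv ℝ X x e))) := by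
      rintro w rfl
      simp only [map_smul, smul_apply, smul_eq_mul]; ring
    exact this v hve.symm
  rw [hL, hR1]
  have hCc : C * t ^ 2 ≤ C / c * t ^ 2 * G x e e := by
    have : C = C / c * c := by field_simp
    calc C * t ^ 2 = C / c * t ^ 2 * c := by rw [this]; field_simp
      _ ≤ _ := by gcongr
  have hfin : Φ (t, x, e, a, b * ρ) ≤ G x e e + t * (2 * (b * ρ * G x (X x) e +
        a * (1 / 2 * fderiv ℝ G x (X x) e e + G x e (fderiv ℝ X x e)))) +
        C / c * t ^ 2 * G x e e := by
    rw [hΦ0] at hk'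
    linarith
  calc _ ≤ ‖v‖ ^ 2 * _ := mul_le_mul_of_nonneg_left hfin (sq_nonneg _)
    _ = _ := by ring

/-- `f` is a positive function with gradient `X` whose Hessian is at most `f` times the metric. -/
structure SinhConcave (G : E n → E n →L[ℝ] E n →L[ℝ] ℝ) (U : Set (E n)) (f : E n → ℝ)
    (X : E n → E n) : Prop where
  smooth : ContDiffOn ℝ ∞ f U
  smooth_grad : ContDiffOn ℝ ∞ X U
  pos : ∀ x ∈ U, 0 < f x
  grad : ∀ x ∈ U, ∀ v, G x (X x) v = fderiv ℝ f x v
  -- The left side is half the Lie derivative of the metric along the gradient `X`, which is the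
  -- Riemannian Hessian of `f`; stated so, it needs no connection.
  hess_le : ∀ x ∈ U, ∀ v,
    1 / 2 * fderiv ℝ G x (X x) v v + G x v (fderiv ℝ X x v) ≤ f x * G x v v

/-- By `2 r h - r² ≤ h²`. It turns a first-order bound on the squared speed into one on the speed
without dividing by `r`, the speed of the original curve, which may vanish. -/
theorem sqrt_le_of_le_two_mul {e r h : ℝ} (he : 0 ≤ e) (hr : 0 ≤ r) (hr0 : r = 0 → 0 ≤ h)
    (h1 : e ≤ 2 * r * h - r ^ 2) : √e ≤ h := by
  have hh : 0 ≤ h := by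
    rcases hr.eq_or_lt with h0 | h0
    · exact hr0 h0.symm
    · by_contra hcon
      push Not at hcon
      nlinarith [mul_neg_of_pos_of_neg h0 hcon, sq_nonneg r]
  rw [Real.sqrt_le_left hh]
  nlinarith [sq_nonneg (h - r)]

end Toric

/-! ### First variation of the length. -/

namespace Toric

open Filter Topology

variable {n : ℕ} {u : E n → ℝ} {U : Set (E n)} {G : E n → E n →L[ℝ] E n →L[ℝ] ℝ}
  {f : E n → ℝ} {X : E n → E n}

/-- First variation of the length of a curve, displaced along the gradient of a function `f` whose
Hessian is at most `f` times the metric, the displacement being proportional to a solution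
`φ = A cosh + B sinh` of `φ'' = φ` in the arc length. -/
theorem HessMetric.exists_curve_variation (hG : HessMetric u U G) (hf : SinhConcave G U f X)
    {K : Set (E n)} (hK : IsCompact K) (hKU : K ⊆ U) (M : ℝ) :
    ∃ C t₀ : ℝ, 0 ≤ C ∧ 0 < t₀ ∧ ∀ (γ : ℝ → E n) (a b : ℝ), a < b → PiecewiseC1On γ a b →
      MapsTo γ (Icc a b) K → ∀ A B : ℝ, (∀ σ ∈ Icc 0 (arc u γ a b),
        0 ≤ A * Real.cosh σ + B * Real.sinh σ ∧ A * Real.cosh σ + B * Real.sinh σ ≤ M ∧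
        |A * Real.sinh σ + B * Real.cosh σ| ≤ M) → ∀ t ∈ Icc 0 t₀,
      0 ≤ arc u γ a b + t * ((A * Real.sinh (arc u γ a b) +
          B * Real.cosh (arc u γ a b)) * f (γ b) - B * f (γ a)) + C * t ^ 2 * arc u γ a b ∧
      Conn u (U ∩ {z | ∃ x ∈ K, ∃ c ∈ Icc 0 M, z = x + (t * c) • X x})
        (γ a + (t * A) • X (γ a))
        (γ b + (t * (A * Real.cosh (arc u γ a b) + B * Real.sinh (arc u γ a b))) • X (γ b))
        (ENNReal.ofReal (arc u γ a b + t * ((A * Real.sinh (arc u γ a b) +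
          B * Real.cosh (arc u γ a b)) * f (γ b) - B * f (γ a)) + C * t ^ 2 * arc u γ a b)) := by
  obtain ⟨C, t₀, hC, ht₀, hvar⟩ := hG.exists_variation_bound hf.smooth_grad hK hKU M
  refine ⟨C, t₀, hC, ht₀, ?_⟩
  intro γ a b hab hγ hm A B hAB t ht
  have hmU : MapsTo γ (Icc a b) U := hm.mono_right hKU
  have hU := hG.metricOn
  set σ : ℝ → ℝ := arc u γ a with hσ
  have hσa : σ a = 0 := arc_self u γ a
  have hσc : ContinuousOn σ (Icc a b) := hU.continuousOn_arc hab hγ hmU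
  have hσm : MonotoneOn σ (Icc a b) := hU.monotoneOn_arc hab hγ hmU
  have hσI : MapsTo σ (Icc a b) (Icc 0 (σ b)) := fun r hr => by
    refine ⟨?_, hσm hr (right_mem_Icc.2 hab.le) hr.2⟩
    rw [← hσa]
    exact hσm (left_mem_Icc.2 hab.le) hr hr.1
  set φ : ℝ → ℝ := fun s => A * Real.cosh s + B * Real.sinh s with hφ
  set φ' : ℝ → ℝ := fun s => A * Real.sinh s + B * Real.cosh s with hφ'
  have hφd : ∀ s, HasDerivAt φ (φ' s) s := fun s =>
    ((Real.hasDerivAt_cosh s).const_mul A).add ((Real.hasDerivAt_sinh s).const_mul B)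
  have hφd' : ∀ s, HasDerivAt φ' (φ s) s := fun s =>
    ((Real.hasDerivAt_sinh s).const_mul A).add ((Real.hasDerivAt_cosh s).const_mul B)
  have hφs : ContDiff ℝ ∞ φ := by
    simp only [hφ]
    exact (contDiff_const.mul Real.contDiff_cosh).add (contDiff_const.mul Real.contDiff_sinh)
  set Γ : ℝ → E n := fun r => γ r + (t * φ (σ r)) • X (γ r) with hΓ
  have hΓa : Γ a = γ a + (t * A) • X (γ a) := by simp [hΓ, hσa, hφ]
  have hXc := hf.smooth_grad
  have hpw : PiecewiseC1On Γ a b := by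
    obtain ⟨hc, s, hs⟩ := hγ
    refine ⟨?_, s, fun x y hx hxy hy hxs => ?_⟩
    · have h1 : ContinuousOn (fun r => X (γ r)) (Icc a b) := hXc.continuousOn.comp hc hmU
      have h2 : ContinuousOn (fun r => φ (σ r)) (Icc a b) := hφs.continuous.comp_continuousOn hσc
      exact hc.add ((continuousOn_const.mul h2).smul h1)
    · have hcd := hs x y hx hxy hy hxs
      have h1 : ContDiffOn ℝ 1 (fun r => X (γ r)) (Icc x y) :=
        (hXc.of_le (natCast_le_infty 1)).comp hcd (hmU.mono_left (Icc_subset_Icc hx hy))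
      have h2 : ContDiffOn ℝ 1 (fun r => φ (σ r)) (Icc x y) :=
        (hφs.of_le (natCast_le_infty 1)).comp_contDiffOn
          (hU.contDiffOn_arc hab ⟨hc, s, hs⟩ hmU hx hxy hy hcd)
      exact hcd.add ((contDiffOn_const.mul h2).smul h1)
  have hmem : ∀ r ∈ Icc a b, φ (σ r) ∈ Icc (-M) M ∧ φ' (σ r) ∈ Icc (-M) M := fun r hr => by
    obtain ⟨h1, h2, h3⟩ := hAB _ (hσI hr)
    exact ⟨⟨by simp only [hφ]; linarith, h2⟩, abs_le.1 h3⟩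
  obtain ⟨hc, s, hs⟩ := id hγ
  -- Since φ'' = φ, the derivative of φ'(σ) f(γ) is φ f times the speed plus φ' df(γ'), which is
  -- exactly the bound for the first variation of the speed when Hess f ≤ f g. The term `C * t ^ 2`
  -- absorbs the error, so the increment of `h` bounds the length of `Γ`.
  set h : ℝ → ℝ := fun r => σ r * (1 + C * t ^ 2) + t * (φ' (σ r) * f (γ r)) with hh
  have hfin : h b - h a = arc u γ a b + t * ((A * Real.sinh (arc u γ a b) +
        B * Real.cosh (arc u γ a b)) * f (γ b) - B * f (γ a)) + C * t ^ 2 * arc u γ a b := by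
    simp only [hh, hσa, hφ']
    simp only [hσ, Real.sinh_zero, Real.cosh_zero]
    ring
  rw [← hfin]
  have hhc : ContinuousOn h (Icc a b) := by
    have h1 : ContinuousOn (fun r => f (γ r)) (Icc a b) := hf.smooth.continuousOn.comp hc hmU
    have h2 : ContinuousOn (fun r => φ' (σ r)) (Icc a b) := by
      simp only [hφ']
      exact (continuousOn_const.mul (Real.continuous_sinh.comp_continuousOn hσc)).add
        (continuousOn_const.mul (Real.continuous_cosh.comp_continuousOn hσc))
    exact (hσc.mul continuousOn_const).add (continuousOn_const.mul (h2.mul h1))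
  have hhd : ∀ r ∈ Ioo a b, r ∉ s → HasDerivAt h (speed u γ r * (1 + C * t ^ 2) +
      t * (φ (σ r) * speed u γ r * f (γ r) + φ' (σ r) * fderiv ℝ f (γ r) (deriv γ r))) r ∧
      0 ≤ √(metricForm u (Γ r) (deriv Γ r)) ∧ √(metricForm u (Γ r) (deriv Γ r)) ≤
      speed u γ r * (1 + C * t ^ 2) +
      t * (φ (σ r) * speed u γ r * f (γ r) + φ' (σ r) * fderiv ℝ f (γ r) (deriv γ r)) := by
    intro r hr hrs
    have hrI := Ioo_subset_Icc_self hr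
    have hrU : γ r ∈ U := hmU hrI
    have hcd := contDiffAt_of_piecewise hs hr hrs
    have hγd : HasDerivAt γ (deriv γ r) r := (hcd.differentiableAt (by simp)).hasDerivAt
    have hσd : HasDerivAt σ (speed u γ r) r := hU.hasDerivAt_arc hγ hmU hr hcd
    have hfd : HasDerivAt (fun r => f (γ r)) (fderiv ℝ f (γ r) (deriv γ r)) r :=
      HasFDerivAt.comp_hasDerivAt r ((hf.smooth.contDiffAt
        (hG.isOpen.mem_nhds hrU)).differentiableAt (by simp)).hasFDerivAt hγd
    have hXd : HasDerivAt (fun r => X (γ r)) (fderiv ℝ X (γ r) (deriv γ r)) r :=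
      HasFDerivAt.comp_hasDerivAt r ((hXc.contDiffAt
        (hG.isOpen.mem_nhds hrU)).differentiableAt (by simp)).hasFDerivAt hγd
    have hφσ : HasDerivAt (fun r => φ (σ r)) (φ' (σ r) * speed u γ r) r :=
      (hφd (σ r)).comp r hσd
    have hφσ' : HasDerivAt (fun r => φ' (σ r)) (φ (σ r) * speed u γ r) r :=
      (hφd' (σ r)).comp r hσd
    have hΓd : HasDerivAt Γ (deriv γ r + t • ((φ' (σ r) * speed u γ r) • X (γ r) +
        φ (σ r) • fderiv ℝ X (γ r) (deriv γ r))) r := by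
      refine (hγd.add ((hφσ.const_mul t).smul hXd)).congr_deriv ?_
      module
    have hsp : speed u γ r = √(G (γ r) (deriv γ r) (deriv γ r)) := by
      rw [speed, hG.eq _ hrU]
    refine ⟨?_, Real.sqrt_nonneg _, ?_⟩
    · exact ((hσd.mul_const _).add ((hφσ'.mul hfd).const_mul t))
    · obtain ⟨m1, m2⟩ := hmem r hrI
      obtain ⟨v1, v2⟩ := hvar (γ r) (hm hrI) _ m1 _ m2 (deriv γ r) t ht
      rw [hΓd.deriv]
      have hΓU : Γ r ∈ U := v1
      rw [hG.eq _ hΓU]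
      have hρ2 : G (γ r) (deriv γ r) (deriv γ r) = speed u γ r ^ 2 := by
        rw [hsp, Real.sq_sqrt (hG.nonneg hrU _)]
      rw [← hsp, hρ2, hf.grad _ hrU] at v2
      have hle := hf.hess_le _ hrU (deriv γ r)
      rw [hρ2] at hle
      have hφ0 : 0 ≤ φ (σ r) := (hAB _ (hσI hrI)).1
      refine sqrt_le_of_le_two_mul (hG.nonneg hΓU _) (speed_nonneg u γ r) ?_ ?_
      · intro h0
        have : deriv γ r = 0 := by
          by_contra hne
          have := hG.pos _ hrU _ hne
          rw [hρ2, h0] at this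
          simp at this
        rw [h0, this]
        simp
      · refine v2.trans ?_
        have := mul_le_mul_of_nonneg_left (mul_le_mul_of_nonneg_left hle hφ0)
          (show 0 ≤ 2 * t by linarith [ht.1])
        have h3 : 0 ≤ C * t ^ 2 * speed u γ r ^ 2 := by positivity
        nlinarith
  refine ⟨?_, Γ, a, b, hab, hpw, hΓa, rfl, ?_, lintegral_le_of_hasDerivAt_off_finset hab.le s hhc hhd⟩
  · have := le_of_hasDerivAt_nonneg_off_finset s hhc
      (fun r hr hrs => ⟨(hhd r hr hrs).1, (hhd r hr hrs).2.1.trans (hhd r hr hrs).2.2⟩)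
      (left_mem_Icc.2 hab.le) (right_mem_Icc.2 hab.le) hab.le
    linarith
  · intro r hr
    obtain ⟨h1, h2⟩ := hmem r hr
    refine ⟨(hvar (γ r) (hm hr) _ h1 _ h2 0 t ht).1, γ r, hm hr, φ (σ r), ?_, rfl⟩
    exact ⟨(hAB _ (hσI hr)).1, h1.2⟩

end Toric

/-! ### Sturm comparison along nearly shortest curves. -/

namespace Toric

open Filter Topology

variable {n : ℕ} {u : E n → ℝ} {U : Set (E n)} {G : E n → E n →L[ℝ] E n →L[ℝ] ℝ}
  {f : E n → ℝ} {X : E n → E n}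

theorem MetricOn.arc_add (hU : MetricOn u U) {γ : ℝ → E n} {a b c : ℝ} (hac : a < c) (hcb : c < b)
    (hγ : PiecewiseC1On γ a b) (hm : MapsTo γ (Icc a b) U) :
    arc u γ a c + arc u γ c b = arc u γ a b :=
  intervalIntegral.integral_add_adjacent_intervals
    (hU.intervalIntegrable_speed hac (hγ.mono le_rfl hcb.le)
      (hm.mono_left (Icc_subset_Icc le_rfl hcb.le)))
    (hU.intervalIntegrable_speed hcb (hγ.mono hac.le le_rfl)
      (hm.mono_left (Icc_subset_Icc hac.le le_rfl)))

theorem MetricOn.arc_nonneg (hU : MetricOn u U) {γ : ℝ → E n} {a b : ℝ} (hab : a < b)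
    (hγ : PiecewiseC1On γ a b) (hm : MapsTo γ (Icc a b) U) : 0 ≤ arc u γ a b := by
  have := hU.monotoneOn_arc hab hγ hm (left_mem_Icc.2 hab.le) (right_mem_Icc.2 hab.le) hab.le
  rwa [arc_self] at this

/-- With L₁, L₂ the lengths before and after `c`, the displacement is sinh L₂ sinh s on the first
piece and sinh L₁ sinh(L₂ - s) on the second: a multiple of the Green's function of φ'' - φ with
pole at `c`. It vanishes at both ends, so these stay fixed, and the jump of φ' at `c` contributes `f
(γ c)` times sinh(L₁ + L₂). On a nearly shortest curve the coefficient of `t` cannot be much below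
0, which says that `f` lies above the solution of φ'' = φ with the same end values. -/
theorem HessMetric.exists_curve_variation_green (hG : HessMetric u U G) (hf : SinhConcave G U f X)
    {K : Set (E n)} (hK : IsCompact K) (hKU : K ⊆ U) (ℓ : ℝ) :
    ∃ C M t₀ : ℝ, 0 ≤ C ∧ 0 < t₀ ∧ ∀ (γ : ℝ → E n) (a b c : ℝ), a < c → c < b →
      PiecewiseC1On γ a b → MapsTo γ (Icc a b) K → arc u γ a b ≤ ℓ → ∀ t ∈ Icc 0 t₀,
      0 ≤ arc u γ a b + t * (f (γ c) * Real.sinh (arc u γ a b) -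
          Real.sinh (arc u γ c b) * f (γ a) - Real.sinh (arc u γ a c) * f (γ b)) +
          C * t ^ 2 * arc u γ a b ∧
      Conn u (U ∩ {z | ∃ x ∈ K, ∃ c ∈ Icc 0 M, z = x + (t * c) • X x}) (γ a) (γ b)
        (ENNReal.ofReal (arc u γ a b + t * (f (γ c) * Real.sinh (arc u γ a b) -
          Real.sinh (arc u γ c b) * f (γ a) - Real.sinh (arc u γ a c) * f (γ b)) +
          C * t ^ 2 * arc u γ a b)) := by
  -- Both φ and φ' are, up to sign, products of two values of sinh or cosh at arguments in `[0, ℓ]`.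
  set M := Real.cosh ℓ * Real.cosh ℓ with hM
  obtain ⟨C, t₀, hC, ht₀, hvar⟩ := hG.exists_curve_variation hf hK hKU M
  refine ⟨C, M, t₀, hC, ht₀, ?_⟩
  intro γ a b c hac hcb hγ hm hℓ t ht
  have hU := hG.metricOn
  have hmU := hm.mono_right hKU
  have hγ1 := hγ.mono le_rfl hcb.le
  have hγ2 := hγ.mono hac.le le_rfl
  have hm1 := hm.mono_left (Icc_subset_Icc (le_refl a) hcb.le)
  have hm2 := hm.mono_left (Icc_subset_Icc hac.le (le_refl b))
  have hL := hU.arc_add hac hcb hγ hmU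
  have hL1 : 0 ≤ arc u γ a c := hU.arc_nonneg hac hγ1 (hm1.mono_right hKU)
  have hL2 : 0 ≤ arc u γ c b := hU.arc_nonneg hcb hγ2 (hm2.mono_right hKU)
  set L1 := arc u γ a c with hL1d
  set L2 := arc u γ c b with hL2d
  have hS : ∀ s, 0 ≤ s → s ≤ ℓ → 0 ≤ Real.sinh s ∧ Real.sinh s ≤ Real.cosh ℓ ∧
      0 ≤ Real.cosh s ∧ Real.cosh s ≤ Real.cosh ℓ := fun s h0 h1 => by
    have hc : Real.cosh s ≤ Real.cosh ℓ := by
      rw [Real.cosh_le_cosh, abs_of_nonneg h0, abs_of_nonneg (h0.trans h1)]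
      exact h1
    exact ⟨Real.sinh_nonneg_iff.2 h0, (Real.sinh_lt_cosh s).le.trans hc, (Real.cosh_pos s).le, hc⟩
  obtain ⟨n1, c1⟩ := hvar γ a c hac hγ1 hm1 0 (Real.sinh L2) (fun s hs => by
    obtain ⟨h1, h2, -, -⟩ := hS L2 hL2 (by linarith)
    obtain ⟨k1, k2, k3, k4⟩ := hS s hs.1 (by linarith [hs.2])
    refine ⟨by positivity, ?_, ?_⟩
    · rw [zero_mul, zero_add]
      exact mul_le_mul h2 k2 k1 (Real.cosh_pos _).le
    · rw [zero_mul, zero_add, abs_of_nonneg (by positivity)]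
      exact mul_le_mul h2 k4 k3 (Real.cosh_pos _).le) t ht
  obtain ⟨n2, c2⟩ := hvar γ c b hcb hγ2 hm2 (Real.sinh L1 * Real.sinh L2) (-(Real.sinh L1 * Real.cosh L2))
    (fun s hs => by
    obtain ⟨h1, h2, -, -⟩ := hS L1 hL1 (by linarith)
    obtain ⟨k1, k2, k3, k4⟩ := hS (L2 - s) (by linarith [hs.2]) (by linarith [hs.1])
    have e1 : Real.sinh L1 * Real.sinh L2 * Real.cosh s + -(Real.sinh L1 * Real.cosh L2) *
        Real.sinh s = Real.sinh L1 * Real.sinh (L2 - s) := by rw [Real.sinh_sub]; ring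
    have e2 : Real.sinh L1 * Real.sinh L2 * Real.sinh s + -(Real.sinh L1 * Real.cosh L2) *
        Real.cosh s = -(Real.sinh L1 * Real.cosh (L2 - s)) := by rw [Real.cosh_sub]; ring
    rw [e1, e2, abs_neg, abs_of_nonneg (mul_nonneg h1 k3)]
    exact ⟨mul_nonneg h1 k1, mul_le_mul h2 k2 k1 (Real.cosh_pos _).le,
      mul_le_mul h2 k4 k3 (Real.cosh_pos _).le⟩) t ht
  rw [← hL1d] at c1 n1
  rw [← hL2d] at c2 n2
  have e0 : γ a + (t * 0) • X (γ a) = γ a := by simp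
  have e3 : γ b + (t * (Real.sinh L1 * Real.sinh L2 * Real.cosh L2 +
      -(Real.sinh L1 * Real.cosh L2) * Real.sinh L2)) • X (γ b) = γ b := by
    have : Real.sinh L1 * Real.sinh L2 * Real.cosh L2 +
      -(Real.sinh L1 * Real.cosh L2) * Real.sinh L2 = 0 := by ring
    rw [this]; simp
  have e4 : 0 * Real.cosh L1 + Real.sinh L2 * Real.sinh L1 = Real.sinh L1 * Real.sinh L2 := by ring
  rw [e0, e4] at c1
  rw [e3] at c2
  have c3 := c1.trans c2
  rw [← ENNReal.ofReal_add n1 n2] at c3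
  have e5 : (L1 + t * ((0 * Real.sinh L1 + Real.sinh L2 * Real.cosh L1) * f (γ c) -
      Real.sinh L2 * f (γ a)) + C * t ^ 2 * L1) +
      (L2 + t * ((Real.sinh L1 * Real.sinh L2 * Real.sinh L2 +
      -(Real.sinh L1 * Real.cosh L2) * Real.cosh L2) * f (γ b) -
      -(Real.sinh L1 * Real.cosh L2) * f (γ c)) + C * t ^ 2 * L2) =
      arc u γ a b + t * (f (γ c) * Real.sinh (arc u γ a b) - Real.sinh L2 * f (γ a) -
      Real.sinh L1 * f (γ b)) + C * t ^ 2 * arc u γ a b := by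
    rw [← hL, Real.sinh_add]
    linear_combination (-t * Real.sinh L1 * f (γ b)) * Real.cosh_sq L2
  rw [e5] at c3
  exact ⟨e5 ▸ add_nonneg n1 n2, c3⟩


/-- On a compact set, small displacements along the gradient do not decrease the function. -/
theorem HessMetric.exists_le_displaced (hG : HessMetric u U G) (hf : SinhConcave G U f X)
    {K : Set (E n)} (hK : IsCompact K) (hKU : K ⊆ U) :
    ∃ s₀ : ℝ, 0 < s₀ ∧ ∀ x ∈ K, ∀ s ∈ Icc 0 s₀, f x ≤ f (x + s • X x) := by
  obtain ⟨c, R, hc, hR, hcR⟩ := hG.exists_bounds hK hKU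
  have hXK : ContinuousOn X K := hf.smooth_grad.continuousOn.mono hKU
  obtain ⟨D, hD⟩ := hK.exists_bound_of_continuousOn hXK
  have hΦ : ∀ z ∈ K ×ˢ Metric.sphere (0 : E n) 1,
      ContDiffAt ℝ 2 (fun q : ℝ × E n × E n => f (q.2.1 + q.1 • q.2.2)) (0, z) := fun z hz =>
    ContDiffAt.comp (f := fun q : ℝ × E n × E n => q.2.1 + q.1 • q.2.2) (0, z)
      (by
        simp only [zero_smul, add_zero]
        exact ((hf.smooth.contDiffAt (hG.isOpen.mem_nhds (hKU hz.1))).of_le (natCast_le_infty 2)))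
      (by fun_prop)
  obtain ⟨C, t₀, hC, ht₀, hT⟩ := exists_taylor_bound (hK.prod (isCompact_sphere 0 1)) hΦ
  -- The gain is at least `c * s * ‖X x‖ ^ 2` and the loss at most `C * s ^ 2 * ‖X x‖ ^ 2`. Both are
  -- quadratic in `‖X x‖`, so one bound on `s` serves near critical points as well.
  refine ⟨min (c / (C + 1)) (t₀ / (|D| + 1)), by positivity, fun x hx s hs => ?_⟩
  rcases eq_or_ne (X x) 0 with h0 | h0
  · simp [h0]
  have hXn : 0 < ‖X x‖ := norm_pos_iff.2 h0
  set e : E n := ‖X x‖⁻¹ • X x with he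
  have hen : ‖e‖ = 1 := by rw [he, norm_smul, norm_inv, norm_norm, inv_mul_cancel₀ hXn.ne']
  have hXe : X x = ‖X x‖ • e := by rw [he, smul_smul, mul_inv_cancel₀ hXn.ne', one_smul]
  have hd : HasDerivAt (fun t : ℝ => f (x + t • e)) (fderiv ℝ f x e) 0 := by
    have h1 : HasDerivAt (fun t : ℝ => x + t • e) e 0 := by
      simpa using ((hasDerivAt_id (0 : ℝ)).smul_const e).const_add x
    refine HasFDerivAt.comp_hasDerivAt (0 : ℝ) ?_ h1
    simp only [zero_smul, add_zero]
    exact ((hf.smooth.contDiffAt (hG.isOpen.mem_nhds (hKU hx))).differentiableAt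
      (by simp)).hasFDerivAt
  have hs1 : s * ‖X x‖ ≤ t₀ := by
    calc s * ‖X x‖ ≤ t₀ / (|D| + 1) * (|D| + 1) := by
          refine mul_le_mul (hs.2.trans (min_le_right _ _)) ?_ hXn.le (by positivity)
          exact (hD x hx).trans ((le_abs_self D).trans (by linarith))
      _ = t₀ := by field_simp
  have hsn : 0 ≤ s * ‖X x‖ := mul_nonneg hs.1 hXn.le
  have key := hT (x, e) ⟨hx, by simpa using hen⟩ (s * ‖X x‖) (by rwa [abs_of_nonneg hsn]) _ hd
  have key' := (abs_le.1 key).1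
  simp only [zero_smul, add_zero] at key'
  have e1 : (s * ‖X x‖) • e = s • X x := by rw [mul_smul, ← hXe]
  rw [e1, ← hf.grad x (hKU hx)] at key'
  have hGe : c * ‖X x‖ ≤ G x (X x) e := by
    have h1 : G x (X x) e = ‖X x‖ * G x e e := by
      conv_lhs => rw [hXe]
      simp
    rw [h1]
    nlinarith [(hcR x hx e hen).1]
  have hCs : C * s ≤ c := by
    calc C * s ≤ (C + 1) * (c / (C + 1)) := by
          refine mul_le_mul (by linarith) (hs.2.trans (min_le_left _ _)) hs.1 (by linarith)
      _ = c := by field_simp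
  have h2 : C * (s * ‖X x‖) ^ 2 ≤ s * ‖X x‖ * (c * ‖X x‖) := by
    have : C * (s * ‖X x‖) ^ 2 = (C * s) * (s * ‖X x‖ ^ 2) := by ring
    rw [this]
    calc _ ≤ c * (s * ‖X x‖ ^ 2) := mul_le_mul_of_nonneg_right hCs (mul_nonneg hs.1 (sq_nonneg _))
      _ = _ := by ring
  have h3 := mul_le_mul_of_nonneg_left hGe hsn
  linarith

/-- Pairing the curve with the fixed vector `γ b - γ a` reduces this to monotonicity of a scalar
function. It ensures that the infimum of the lengths of curves in `K` between two distinct points is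
positive. -/
theorem HessMetric.exists_dist_le_arc (hG : HessMetric u U G) {K : Set (E n)} (hK : IsCompact K)
    (hKU : K ⊆ U) : ∃ c : ℝ, 0 < c ∧ ∀ (γ : ℝ → E n) (a b : ℝ), a < b → PiecewiseC1On γ a b →
      MapsTo γ (Icc a b) K → c * ‖γ b - γ a‖ ≤ arc u γ a b := by
  obtain ⟨c, R, hc, hR, hcR⟩ := hG.exists_bounds hK hKU
  refine ⟨√c, Real.sqrt_pos.2 hc, fun γ a b hab hγ hm => ?_⟩
  have hU := hG.metricOn
  have hmU := hm.mono_right hKU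
  set w := γ b - γ a with hw
  have hsp : ∀ x ∈ K, ∀ v : E n, √c * ‖v‖ ≤ √(G x v v) := by
    intro x hx v
    rcases eq_or_ne v 0 with rfl | hv
    · simp
    have hvn : 0 < ‖v‖ := norm_pos_iff.2 hv
    have h1 := (hcR x hx (‖v‖⁻¹ • v) (by rw [norm_smul, norm_inv, norm_norm,
      inv_mul_cancel₀ hvn.ne'])).1
    rw [← Real.sqrt_sq hvn.le, ← Real.sqrt_mul hc.le]
    apply Real.sqrt_le_sqrt
    simp only [map_smul, smul_apply, smul_eq_mul] at h1
    calc c * ‖v‖ ^ 2 ≤ (‖v‖⁻¹ * (‖v‖⁻¹ * G x v v)) * ‖v‖ ^ 2 := by gcongr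
      _ = G x v v := by field_simp
  obtain ⟨hc', s, hs⟩ := id hγ
  have hmono := le_of_hasDerivAt_nonneg_off_finset (a := a) (b := b)
    (h := fun t => ‖w‖ * arc u γ a t - √c * inner ℝ w (γ t))
    (h' := fun t => ‖w‖ * speed u γ t - √c * inner ℝ w (deriv γ t)) s ?_ ?_
  · have h1 := hmono (left_mem_Icc.2 hab.le) (right_mem_Icc.2 hab.le) hab.le
    simp only [arc_self, mul_zero] at h1
    have h2 : inner ℝ w (γ b) - inner ℝ w (γ a) = ‖w‖ ^ 2 := by
      rw [← inner_sub_right, ← hw, real_inner_self_eq_norm_sq]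
    rcases (norm_nonneg w).eq_or_lt with h0 | h0
    · rw [← h0, mul_zero]; exact hU.arc_nonneg hab hγ hmU
    · have h3 : ‖w‖ * (√c * ‖w‖) ≤ ‖w‖ * arc u γ a b := by
        have h4 : √c * (inner ℝ w (γ b) - inner ℝ w (γ a)) = √c * ‖w‖ ^ 2 := by rw [h2]
        linarith
      exact le_of_mul_le_mul_left h3 h0
  · exact (continuousOn_const.mul (hU.continuousOn_arc hab hγ hmU)).sub
      (continuousOn_const.mul (continuousOn_const.inner hc'))
  · intro t ht hts
    have hcd := contDiffAt_of_piecewise hs ht hts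
    have hd : HasDerivAt γ (deriv γ t) t := (hcd.differentiableAt (by simp)).hasDerivAt
    have hmt := hm (Ioo_subset_Icc_self ht)
    refine ⟨((hU.hasDerivAt_arc hγ hmU ht hcd).const_mul _).sub ?_, ?_⟩
    · have := ((hasDerivAt_const t w).inner ℝ hd).const_mul (√c)
      refine this.congr_deriv ?_
      simp
    · have h1 := real_inner_le_norm w (deriv γ t)
      have h2 := hsp _ hmt (deriv γ t)
      have h3 : speed u γ t = √(G (γ t) (deriv γ t) (deriv γ t)) := by
        rw [speed, hG.eq _ (hKU hmt)]
      rw [h3]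
      have h4 := mul_le_mul_of_nonneg_left h1 (Real.sqrt_nonneg c)
      have h5 := mul_le_mul_of_nonneg_left h2 (norm_nonneg w)
      nlinarith

set_option maxHeartbeats 800000 in
/-- If `f` has compact superlevel sets, then nearly shortest curves between two points can be found
in one compact set. -/
theorem HessMetric.exists_compact_conn (hG : HessMetric u U G) (hf : SinhConcave G U f X)
    (hcpt : ∀ η > 0, IsCompact {x | x ∈ U ∧ η ≤ f x}) {p q : E n} (hp : p ∈ U) (hq : q ∈ U)
    (ℓ₀ : ℝ) : ∃ K ⊆ U, IsCompact K ∧ ∀ ℓ, 0 ≤ ℓ → ℓ ≤ ℓ₀ → Conn u U p q (ENNReal.ofReal ℓ) →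
      ∀ ε > 0, Conn u K p q (ENNReal.ofReal (ℓ + ε)) := by
  have hU := hG.metricOn
  set m := min (f p) (f q) with hm
  have hm0 : 0 < m := lt_min (hf.pos p hp) (hf.pos q hq)
  set ch := Real.cosh (ℓ₀ + 1) with hch
  have hch0 : 0 < ch := Real.cosh_pos _
  have hch1 : 1 ≤ ch := Real.one_le_cosh _
  -- On a curve of length at most `ℓ₀ + 1` the solution of φ'' = φ with end values at least `m` is
  -- at least `m / ch`; half of that is kept for the error. It matters that `m'` depends on the end
  -- points and `ℓ₀` only.
  set m' := m / (2 * ch) with hm'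
  have hm'0 : 0 < m' := by positivity
  have hm'm : m' ≤ m := by
    rw [hm', div_le_iff₀ (by positivity)]
    nlinarith
  refine ⟨{x | x ∈ U ∧ m' ≤ f x}, fun x hx => hx.1, hcpt m' hm'0, ?_⟩
  intro ℓ hℓ hℓ₀ hconn ε hε
  rcases eq_or_ne p q with rfl | hpq
  · exact (Conn.refl (u := u) (K := {x | x ∈ U ∧ m' ≤ f x})
      ⟨hp, hm'm.trans (min_le_left _ _)⟩).mono le_rfl bot_le
  obtain ⟨γ₀, a₀, b₀, hab₀, hγ₀, h1, h2, hmap₀, hlen₀⟩ := hconn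
  -- the given curve lies in a superlevel set
  have himg : IsCompact (γ₀ '' Icc a₀ b₀) := isCompact_Icc.image_of_continuousOn hγ₀.1
  obtain ⟨x₁, hx₁, hmin⟩ := himg.exists_isMinOn ⟨γ₀ a₀, mem_image_of_mem _ (left_mem_Icc.2 hab₀.le)⟩
    (hf.smooth.continuousOn.mono (by rintro _ ⟨t, ht, rfl⟩; exact hmap₀ ht))
  have hx₁U : x₁ ∈ U := by obtain ⟨t, ht, rfl⟩ := hx₁; exact hmap₀ ht
  -- This level depends on the given curve; it serves only to place the competitors for the infimum
  -- `d` in a compact set.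
  set η := f x₁ with hη
  have hη0 : 0 < η := hf.pos _ hx₁U
  set K : Set (E n) := {x | x ∈ U ∧ η ≤ f x} with hK
  have hKU : K ⊆ U := fun x hx => hx.1
  have hKc : IsCompact K := hcpt η hη0
  have hconnK : Conn u K p q (ENNReal.ofReal ℓ) :=
    ⟨γ₀, a₀, b₀, hab₀, hγ₀, h1, h2, fun t ht => ⟨hmap₀ ht, hmin (mem_image_of_mem _ ht)⟩, hlen₀⟩
  set S : Set ℝ := {r | 0 ≤ r ∧ Conn u K p q (ENNReal.ofReal r)} with hS
  have hSne : S.Nonempty := ⟨ℓ, hℓ, hconnK⟩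
  have hSbdd : BddBelow S := ⟨0, fun r hr => hr.1⟩
  set d := sInf S with hd
  have hdℓ : d ≤ ℓ := csInf_le hSbdd ⟨hℓ, hconnK⟩
  have hd0 : 0 < d := by
    obtain ⟨c, hc, hcurve⟩ := hG.exists_dist_le_arc hKc hKU
    have hpos : 0 < c * ‖q - p‖ := mul_pos hc (norm_pos_iff.2 (sub_ne_zero.2 hpq.symm))
    refine hpos.trans_le (le_csInf hSne ?_)
    rintro r ⟨hr0, γ, a, b, hab, hγ, rfl, rfl, hmap, hlen⟩
    rw [hU.gLength_eq_arc hab hγ (hmap.mono_right hKU), ENNReal.ofReal_le_ofReal_iff hr0] at hlen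
    exact (hcurve γ a b hab hγ hmap).trans hlen
  obtain ⟨C, M, t₀, hC, ht₀, hgreen⟩ := hG.exists_curve_variation_green hf hKc hKU (ℓ₀ + 1)
  obtain ⟨s₀, hs₀, hdisp⟩ := hG.exists_le_displaced hf hKc hKU
  -- choice of the time of displacement
  obtain ⟨t, ht0, htt₀, htM, htm, ht1⟩ : ∃ t : ℝ, 0 < t ∧ t ≤ t₀ ∧ t * |M| ≤ s₀ ∧
      (C + 1) * t ≤ m' ∧ t ^ 2 * d ≤ min ε 1 := by
    have hε1 : 0 < min ε 1 := lt_min hε one_pos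
    have hev : ∀ᶠ t : ℝ in 𝓝[>] 0, t ≤ t₀ ∧ t * |M| ≤ s₀ ∧ (C + 1) * t ≤ m' ∧
        t ^ 2 * d ≤ min ε 1 := by
      have hcont : ∀ (g : ℝ → ℝ) (k : ℝ), Continuous g → g 0 < k → ∀ᶠ t : ℝ in 𝓝[>] 0, g t ≤ k :=
        fun g k hg hgk => ((hg.tendsto 0).eventually_le_const hgk).filter_mono nhdsWithin_le_nhds
      refine (hcont (fun t => t) _ (by fun_prop) ht₀).and ((hcont (fun t => t * |M|) _
        (by fun_prop) (by simpa)).and ((hcont (fun t => (C + 1) * t) _ (by fun_prop)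
        (by simpa)).and (hcont (fun t => t ^ 2 * d) _ (by fun_prop) (by simpa))))
    obtain ⟨t, h, h'⟩ := (hev.and self_mem_nhdsWithin).exists
    exact ⟨t, h', h⟩
  -- The excess over the infimum is of order `t ^ 2`, negligible against a first variation of order
  -- `t`.
  obtain ⟨r, ⟨hr0, γ, a, b, hab, hγ, hγa, hγb, hmap, hlen⟩, hrd⟩ :=
    exists_lt_of_csInf_lt hSne (show sInf S < d + t ^ 2 * d by rw [← hd]; nlinarith [pow_pos ht0 2])
  have hmapU := hmap.mono_right hKU
  have hlen' := hlen
  rw [hU.gLength_eq_arc hab hγ hmapU, ENNReal.ofReal_le_ofReal_iff hr0] at hlen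
  set L := arc u γ a b with hL
  have hdL : d ≤ L := csInf_le hSbdd ⟨hU.arc_nonneg hab hγ hmapU, γ, a, b, hab, hγ, hγa, hγb, hmap,
    (hU.gLength_eq_arc hab hγ hmapU).le⟩
  have hLd : L ≤ d + t ^ 2 * d := hlen.trans hrd.le
  have hLℓ : L ≤ ℓ₀ + 1 := by linarith [min_le_right ε 1]
  refine ⟨γ, a, b, hab, hγ, hγa, hγb, ?_, hlen'.trans (ENNReal.ofReal_le_ofReal ?_)⟩
  swap
  · linarith [min_le_left ε 1]
  intro c hc
  refine ⟨hmapU hc, ?_⟩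
  rcases hc.1.eq_or_lt with rfl | hac
  · rw [hγa]; exact hm'm.trans (min_le_left _ _)
  rcases hc.2.eq_or_lt with rfl | hcb
  · rw [hγb]; exact hm'm.trans (min_le_right _ _)
  obtain ⟨hV0, hV⟩ := hgreen γ a b c hac hcb hγ hmap hLℓ t ⟨ht0.le, htt₀⟩
  rw [← hL] at hV hV0
  -- Displacement along the gradient does not lower `f`, so the displaced curve stays in `K` and its
  -- length is at least `d`.
  have hVK := hV.mono (K' := K) (by
    rintro z ⟨hzU, x, hx, c', hc', rfl⟩
    refine ⟨hzU, hx.2.trans (hdisp x hx _ ⟨mul_nonneg ht0.le hc'.1, ?_⟩)⟩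
    exact (mul_le_mul_of_nonneg_left (hc'.2.trans (le_abs_self M)) ht0.le).trans htM) le_rfl
  rw [hγa, hγb] at hVK hV0
  have hdV := csInf_le hSbdd ⟨hV0, hVK⟩
  rw [← hd] at hdV
  have hsum := hU.arc_add hac hcb hγ hmapU
  have hL1 := hU.arc_nonneg hac (hγ.mono le_rfl hcb.le)
    (hmapU.mono_left (Icc_subset_Icc le_rfl hcb.le))
  have hL2 := hU.arc_nonneg hcb (hγ.mono hac.le le_rfl)
    (hmapU.mono_left (Icc_subset_Icc hac.le le_rfl))
  set L1 := arc u γ a c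
  set L2 := arc u γ c b
  rw [← hL] at hsum
  have hL0 : 0 < L := hd0.trans_le hdL
  have hLs : L ≤ Real.sinh L := Real.self_le_sinh_iff.2 hL0.le
  have hsL0 : 0 < Real.sinh L := Real.sinh_pos_iff.2 hL0
  have hs1 : 0 ≤ Real.sinh L1 := Real.sinh_nonneg_iff.2 hL1
  have hs2 : 0 ≤ Real.sinh L2 := Real.sinh_nonneg_iff.2 hL2
  have hcosh : ∀ s, 0 ≤ s → s ≤ L → Real.cosh s ≤ ch := fun s h0 h1 => by
    rw [hch, Real.cosh_le_cosh, abs_of_nonneg h0, abs_of_nonneg (by linarith)]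
    linarith
  -- lower bound for the comparison function
  have hcmp : m / ch * Real.sinh L ≤ Real.sinh L2 * f p + Real.sinh L1 * f q := by
    have h3 : Real.sinh L ≤ ch * (Real.sinh L1 + Real.sinh L2) := by
      rw [← hsum, Real.sinh_add]
      have := mul_le_mul_of_nonneg_left (hcosh L2 hL2 (by linarith)) hs1
      have := mul_le_mul_of_nonneg_left (hcosh L1 hL1 (by linarith)) hs2
      nlinarith
    calc m / ch * Real.sinh L ≤ m / ch * (ch * (Real.sinh L1 + Real.sinh L2)) := by gcongr
      _ = Real.sinh L2 * m + Real.sinh L1 * m := by field_simp; ring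
      _ ≤ _ := by gcongr <;> [exact min_le_left _ _; exact min_le_right _ _]
  -- The first variation inequality divided by `t`: `C` comes from its error term, the additional 1
  -- from the excess `t ^ 2 * d ≤ t ^ 2 * L`.
  have hΔ : -((C + 1) * t * L) ≤ f (γ c) * Real.sinh L - Real.sinh L2 * f p - Real.sinh L1 * f q := by
    have h4 : t * (-((C + 1) * t * L)) ≤
        t * (f (γ c) * Real.sinh L - Real.sinh L2 * f p - Real.sinh L1 * f q) := by
      have h6 : t ^ 2 * d ≤ t ^ 2 * L := by gcongr
      have h7 : t * (-((C + 1) * t * L)) = -(C * t ^ 2 * L) - t ^ 2 * L := by ring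
      rw [h7]
      linarith
    exact le_of_mul_le_mul_left h4 ht0
  have hmm : m / ch = 2 * m' := by rw [hm']; field_simp
  rw [hmm] at hcmp
  have h5 : m' * Real.sinh L ≤ f (γ c) * Real.sinh L := by
    have : (C + 1) * t * L ≤ m' * Real.sinh L := by gcongr
    linarith
  exact le_of_mul_le_mul_right h5 hsL0

end Toric

/-! ### The Hessian of a symplectic potential on a Delzant polytope. -/

namespace Toric

open Filter Topology

variable {n : ℕ}

theorem euclidean_eq_sum_single (w : E n) : w = ∑ i, w i • EuclideanSpace.single i (1 : ℝ) := by
  ext j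
  simp [Finset.sum_apply, Pi.single_apply]

/-- The second derivative of `u` as a field of bilinear forms. -/
noncomputable def hessForm (u : E n → ℝ) (x : E n) : E n →L[ℝ] E n →L[ℝ] ℝ :=
  fderiv ℝ (fderiv ℝ u) x

theorem hess_apply_eq {u : E n → ℝ} {x : E n} (hu : DifferentiableAt ℝ (fderiv ℝ u) x)
    (i j : Fin n) : hess u x i j =
      hessForm u x (EuclideanSpace.single i 1) (EuclideanSpace.single j 1) := by
  simp only [hess, Matrix.of_apply, partialDeriv, hessForm]
  have : HasFDerivAt (fun y => fderiv ℝ u y (EuclideanSpace.single j 1))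
      ((fderiv ℝ (fderiv ℝ u) x).flip (EuclideanSpace.single j 1)) x :=
    hu.hasFDerivAt.clm_apply (hasFDerivAt_const _ _) |>.congr_fderiv (by ext; simp)
  exact congrArg (fun L : E n →L[ℝ] ℝ => L (EuclideanSpace.single i 1)) this.fderiv

theorem metricForm_eq_hessForm {u : E n → ℝ} {x : E n} (hu : DifferentiableAt ℝ (fderiv ℝ u) x)
    (w : E n) : metricForm u x w = hessForm u x w w := by
  conv_rhs => rw [euclidean_eq_sum_single w]
  simp only [map_sum, map_smul, sum_apply, smul_apply, smul_eq_mul, metricForm, Finset.mul_sum]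
  rw [Finset.sum_comm]
  refine Finset.sum_congr rfl fun i _ => Finset.sum_congr rfl fun j _ => ?_
  rw [hess_apply_eq hu]
  ring

namespace DelzantPolytope

variable (P : DelzantPolytope n)

/-- The linear part of `l_k`. -/
noncomputable def normalForm (k : Fin P.numFacets) : E n →L[ℝ] ℝ :=
  ∑ i, (P.normal k i : ℝ) • EuclideanSpace.proj i

theorem normalForm_apply (k : Fin P.numFacets) (w : E n) :
    P.normalForm k w = ∑ i, (P.normal k i : ℝ) * w i := by
  simp [normalForm]

theorem l_eq (k : Fin P.numFacets) (x : E n) : P.l k x = P.normalForm k x - P.offset k := by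
  rw [normalForm_apply]; rfl

theorem l_add_smul (k : Fin P.numFacets) (x w : E n) (t : ℝ) :
    P.l k (x + t • w) = P.l k x + t * P.normalForm k w := by
  simp only [l_eq, map_add, map_smul, smul_eq_mul]; ring

theorem hasFDerivAt_l (k : Fin P.numFacets) (x : E n) :
    HasFDerivAt (P.l k) (P.normalForm k) x := by
  have : P.l k = fun x => P.normalForm k x - P.offset k := funext (P.l_eq k)
  rw [this]
  exact (P.normalForm k).hasFDerivAt.sub_const _

theorem contDiff_l (k : Fin P.numFacets) : ContDiff ℝ ∞ (P.l k) := by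
  have : P.l k = fun x => P.normalForm k x - P.offset k := funext (P.l_eq k)
  rw [this]
  exact (P.normalForm k).contDiff.sub contDiff_const

theorem continuous_l (k : Fin P.numFacets) : Continuous (P.l k) := (P.contDiff_l k).continuous

theorem isOpen_inner : IsOpen P.inner := by
  simp only [inner, ofPred_forall]
  exact isOpen_iInter_of_finite fun k => isOpen_lt continuous_const (P.continuous_l k)

theorem inner_subset_closed : P.inner ⊆ P.closed := fun _ hx k => (hx k).le

theorem isCompact_closed : IsCompact P.closed := by
  refine Metric.isCompact_of_isClosed_isBounded ?_ P.bounded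
  simp only [closed, ofPred_forall]
  exact isClosed_iInter fun k => isClosed_le continuous_const (P.continuous_l k)

/-- The points of the polytope at which all `l_k` are at least `c`. -/
def core (c : ℝ) : Set (E n) := {x | ∀ k, c ≤ P.l k x}

theorem core_subset_inner {c : ℝ} (hc : 0 < c) : P.core c ⊆ P.inner :=
  fun _ hx k => hc.trans_le (hx k)

theorem isCompact_core {c : ℝ} (hc : 0 < c) : IsCompact (P.core c) := by
  refine P.isCompact_closed.of_isClosed_subset ?_
    ((P.core_subset_inner hc).trans P.inner_subset_closed)
  simp only [core, ofPred_forall]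
  exact isClosed_iInter fun k => isClosed_le continuous_const (P.continuous_l k)

theorem normalForm_ne_zero (k : Fin P.numFacets) : P.normalForm k ≠ 0 := by
  intro h
  obtain ⟨x, hx, -⟩ := P.facet k
  obtain ⟨y, hy⟩ := P.nonempty_interior
  have h1 : P.l k x = 0 := hx
  have h2 : 0 < P.l k y := hy k
  rw [l_eq, h] at h1 h2
  simp at h1 h2
  linarith

/-- The derivative of the Guillemin potential. -/
theorem hasFDerivAt_guilleminPotential {x : E n} (hx : x ∈ P.inner) :
    HasFDerivAt P.guilleminPotential
      ((1 / 2 : ℝ) • ∑ k, (Real.log (P.l k x) + 1) • P.normalForm k) x := by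
  have h1 : ∀ k ∈ Finset.univ, HasFDerivAt (fun x => P.l k x * Real.log (P.l k x))
      ((Real.log (P.l k x) + 1) • P.normalForm k) x := fun k _ =>
    (Real.hasDerivAt_mul_log (hx k).ne').comp_hasFDerivAt x (P.hasFDerivAt_l k x)
  have h2 := (HasFDerivAt.fun_sum h1).const_mul (1 / 2 : ℝ)
  exact h2

theorem contDiffOn_guilleminPotential : ContDiffOn ℝ ∞ P.guilleminPotential P.inner := by
  intro x hx
  have h1 : ∀ k, ContDiffAt ℝ ∞ (fun x => P.l k x * Real.log (P.l k x)) x := fun k =>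
    ((P.contDiff_l k).contDiffAt).mul ((P.contDiff_l k).contDiffAt.log (hx k).ne')
  have h2 : ContDiffAt ℝ ∞ (fun x => (1 / 2 : ℝ) * ∑ k, P.l k x * Real.log (P.l k x)) x :=
    contDiffAt_const.mul (ContDiffAt.sum fun k _ => h1 k)
  exact h2.contDiffWithinAt

end DelzantPolytope

variable {P : DelzantPolytope n} {u : E n → ℝ}

theorem DelzantPolytope.Guillemin.contDiffOn (hu : P.Guillemin u) : ContDiffOn ℝ ∞ u P.inner := by
  obtain ⟨v, hv, h⟩ := hu.smooth
  exact (P.contDiffOn_guilleminPotential.add hv.contDiffOn).congr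
    fun x hx => h x (P.inner_subset_closed hx)

theorem DelzantPolytope.Guillemin.contDiffOn_fderiv (hu : P.Guillemin u) :
    ContDiffOn ℝ ∞ (fderiv ℝ u) P.inner :=
  hu.contDiffOn.fderiv_of_isOpen P.isOpen_inner (by simp)

theorem DelzantPolytope.Guillemin.differentiableAt_fderiv (hu : P.Guillemin u) {x : E n}
    (hx : x ∈ P.inner) : DifferentiableAt ℝ (fderiv ℝ u) x :=
  (hu.contDiffOn_fderiv.contDiffAt (P.isOpen_inner.mem_nhds hx)).differentiableAt (by simp)

theorem DelzantPolytope.Guillemin.hessMetric (hu : P.Guillemin u) :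
    HessMetric u P.inner (hessForm u) where
  isOpen := P.isOpen_inner
  smooth := hu.contDiffOn_fderiv.fderiv_of_isOpen P.isOpen_inner (by simp)
  symm x hx v w := by
    have h := (hu.contDiffOn.contDiffAt (P.isOpen_inner.mem_nhds hx)).isSymmSndFDerivAt
      (by simpa using natCast_le_infty 2)
    exact h v w
  eq x hx w := metricForm_eq_hessForm (hu.differentiableAt_fderiv hx) w
  pos x hx w hw := by
    have h := hu.convex x (P.inner_subset_closed hx) w hw
      (fun k hk => absurd hk (hx k).ne')
    have hline : ∀ t : ℝ, HasDerivAt (fun t : ℝ => x + t • w) w t := fun t => by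
      simpa using ((hasDerivAt_id t).smul_const w).const_add x
    have h1 : deriv (fun t : ℝ => u (x + t • w)) =ᶠ[𝓝 0]
        fun t => fderiv ℝ u (x + t • w) w := by
      have hcont : ContinuousAt (fun t : ℝ => x + t • w) 0 := (hline 0).continuousAt
      have hx' : P.inner ∈ 𝓝 (x + (0 : ℝ) • w) := by
        rw [zero_smul, add_zero]; exact P.isOpen_inner.mem_nhds hx
      filter_upwards [hcont.preimage_mem_nhds hx'] with t ht
      have hd : HasFDerivAt u (fderiv ℝ u (x + t • w)) (x + t • w) :=
        ((hu.contDiffOn.contDiffAt (P.isOpen_inner.mem_nhds ht)).differentiableAt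
          (by simp)).hasFDerivAt
      exact (HasFDerivAt.comp_hasDerivAt t hd (hline t)).deriv
    have h2 : HasDerivAt (fun t : ℝ => fderiv ℝ u (x + t • w)) (hessForm u x w) 0 := by
      refine HasFDerivAt.comp_hasDerivAt (0 : ℝ) (l := fderiv ℝ u) (l' := hessForm u x) ?_ (hline 0)
      simp only [zero_smul, add_zero]
      exact (hu.differentiableAt_fderiv hx).hasFDerivAt
    have h3 : HasDerivAt (fun t : ℝ => fderiv ℝ u (x + t • w) w) (hessForm u x w w) 0 := by
      simpa using h2.clm_apply (hasDerivAt_const (0 : ℝ) w)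
    rw [iteratedDeriv_succ, iteratedDeriv_one, h1.deriv_eq, h3.deriv] at h
    exact h

/-- The second derivative of `u` is that of the Guillemin potential up to a bounded form. -/
theorem DelzantPolytope.Guillemin.exists_hessForm_bound (hu : P.Guillemin u) :
    ∃ C : ℝ, 0 ≤ C ∧ ∀ x ∈ P.inner, ∀ w : E n,
      |hessForm u x w w - (1 / 2) * ∑ k, P.normalForm k w ^ 2 / P.l k x| ≤ C * ‖w‖ ^ 2 := by
  obtain ⟨v, hv, h⟩ := hu.smooth
  -- `v` is smooth on the whole space, so its second derivative is bounded on the compact polytope;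
  -- only the logarithmic part blows up.
  have hcont : Continuous (hessForm v) :=
    (hv.fderiv_right (m := ∞) (by simp)).continuous_fderiv (by simp)
  obtain ⟨C, hC⟩ := P.isCompact_closed.exists_bound_of_continuousOn
    (E := E n →L[ℝ] E n →L[ℝ] ℝ) hcont.continuousOn
  refine ⟨|C|, abs_nonneg _, fun x hx w => ?_⟩
  have hd1 : fderiv ℝ u =ᶠ[𝓝 x] fun y =>
      ((1 / 2 : ℝ) • ∑ k, (Real.log (P.l k y) + 1) • P.normalForm k) + fderiv ℝ v y := by
    filter_upwards [P.isOpen_inner.mem_nhds hx] with y hy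
    have hloc : u =ᶠ[𝓝 y] fun z => P.guilleminPotential z + v z := by
      filter_upwards [P.isOpen_inner.mem_nhds hy] with z hz using h z (P.inner_subset_closed hz)
    rw [hloc.fderiv_eq]
    exact ((P.hasFDerivAt_guilleminPotential hy).add
      ((hv.differentiable (by simp)) y).hasFDerivAt).fderiv
  have hlog : ∀ k ∈ Finset.univ, HasFDerivAt (fun y => (Real.log (P.l k y) + 1) • P.normalForm k)
      (((P.l k x)⁻¹ • P.normalForm k).smulRight (P.normalForm k)) x := fun k _ =>
    HasFDerivAt.smul_const (F := E n →L[ℝ] ℝ) (((P.hasFDerivAt_l k x).log (hx k).ne').add_const 1) _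
  have hd2 := ((HasFDerivAt.fun_sum hlog).const_smul (1 / 2 : ℝ)).add
    (((hv.fderiv_right (m := ∞) (by simp)).differentiable (by simp) x).hasFDerivAt)
  have hform : hessForm u x w w - (1 / 2) * ∑ k, P.normalForm k w ^ 2 / P.l k x =
      hessForm v x w w := by
    have h3 := hd1.fderiv_eq.trans hd2.fderiv
    have h4 : hessForm u x w w = ((1 / 2 : ℝ) • ∑ k, ((P.l k x)⁻¹ • P.normalForm k).smulRight
        (P.normalForm k) + fderiv ℝ (fderiv ℝ v) x) w w := by rw [hessForm, h3]
    rw [h4]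
    simp only [add_apply, smul_apply, sum_apply, ContinuousLinearMap.smulRight_apply, smul_eq_mul,
      hessForm]
    have h5 : ∑ k, (P.l k x)⁻¹ * P.normalForm k w * P.normalForm k w =
        ∑ k, P.normalForm k w ^ 2 / P.l k x :=
      Finset.sum_congr rfl fun k _ => by ring
    rw [h5]
    ring
  rw [hform, ← Real.norm_eq_abs]
  calc ‖hessForm v x w w‖ ≤ ‖hessForm v x‖ * ‖w‖ * ‖w‖ := (hessForm v x).le_opNorm₂ w w
    _ ≤ |C| * ‖w‖ * ‖w‖ := by
        gcongr
        exact (hC x (P.inner_subset_closed hx)).trans (le_abs_self C)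
    _ = _ := by ring

end Toric

/-! ### The distance function and short paths to the boundary. -/

namespace Toric

open Filter Topology

variable {n : ℕ}

theorem exists_pos_forall_le {ι : Type*} [Finite ι] (c : ι → ℝ) (h : ∀ i, 0 < c i) :
    ∃ ε > 0, ∀ i, ε ≤ c i := by
  rcases isEmpty_or_nonempty ι with h' | h'
  · exact ⟨1, one_pos, fun i => h'.elim i⟩
  · obtain ⟨i, hi⟩ := Finite.exists_min c
    exact ⟨c i, h i, hi⟩

variable {P : DelzantPolytope n} {u : E n → ℝ}

theorem DelzantPolytope.convex_inner (P : DelzantPolytope n) : Convex ℝ P.inner := by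
  intro x hx y hy a b ha hb hab k
  have e : P.l k (a • x + b • y) = a * P.l k x + b * P.l k y := by
    simp only [P.l_eq, map_add, map_smul, smul_eq_mul]
    linear_combination (-P.offset k) * hab.symm
  rw [e]
  rcases ha.eq_or_lt with rfl | ha'
  · have : b = 1 := by linarith
    subst this
    simpa using hy k
  · exact add_pos_of_pos_of_nonneg (mul_pos ha' (hx k)) (mul_nonneg hb (hy k).le)

theorem DelzantPolytope.add_smul_sub_mem (P : DelzantPolytope n) {x y : E n} (hx : x ∈ P.inner)
    (hy : y ∈ P.inner) {t : ℝ} (ht : t ∈ Icc (0 : ℝ) 1) : x + t • (y - x) ∈ P.inner :=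
  P.convex_inner.add_smul_sub_mem hx hy ht

theorem DelzantPolytope.Guillemin.sqrt_metric_le (hu : P.Guillemin u) {K : Set (E n)}
    (hK : IsCompact K) (hKU : K ⊆ P.inner) :
    ∃ C : ℝ, 0 ≤ C ∧ ∀ x ∈ K, ∀ v, √(metricForm u x v) ≤ C * ‖v‖ := by
  obtain ⟨c, R, hc, hR, h⟩ := hu.hessMetric.exists_bounds hK hKU
  refine ⟨√R, Real.sqrt_nonneg _, fun x hx v => ?_⟩
  rw [hu.hessMetric.eq x (hKU hx)]
  rcases eq_or_ne v 0 with rfl | hv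
  · simp
  have hvn : 0 < ‖v‖ := norm_pos_iff.2 hv
  have h1 := (h x hx (‖v‖⁻¹ • v) (by rw [norm_smul, norm_inv, norm_norm,
      inv_mul_cancel₀ hvn.ne'])).2
  rw [← Real.sqrt_sq hvn.le, ← Real.sqrt_mul hR]
  apply Real.sqrt_le_sqrt
  simp only [map_smul, smul_apply, smul_eq_mul] at h1
  calc hessForm u x v v = (‖v‖⁻¹ * (‖v‖⁻¹ * hessForm u x v v)) * ‖v‖ ^ 2 := by field_simp
    _ ≤ R * ‖v‖ ^ 2 := by gcongr

theorem DelzantPolytope.Guillemin.exists_conn (hu : P.Guillemin u) {x y : E n}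
    (hx : x ∈ P.inner) (hy : y ∈ P.inner) : ∃ ℓ : ℝ, 0 ≤ ℓ ∧
      Conn u P.inner x y (ENNReal.ofReal ℓ) := by
  have hsub : segment ℝ x y ⊆ P.inner := P.convex_inner.segment_subset hx hy
  have hcs : IsCompact (segment ℝ x y) := by
    rw [segment_eq_image']
    exact isCompact_Icc.image (by fun_prop)
  obtain ⟨C, hC, h⟩ := hu.sqrt_metric_le hcs hsub
  refine ⟨C * ‖y - x‖, by positivity, ?_⟩
  have := Conn.segment (u := u) (K := P.inner) (x := x) (v := y - x) (k := C * ‖y - x‖)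
    (fun t ht => P.add_smul_sub_mem hx hy ht) (fun t ht => h _ (by
      rw [segment_eq_image']; exact ⟨t, ht, rfl⟩) _)
  simpa using this

theorem DelzantPolytope.Guillemin.gDist_ne_top (hu : P.Guillemin u) {x y : E n}
    (hx : x ∈ P.inner) (hy : y ∈ P.inner) : gDist P u x y ≠ ⊤ := by
  obtain ⟨ℓ, -, h⟩ := hu.exists_conn hx hy
  exact ne_top_of_le_ne_top ENNReal.ofReal_ne_top (gDist_le_of_conn h)

/-- The distance as a real number. -/
noncomputable def rDist (P : DelzantPolytope n) (u : E n → ℝ) (x y : E n) : ℝ :=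
  (gDist P u x y).toReal

theorem rDist_nonneg (x y : E n) : 0 ≤ rDist P u x y := ENNReal.toReal_nonneg

theorem DelzantPolytope.Guillemin.ofReal_rDist (hu : P.Guillemin u) {x y : E n}
    (hx : x ∈ P.inner) (hy : y ∈ P.inner) :
    ENNReal.ofReal (rDist P u x y) = gDist P u x y :=
  ENNReal.ofReal_toReal (hu.gDist_ne_top hx hy)

theorem DelzantPolytope.Guillemin.rDist_le_add (hu : P.Guillemin u) {x y z : E n}
    (hx : x ∈ P.inner) (hy : y ∈ P.inner) {ℓ : ℝ} (hℓ : 0 ≤ ℓ)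
    (h : Conn u P.inner y z (ENNReal.ofReal ℓ)) : rDist P u x z ≤ rDist P u x y + ℓ := by
  have h1 : gDist P u x z ≤ gDist P u x y + ENNReal.ofReal ℓ :=
    gDist_triangle.trans (add_le_add le_rfl (gDist_le_of_conn h))
  rw [← hu.ofReal_rDist hx hy, ← ENNReal.ofReal_add (rDist_nonneg _ _) hℓ] at h1
  exact ENNReal.toReal_le_of_le_ofReal (add_nonneg (rDist_nonneg _ _) hℓ) h1

theorem DelzantPolytope.Guillemin.conn_of_rDist_lt (hu : P.Guillemin u) {x y : E n}
    (hx : x ∈ P.inner) (hy : y ∈ P.inner) {r : ℝ} (h : rDist P u x y < r) :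
    Conn u P.inner x y (ENNReal.ofReal r) := by
  apply conn_of_gDist_lt
  rw [← hu.ofReal_rDist hx hy]
  exact (ENNReal.ofReal_lt_ofReal_iff_of_nonneg (rDist_nonneg _ _)).2 h

theorem DelzantPolytope.Guillemin.continuousOn_rDist (hu : P.Guillemin u) {p : E n}
    (hp : p ∈ P.inner) : ContinuousOn (rDist P u p) P.inner := by
  intro x hx
  apply ContinuousAt.continuousWithinAt
  obtain ⟨δ, hδ, hball⟩ := Metric.nhds_basis_closedBall.mem_iff.1 (P.isOpen_inner.mem_nhds hx)
  obtain ⟨C, hC, h⟩ := hu.sqrt_metric_le (isCompact_closedBall x δ) hball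
  have hconn : ∀ y ∈ Metric.closedBall x δ, ∀ z ∈ Metric.closedBall x δ,
      Conn u P.inner y z (ENNReal.ofReal (C * ‖z - y‖)) := by
    intro y hy z hz
    have hseg : ∀ t ∈ Icc (0 : ℝ) 1, y + t • (z - y) ∈ Metric.closedBall x δ := fun t ht =>
      (convex_closedBall x δ).add_smul_sub_mem hy hz ht
    have := Conn.segment (u := u) (K := P.inner) (x := y) (v := z - y) (k := C * ‖z - y‖)
      (fun t ht => hball (hseg t ht)) (fun t ht => h _ (hseg t ht) _)
    simpa using this
  have hxb : x ∈ Metric.closedBall x δ := Metric.mem_closedBall_self hδ.le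
  rw [Metric.continuousAt_iff']
  intro ε hε
  have hlim : ∀ᶠ y in 𝓝 x, C * ‖y - x‖ < ε := by
    have : Continuous fun y : E n => C * ‖y - x‖ := by fun_prop
    exact (this.tendsto x).eventually_lt_const (by simpa)
  filter_upwards [Metric.closedBall_mem_nhds x hδ, hlim] with y hy hlt
  have h1 := hu.rDist_le_add hp hx (by positivity) (hconn x hxb y hy)
  have h2 := hu.rDist_le_add hp (hball hy) (by positivity) (hconn y hy x hxb)
  rw [norm_sub_rev] at h2
  rw [Real.dist_eq, abs_lt]
  constructor <;> linarith

theorem sqrt_sub_sqrt_le_sqrt_abs {a b : ℝ} (hb : 0 ≤ b) : √a - √b ≤ √|a - b| := by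
  have h1 : √a ≤ √(b + |a - b|) := Real.sqrt_le_sqrt (by linarith [le_abs_self (a - b)])
  have h2 : √(b + |a - b|) ≤ √b + √|a - b| := by
    rw [Real.sqrt_le_left (by positivity)]
    nlinarith [Real.sq_sqrt hb, Real.sq_sqrt (abs_nonneg (a - b)), Real.sqrt_nonneg b,
      Real.sqrt_nonneg |a - b|, mul_nonneg (Real.sqrt_nonneg b) (Real.sqrt_nonneg |a - b|)]
  linarith

/-- The length of a straight path from a point to the boundary, in terms of its Euclidean size. -/
theorem DelzantPolytope.Guillemin.exists_connBoundary (hu : P.Guillemin u) :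
    ∃ C : ℝ, 0 ≤ C ∧ ∀ x ∈ P.inner, ∀ k,
      ConnBoundary P u x (ENNReal.ofReal (C * (√(P.l k x) + P.l k x))) := by
  obtain ⟨C₀, hC₀, hbd⟩ := hu.exists_hessForm_bound
  -- Along `w k` the function `l_k` falls at unit rate; the path follows this direction until it
  -- meets its first facet, at a time at most `l_k(x)`.
  have hw : ∀ k, ∃ w : E n, P.normalForm k w = -1 := fun k => by
    have : ∃ w, P.normalForm k w ≠ 0 := by
      by_contra! h
      exact P.normalForm_ne_zero k (ContinuousLinearMap.ext h)
    obtain ⟨w, hw⟩ := this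
    exact ⟨(-(P.normalForm k w)⁻¹) • w, by simp [hw]⟩
  choose w hw using hw
  refine ⟨∑ k, (√C₀ * ‖w k‖ + ∑ j, 2 * √|P.normalForm j (w k)|),
    Finset.sum_nonneg fun k _ => by positivity, fun x hx k => ?_⟩
  -- the exit time
  set J := Finset.univ.filter (fun j => P.normalForm j (w k) < 0) with hJ
  have hkJ : k ∈ J := by simp [hJ, hw]
  obtain ⟨j₀, hj₀, hmin⟩ := J.exists_min_image (fun j => P.l j x / (-P.normalForm j (w k))) ⟨k, hkJ⟩
  set T := P.l j₀ x / (-P.normalForm j₀ (w k)) with hT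
  have hj₀' : P.normalForm j₀ (w k) < 0 := by simpa [hJ] using hj₀
  have hT0 : 0 < T := div_pos (hx j₀) (by linarith)
  have hTk : T ≤ P.l k x := by
    have := hmin k hkJ
    rw [hw k] at this
    simpa using this
  have hTj : ∀ j, 0 ≤ P.l j x + T * P.normalForm j (w k) := fun j => by
    rcases le_or_gt 0 (P.normalForm j (w k)) with h | h
    · have := hx j
      positivity
    · have := hmin j (by simp [hJ, h])
      rw [le_div_iff₀ (by linarith)] at this
      linarith
  have hlpos : ∀ t ∈ Ico (0 : ℝ) 1, ∀ j, 0 < P.l j x + t * (T * P.normalForm j (w k)) := by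
    intro t ht j
    have := mul_nonneg ht.1 (hTj j)
    have := mul_pos (sub_pos.2 ht.2) (hx j)
    linarith
  set γ : ℝ → E n := fun t => x + t • (T • w k) with hγ
  have hlγ : ∀ t j, P.l j (γ t) = P.l j x + t * (T * P.normalForm j (w k)) := fun t j => by
    simp only [hγ]
    rw [P.l_add_smul, map_smul, smul_eq_mul]
  have hγin : ∀ t ∈ Ico (0 : ℝ) 1, γ t ∈ P.inner := fun t ht j => by
    rw [hlγ]; exact hlpos t ht j
  have hγs : ContDiff ℝ 1 γ := by simp only [hγ]; fun_prop
  have hγd : ∀ t, deriv γ t = T • w k := fun t => by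
    have := ((hasDerivAt_id t).smul_const (T • w k)).const_add x
    simpa [hγ] using this.deriv
  refine ⟨γ, ⟨hγs.continuous.continuousOn, fun b _ => ContDiffOn.piecewiseC1On hγs.contDiffOn,
    by simp [hγ], ⟨fun j => ?_, fun h => ?_⟩, hγin⟩, ?_⟩
  · rw [hlγ, one_mul]; exact hTj j
  · have h1 := h j₀
    rw [hlγ, one_mul, hT, div_mul_eq_mul_div, mul_div_assoc, div_neg, div_self hj₀'.ne] at h1
    linarith
  -- the length
  have hsign : ∀ j, SignType.sign (P.normalForm j (w k)) * P.normalForm j (w k) =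
    |P.normalForm j (w k)| := fun j => sign_mul_self _
  set σ : Fin P.numFacets → ℝ := fun j => (SignType.sign (P.normalForm j (w k)) : ℝ) with hσ
  have hσabs : ∀ j, |σ j| ≤ 1 := fun j => by
    simp only [hσ]
    rcases lt_trichotomy (P.normalForm j (w k)) 0 with h | h | h
    · simp [sign_neg h]
    · simp [h]
    · simp [sign_pos h]
  -- The metric is at most ½ Σ (dl_j)²/l_j plus a bounded form, so the speed is at most `T` times a
  -- constant plus Σ |dl_j(w)|/√l_j. The antiderivative of each singular term is `2 σ_j √l_j`, which
  -- is finite up to the boundary.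
  set h : ℝ → ℝ := fun t => t * (T * (√C₀ * ‖w k‖)) +
    ∑ j, 2 * σ j * √(P.l j x + t * (T * P.normalForm j (w k))) with hh
  have hlen : gLength u γ 0 1 ≤ ENNReal.ofReal (h 1 - h 0) := by
    refine lintegral_le_of_hasDerivAt_off_finset (h := h)
      (h' := fun t => T * (√C₀ * ‖w k‖) + ∑ j, 2 * σ j * (T * P.normalForm j (w k) /
        (2 * √(P.l j x + t * (T * P.normalForm j (w k)))))) zero_le_one ∅ ?_ ?_
    · simp only [hh]; fun_prop
    · intro t ht _
      have htI : t ∈ Ico (0 : ℝ) 1 := ⟨ht.1.le, ht.2⟩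
      refine ⟨?_, Real.sqrt_nonneg _, ?_⟩
      · refine HasDerivAt.add ?_ (HasDerivAt.fun_sum fun j _ => HasDerivAt.const_mul _ ?_)
        · simpa using (hasDerivAt_id t).mul_const (T * (√C₀ * ‖w k‖))
        · refine HasDerivAt.sqrt ?_ (hlpos t htI j).ne'
          simpa using ((hasDerivAt_id t).mul_const (T * P.normalForm j (w k))).const_add (P.l j x)
      · rw [hγd, sqrt_metricForm_smul _ _ _ hT0.le]
        have e1 : T * (√C₀ * ‖w k‖) + ∑ j, 2 * σ j * (T * P.normalForm j (w k) /
            (2 * √(P.l j x + t * (T * P.normalForm j (w k))))) =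
            T * (√C₀ * ‖w k‖ + ∑ j, |P.normalForm j (w k)| / √(P.l j (γ t))) := by
          rw [mul_add, Finset.mul_sum]
          congr 1
          refine Finset.sum_congr rfl fun j _ => ?_
          rw [hlγ, ← hsign j]
          simp only [hσ]
          ring
        rw [e1]
        refine mul_le_mul_of_nonneg_left ?_ hT0.le
        have hγt := hγin t htI
        have hsum0 : 0 ≤ ∑ j, |P.normalForm j (w k)| / √(P.l j (γ t)) :=
          Finset.sum_nonneg fun j _ => by positivity
        rw [Real.sqrt_le_left (by positivity), hu.hessMetric.eq _ hγt]
        have h1 := (abs_le.1 (hbd _ hγt (w k))).2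
        have h2 := Finset.sum_sq_le_sq_sum_of_nonneg (s := Finset.univ)
          (f := fun j => |P.normalForm j (w k)| / √(P.l j (γ t))) fun j _ => by positivity
        have h3 : ∑ j, (|P.normalForm j (w k)| / √(P.l j (γ t))) ^ 2 =
            ∑ j, P.normalForm j (w k) ^ 2 / P.l j (γ t) :=
          Finset.sum_congr rfl fun j _ => by
            rw [div_pow, sq_abs, Real.sq_sqrt (hγt j).le]
        have h4 : 0 ≤ ∑ j, P.normalForm j (w k) ^ 2 / P.l j (γ t) :=
          Finset.sum_nonneg fun j _ => div_nonneg (sq_nonneg _) (hγt j).le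
        rw [h3] at h2
        have h5 : (√C₀ * ‖w k‖) ^ 2 = C₀ * ‖w k‖ ^ 2 := by rw [mul_pow, Real.sq_sqrt hC₀]
        have h6 : 0 ≤ √C₀ * ‖w k‖ := by positivity
        nlinarith
  refine hlen.trans (ENNReal.ofReal_le_ofReal ?_)
  -- `l_j` changes by at most `|dl_j(w)| * l_k(x)` since `T ≤ l_k(x)`, and the square root is Hölder
  -- continuous of exponent 1/2.
  have hterm : ∀ j, 2 * σ j * √(P.l j x + 1 * (T * P.normalForm j (w k))) -
      2 * σ j * √(P.l j x + 0 * (T * P.normalForm j (w k))) ≤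
      2 * √|P.normalForm j (w k)| * √(P.l k x) := fun j => by
    have h1 := hTj j
    have h0 := (hx j).le
    have d1 := sqrt_sub_sqrt_le_sqrt_abs (a := P.l j x + T * P.normalForm j (w k)) h0
    have d2 := sqrt_sub_sqrt_le_sqrt_abs (a := P.l j x) h1
    have e1 : |P.l j x + T * P.normalForm j (w k) - P.l j x| = T * |P.normalForm j (w k)| := by
      rw [add_sub_cancel_left, abs_mul, abs_of_pos hT0]
    rw [abs_sub_comm, e1] at d2
    rw [e1] at d1
    have d3 : √(T * |P.normalForm j (w k)|) ≤ √|P.normalForm j (w k)| * √(P.l k x) := by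
      rw [← Real.sqrt_mul (abs_nonneg _), mul_comm]
      exact Real.sqrt_le_sqrt (by gcongr)
    have d4 : |√(P.l j x + T * P.normalForm j (w k)) - √(P.l j x)| ≤
        √|P.normalForm j (w k)| * √(P.l k x) := abs_le.2 ⟨by linarith, by linarith⟩
    rw [one_mul, zero_mul, add_zero, ← mul_sub]
    have d5 : σ j * (√(P.l j x + T * P.normalForm j (w k)) - √(P.l j x)) ≤
        1 * (√|P.normalForm j (w k)| * √(P.l k x)) := by
      refine (le_abs_self _).trans ?_
      rw [abs_mul]
      exact mul_le_mul (hσabs j) d4 (abs_nonneg _) zero_le_one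
    linarith
  have hdiff : h 1 - h 0 ≤ T * (√C₀ * ‖w k‖) + (∑ j, 2 * √|P.normalForm j (w k)|) * √(P.l k x) := by
    simp only [hh]
    rw [Finset.sum_mul]
    have := Finset.sum_le_sum fun j (_ : j ∈ Finset.univ) => hterm j
    rw [Finset.sum_sub_distrib] at this
    linarith
  refine hdiff.trans ?_
  have hck : √C₀ * ‖w k‖ + ∑ j, 2 * √|P.normalForm j (w k)| ≤
      ∑ k, (√C₀ * ‖w k‖ + ∑ j, 2 * √|P.normalForm j (w k)|) :=
    Finset.single_le_sum (f := fun k => √C₀ * ‖w k‖ + ∑ j, 2 * √|P.normalForm j (w k)|)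
      (fun k _ => by positivity) (Finset.mem_univ k)
  have hl0 := (hx k).le
  have hs0 := Real.sqrt_nonneg (P.l k x)
  have hA : 0 ≤ √C₀ * ‖w k‖ := by positivity
  have hB : 0 ≤ ∑ j, 2 * √|P.normalForm j (w k)| := by positivity
  calc _ ≤ (√C₀ * ‖w k‖ + ∑ j, 2 * √|P.normalForm j (w k)|) * (√(P.l k x) + P.l k x) := by
        nlinarith [mul_le_mul_of_nonneg_right hTk hA, mul_nonneg hA hs0, mul_nonneg hB hl0]
    _ ≤ _ := by gcongr

/-- A ball whose radius is less than the distance to the boundary stays away from the boundary. -/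
theorem DelzantPolytope.Guillemin.exists_mem_core (hu : P.Guillemin u) {p : E n} {α r : ℝ}
    (hr : 0 ≤ r) (hrα : r < α) (hpα : ENNReal.ofReal α ≤ gDistBoundary P u p) :
    ∃ c > 0, ∀ x ∈ P.inner, Conn u P.inner p x (ENNReal.ofReal r) → x ∈ P.core c := by
  obtain ⟨C, hC, h⟩ := hu.exists_connBoundary
  -- A point of the ball with some `l_k < c` could then be joined to the boundary by a path shorter
  -- than `α - r`, and `p` by one shorter than `α`.
  have hev : ∀ᶠ c : ℝ in 𝓝[>] 0, C * (√c + c) < α - r := by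
    have hcont : Continuous fun c : ℝ => C * (√c + c) := by fun_prop
    have h0 : C * (√0 + 0) < α - r := by simpa using hrα
    exact ((hcont.tendsto 0).eventually_lt_const h0).filter_mono nhdsWithin_le_nhds
  obtain ⟨c, hc, hc0⟩ := (hev.and self_mem_nhdsWithin).exists
  refine ⟨c, hc0, fun x hx hconn k => ?_⟩
  by_contra hlt
  push Not at hlt
  have h1 := hpα.trans ((gDistBoundary_le_add hconn).trans
    (add_le_add le_rfl (h x hx k).gDistBoundary_le))
  have hl := (hx k).le
  rw [← ENNReal.ofReal_add hr (by positivity), ENNReal.ofReal_le_ofReal_iff (by positivity)] at h1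
  have h2 : √(P.l k x) ≤ √c := Real.sqrt_le_sqrt hlt.le
  have h3 : C * (√(P.l k x) + P.l k x) ≤ C * (√c + c) := by gcongr
  linarith

end Toric

/-! ### The gradient bound. -/

namespace Toric

open Filter Topology

variable {n : ℕ} {P : DelzantPolytope n} {u : E n → ℝ} {f : E n → ℝ} {X : E n → E n}

theorem eventually_lt_of_hasDerivAt {θ : ℝ → ℝ} {θ' k : ℝ} (h : HasDerivAt θ θ' 0) (hk : θ' < k) :
    ∀ᶠ s in 𝓝[>] (0 : ℝ), θ s < θ 0 + k * s := by
  have h1 := (hasDerivAt_iff_tendsto_slope.1 h).mono_left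
    (nhdsWithin_mono 0 (fun s (hs : s ∈ Ioi (0 : ℝ)) => (ne_of_gt hs : s ≠ 0)))
  filter_upwards [h1.eventually_lt_const hk, self_mem_nhdsWithin] with s hs hs0
  rw [slope_def_field, sub_zero, div_lt_iff₀ hs0] at hs
  linarith

/-- The squared length of the gradient along the direction of steepest descent. -/
theorem SinhConcave.hasDerivAt_ratio {G : E n → E n →L[ℝ] E n →L[ℝ] ℝ} {U : Set (E n)}
    (hG : HessMetric u U G) (hf : SinhConcave G U f X) {x : E n} (hx : x ∈ U)
    (hN : 0 < √(G x (X x) (X x))) :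
    ∃ w', w' ≤ -(1 - (f x / √(G x (X x) (X x))) ^ 2) ∧
      HasDerivAt (fun s : ℝ => f (x + s • (-(√(G x (X x) (X x)))⁻¹ • X x)) /
        √(G (x + s • (-(√(G x (X x) (X x)))⁻¹ • X x)) (X (x + s • (-(√(G x (X x) (X x)))⁻¹ • X x)))
          (X (x + s • (-(√(G x (X x) (X x)))⁻¹ • X x))))) w' 0 := by
  set N := √(G x (X x) (X x)) with hNdef
  have hN2 : G x (X x) (X x) = N ^ 2 := by rw [hNdef, Real.sq_sqrt (hG.nonneg hx _)]
  set v : E n := -N⁻¹ • X x with hv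
  have hline : HasDerivAt (fun s : ℝ => x + s • v) v 0 := by
    simpa using ((hasDerivAt_id (0 : ℝ)).smul_const v).const_add x
  have hx0 : x + (0 : ℝ) • v = x := by simp
  have hnhds := hG.isOpen.mem_nhds hx
  have hfd : HasDerivAt (fun s : ℝ => f (x + s • v)) (fderiv ℝ f x v) 0 := by
    refine HasFDerivAt.comp_hasDerivAt (0 : ℝ) ?_ hline
    rw [hx0]
    exact ((hf.smooth.contDiffAt hnhds).differentiableAt (by simp)).hasFDerivAt
  have hXd : HasDerivAt (fun s : ℝ => X (x + s • v)) (fderiv ℝ X x v) 0 := by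
    refine HasFDerivAt.comp_hasDerivAt (0 : ℝ) ?_ hline
    rw [hx0]
    exact ((hf.smooth_grad.contDiffAt hnhds).differentiableAt (by simp)).hasFDerivAt
  have hGd : HasDerivAt (fun s : ℝ => G (x + s • v)) (fderiv ℝ G x v) 0 := by
    refine HasFDerivAt.comp_hasDerivAt (E := E n →L[ℝ] E n →L[ℝ] ℝ) (0 : ℝ) ?_ hline
    rw [hx0]
    exact ((hG.smooth.contDiffAt hnhds).differentiableAt (by simp)).hasFDerivAt
  have hQd := (hGd.clm_apply hXd).clm_apply hXd
  simp only [hx0] at hQd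
  have hQ0 : G (x + (0 : ℝ) • v) (X (x + (0 : ℝ) • v)) (X (x + (0 : ℝ) • v)) ≠ 0 := by
    rw [hx0, hN2]; positivity
  have hq := hfd.div (hQd.sqrt hQ0) (by
    rw [hx0]; exact hN.ne')
  -- Along the unit vector `v` one has f' = -N, and the Hessian bound at `X` gives N' ≥ -f, whence
  -- (f/N)' ≤ -1 + (f/N)², a Riccati inequality. Below, `D` is the derivative of N².
  refine ⟨_, ?_, hq⟩
  simp only [hx0, ← hNdef]
  have hfv : fderiv ℝ f x v = -N := by
    rw [← hf.grad x hx, hv, map_smul, hN2, smul_eq_mul]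
    field_simp
  have hle := hf.hess_le x hx (X x)
  rw [hN2] at hle
  set D := (fderiv ℝ G x v (X x) + G x (fderiv ℝ X x v)) (X x) + G x (X x) (fderiv ℝ X x v) with hD
  have hDle : -(2 * f x * N) ≤ D := by
    have e : D = -(2 * N⁻¹ * (1 / 2 * fderiv ℝ G x (X x) (X x) (X x) +
        G x (X x) (fderiv ℝ X x (X x)))) := by
      rw [hD, hv]
      simp only [map_smul, add_apply, smul_apply, smul_eq_mul]
      rw [hG.symm x hx (fderiv ℝ X x (X x)) (X x)]
      ring
    rw [e]
    have : 2 * N⁻¹ * (1 / 2 * fderiv ℝ G x (X x) (X x) (X x) +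
        G x (X x) (fderiv ℝ X x (X x))) ≤ 2 * N⁻¹ * (f x * N ^ 2) := by gcongr
    have e2 : 2 * N⁻¹ * (f x * N ^ 2) = 2 * f x * N := by field_simp
    linarith
  rw [hfv]
  have hfp := hf.pos x hx
  have e3 : (-N * N - f x * (D / (2 * N))) / N ^ 2 = -1 - f x * D / (2 * N ^ 3) := by field_simp
  rw [e3]
  have h4 : -(f x * (2 * f x * N)) ≤ f x * D := by
    have := mul_le_mul_of_nonneg_left hDle hfp.le
    linarith
  have h5 : -(f x * (2 * f x * N)) / (2 * N ^ 3) ≤ f x * D / (2 * N ^ 3) := by gcongr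
  have e6 : -(f x * (2 * f x * N)) / (2 * N ^ 3) = -(f x / N) ^ 2 := by field_simp
  linarith

set_option maxHeartbeats 800000 in
/-- The gradient of a positive function, whose Hessian is at most `f` times the metric, is
controlled by the distance to the boundary. -/
theorem DelzantPolytope.Guillemin.gradient_le (hu : P.Guillemin u)
    (hf : SinhConcave (hessForm u) P.inner f X) {p : E n} (hp : p ∈ P.inner) {α : ℝ} (hα : 0 < α)
    (hpα : ENNReal.ofReal α ≤ gDistBoundary P u p) :
    √(hessForm u p (X p) (X p)) * Real.sinh α ≤ f p * Real.cosh α := by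
  by_contra hcon
  push Not at hcon
  have hG := hu.hessMetric
  set N : E n → ℝ := fun x => √(hessForm u x (X x) (X x)) with hN
  have hNc : ContinuousOn N P.inner := by
    have h1 := (hG.smooth.continuousOn.clm_apply hf.smooth_grad.continuousOn).clm_apply
      hf.smooth_grad.continuousOn
    exact h1.sqrt
  have hfp : 0 < f p := hf.pos p hp
  have hsα : 0 < Real.sinh α := Real.sinh_pos_iff.2 hα
  have hNf : f p < N p := by
    have := Real.sinh_lt_cosh α
    nlinarith
  have hNp : 0 < N p := hfp.trans hNf
  set w : E n → ℝ := fun x => f x / N x with hw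
  -- This is artanh. By the Riccati inequality θ(f/N) falls at least at unit rate along steepest
  -- descent, so `f` would reach 0 within distance θ(w₀), and the negated claim says that θ(w₀) < α.
  -- The contradiction is drawn at a minimum of θ(f/N) + λ · distance with λ < 1.
  set θ : ℝ → ℝ := fun w => (Real.log (1 + w) - Real.log (1 - w)) / 2 with hθ
  set w₀ := w p with hw₀
  have hw0pos : 0 < w₀ := div_pos hfp hNp
  have hw01 : w₀ < 1 := (div_lt_one hNp).2 hNf
  have hθpos : ∀ s, 0 < s → s < 1 → 0 < θ s := fun s h0 h1 => by
    have a1 : 0 < Real.log (1 + s) := Real.log_pos (by linarith)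
    have a2 : Real.log (1 - s) < 0 := Real.log_neg (by linarith) (by linarith)
    simp only [hθ]; linarith
  have hθα : θ w₀ < α := by
    have h1 : 1 + w₀ < Real.exp (2 * α) * (1 - w₀) := by
      have e1 : 1 + w₀ = (N p + f p) / N p := by simp only [hw₀, hw]; field_simp
      have e2 : Real.exp (2 * α) * (1 - w₀) = (Real.exp (2 * α) * (N p - f p)) / N p := by
        simp only [hw₀, hw]; field_simp
      rw [e1, e2]
      refine (div_lt_div_iff_of_pos_right hNp).2 ?_
      have e3 : Real.exp (2 * α) = Real.exp α * Real.exp α := by rw [← Real.exp_add]; ring_nf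
      have e4 : Real.exp α * Real.exp (-α) = 1 := by rw [← Real.exp_add]; simp
      rw [Real.sinh_eq, Real.cosh_eq] at hcon
      have h3 := mul_lt_mul_of_pos_left hcon (Real.exp_pos α)
      have e5 : Real.exp α * (f p * ((Real.exp α + Real.exp (-α)) / 2)) =
          f p * (Real.exp α * Real.exp α + Real.exp α * Real.exp (-α)) / 2 := by ring
      have e6 : Real.exp α * (N p * ((Real.exp α - Real.exp (-α)) / 2)) =
          N p * (Real.exp α * Real.exp α - Real.exp α * Real.exp (-α)) / 2 := by ring
      rw [e3]
      change _ < Real.exp α * (N p * ((Real.exp α - Real.exp (-α)) / 2)) at h3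
      rw [e5, e6, e4] at h3
      linarith
    have h2 : Real.log (1 + w₀) < 2 * α + Real.log (1 - w₀) := by
      have := Real.log_lt_log (by linarith) h1
      rwa [Real.log_mul (Real.exp_pos _).ne' (by linarith), Real.log_exp] at this
    simp only [hθ]; linarith
  have hθ0 := hθpos w₀ hw0pos hw01
  obtain ⟨r, hr1, hr2⟩ := exists_between hθα
  have hr0 : 0 < r := hθ0.trans hr1
  -- Chosen so that at distance `r` the penalty alone equals the value at `p`; the minimum therefore
  -- lies strictly inside the ball.
  set lam := θ w₀ / r with hlam
  have hlam0 : 0 < lam := div_pos hθ0 hr0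
  have hlam1 : lam < 1 := (div_lt_one hr0).2 hr1
  have hlamr : lam * r = θ w₀ := by rw [hlam]; field_simp
  obtain ⟨r', hr'1, hr'2⟩ := exists_between hr2
  obtain ⟨c, hc, hcore⟩ := hu.exists_mem_core (hr0.le.trans hr'1.le) hr'2 hpα
  have hDc := hu.continuousOn_rDist (u := u) hp
  set D := rDist P u p with hD
  -- The condition says f/N ≤ w₀ without division. As `f` is positive it also excludes zeros of the
  -- gradient.
  set A : Set (E n) := {x | x ∈ P.core c ∧ (D x ≤ r ∧ f x - w₀ * N x ≤ 0)} with hA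
  have hAin : ∀ x ∈ A, x ∈ P.inner := fun x hx => P.core_subset_inner hc hx.1
  have hcoreD : ∀ x ∈ P.inner, D x ≤ r → x ∈ P.core c := fun x hx hxr =>
    hcore x hx (hu.conn_of_rDist_lt hp hx (hxr.trans_lt hr'1))
  have hfc := hf.smooth.continuousOn
  have hAc : IsCompact A := by
    have hK := P.isCompact_core hc
    have hs := P.core_subset_inner hc
    have hc1 : ContinuousOn (fun x => (D x, f x - w₀ * N x)) (P.core c) :=
      (hDc.mono hs).prodMk ((hfc.mono hs).sub (continuousOn_const.mul (hNc.mono hs)))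
    have := hc1.preimage_isClosed_of_isClosed hK.isClosed (isClosed_Iic (a := r) |>.prod
      (isClosed_Iic (a := (0 : ℝ))))
    exact hK.of_isClosed_subset this (fun x hx => hx.1)
  have hNA : ∀ x ∈ A, 0 < N x := fun x hx => by
    have h1 := hf.pos x (hAin x hx)
    by_contra h
    push Not at h
    nlinarith [hx.2.2]
  have hwA : ∀ x ∈ A, 0 < w x ∧ w x ≤ w₀ := fun x hx =>
    ⟨div_pos (hf.pos x (hAin x hx)) (hNA x hx), by
      simp only [hw]; rw [div_le_iff₀ (hNA x hx)]; linarith [hx.2.2]⟩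
  have hDp : D p = 0 := by simp [hD, rDist, gDist_self hp]
  have hpA : p ∈ A := ⟨hcoreD p hp (hDp ▸ hr0.le), hDp ▸ hr0.le, by
    have : f p = w₀ * N p := by simp only [hw₀, hw]; field_simp
    linarith⟩
  have hwc : ContinuousOn w A := (hfc.mono hAin).div (hNc.mono hAin) fun x hx => (hNA x hx).ne'
  have hmc : ContinuousOn (fun x => θ (w x) + lam * D x) A := by
    refine ContinuousOn.add ?_ (continuousOn_const.mul (hDc.mono hAin))
    refine ContinuousOn.div_const (ContinuousOn.sub ?_ ?_) 2
    · exact (continuousOn_const.add hwc).log fun x hx =>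
        (show 0 < 1 + w x by linarith [(hwA x hx).1]).ne'
    · exact (continuousOn_const.sub hwc).log fun x hx =>
        (show 0 < 1 - w x by linarith [(hwA x hx).2]).ne'
  obtain ⟨x, hxA, hmin⟩ := hAc.exists_isMinOn ⟨p, hpA⟩ hmc
  have hx := hAin x hxA
  obtain ⟨hwx0, hwx1⟩ := hwA x hxA
  have hDx : D x < r := by
    have h1 := hmin hpA
    simp only [mem_ofPred_eq] at h1
    rw [hDp, mul_zero, add_zero] at h1
    have h2 := hθpos (w x) hwx0 (hwx1.trans_lt hw01)
    have h3 : lam * D x < lam * r := by rw [hlamr]; simp only [hw₀]; linarith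
    exact lt_of_mul_lt_mul_left h3 hlam0.le
  have hNx := hNA x hxA
  obtain ⟨w', hw', hder⟩ := hf.hasDerivAt_ratio hG hx hNx
  set v : E n := -(√(hessForm u x (X x) (X x)))⁻¹ • X x with hv
  have hder' : HasDerivAt (fun s : ℝ => w (x + s • v)) w' 0 := hder
  have hx0 : x + (0 : ℝ) • v = x := by simp
  have hwx : w' ≤ -(1 - w x ^ 2) := hw'
  have hw1sq : 0 < 1 - w x ^ 2 := by nlinarith
  have hθd : HasDerivAt (fun s : ℝ => θ (w (x + s • v)))
      ((w' / (1 + w x) - -w' / (1 - w x)) / 2) 0 := by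
    have h1 := (hder'.const_add 1).log (by rw [hx0]; linarith)
    have h2 := (hder'.const_sub 1).log (by rw [hx0]; linarith)
    simp only [hx0] at h1 h2
    exact (h1.sub h2).div_const 2
  have hθ' : (w' / (1 + w x) - -w' / (1 - w x)) / 2 ≤ -1 := by
    have p1 : 0 < 1 + w x := by linarith
    have p2 : 0 < 1 - w x := by linarith
    have e : (w' / (1 + w x) - -w' / (1 - w x)) / 2 = w' / (1 - w x ^ 2) := by
      have : 1 - w x ^ 2 = (1 + w x) * (1 - w x) := by ring
      rw [this]; field_simp; ring
    rw [e, div_le_iff₀ hw1sq]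
    linarith
  -- Near `x` the vector `v` has length less than `k`, so the penalty grows at rate at most `lam * k
  -- < 1`, while θ(f/N) falls at rate at least 1.
  obtain ⟨k, hk1, hk2⟩ := exists_between ((one_lt_div hlam0).2 hlam1)
  have hlk : lam * k < 1 := by rwa [lt_div_iff₀ hlam0, mul_comm] at hk2
  -- the length of short segments
  have hlinec : Continuous fun s : ℝ => x + s • v := by fun_prop
  have hGv : hessForm u x v v = 1 := by
    have hN2 : hessForm u x (X x) (X x) = N x ^ 2 := by
      simp only [hN]; rw [Real.sq_sqrt (hG.nonneg hx _)]
    have : v = -(N x)⁻¹ • X x := rfl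
    rw [this]
    simp only [map_smul, smul_apply, smul_eq_mul, hN2]
    field_simp
  have hspeed : ∀ᶠ s : ℝ in 𝓝 0, x + s • v ∈ P.inner ∧ hessForm u (x + s • v) v v < k ^ 2 := by
    have hin : ∀ᶠ s : ℝ in 𝓝 0, x + s • v ∈ P.inner :=
      hlinec.continuousAt.preimage_mem_nhds (by rw [hx0]; exact P.isOpen_inner.mem_nhds hx)
    refine hin.and ?_
    have hcg : ContinuousAt (fun y => hessForm u y v v) (x + (0 : ℝ) • v) := by
      rw [hx0]
      exact ((hG.smooth.continuousOn.clm_apply continuousOn_const).clm_apply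
        continuousOn_const).continuousAt (P.isOpen_inner.mem_nhds hx)
    have hcg' : ContinuousAt (fun s : ℝ => hessForm u (x + s • v) v v) 0 :=
      ContinuousAt.comp (f := fun s : ℝ => x + s • v) hcg hlinec.continuousAt
    have : hessForm u (x + (0 : ℝ) • v) v v < k ^ 2 := by rw [hx0, hGv]; nlinarith
    exact hcg'.tendsto.eventually_lt_const this
  obtain ⟨ε, hε, hball⟩ := Metric.eventually_nhds_iff.1 hspeed
  have hDs : ∀ s, 0 < s → s < ε → D (x + s • v) ≤ D x + s * k := fun s h0 h1 => by
    have hts : ∀ t ∈ Icc (0 : ℝ) 1, dist (t * s) 0 < ε := fun t ht => by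
      rw [Real.dist_0_eq_abs, abs_of_nonneg (mul_nonneg ht.1 h0.le)]
      nlinarith [ht.2]
    have hk0 : 0 ≤ k := by linarith
    refine hu.rDist_le_add hp hx (mul_nonneg h0.le hk0) (Conn.segment (fun t ht => ?_)
      fun t ht => ?_)
    · rw [smul_smul]; exact (hball (hts t ht)).1
    · rw [smul_smul, sqrt_metricForm_smul _ _ _ h0.le, hG.eq _ (hball (hts t ht)).1]
      gcongr
      rw [Real.sqrt_le_left hk0]
      exact (hball (hts t ht)).2.le
  have ev1 := eventually_lt_of_hasDerivAt hθd (show _ < -(lam * k) by linarith)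
  have ev2 := eventually_lt_of_hasDerivAt hder' (show w' < 0 by linarith)
  have ev3 : ∀ᶠ s : ℝ in 𝓝[>] 0, s < ε ∧ D x + s * k < r ∧ 0 < N (x + s • v) := by
    have g1 : ∀ᶠ s : ℝ in 𝓝 0, s < ε := eventually_lt_nhds hε
    have g2 : ∀ᶠ s : ℝ in 𝓝 0, D x + s * k < r := by
      have hc : Continuous fun s : ℝ => D x + s * k := by fun_prop
      have h0 : D x + 0 * k < r := by simpa using hDx
      exact (hc.tendsto 0).eventually_lt_const h0
    have g3 : ∀ᶠ s : ℝ in 𝓝 0, 0 < N (x + s • v) := by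
      have h1 : ContinuousAt N (x + (0 : ℝ) • v) := by
        rw [hx0]; exact hNc.continuousAt (P.isOpen_inner.mem_nhds hx)
      have h2 : ContinuousAt (fun s : ℝ => N (x + s • v)) 0 :=
        ContinuousAt.comp (f := fun s : ℝ => x + s • v) h1 hlinec.continuousAt
      have h3 : 0 < N (x + (0 : ℝ) • v) := by rw [hx0]; exact hNx
      exact h2.tendsto.eventually_const_lt h3
    exact (g1.and (g2.and g3)).filter_mono nhdsWithin_le_nhds
  obtain ⟨s, hs1, hs2, ⟨hs3, hs4, hs5⟩, hs0⟩ :=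
    (ev1.and (ev2.and (ev3.and self_mem_nhdsWithin))).exists
  have hs0' : 0 < s := hs0
  simp only [hx0] at hs1 hs2
  have hyD := hDs s hs0' hs3
  have hyin : x + s • v ∈ P.inner := (hball (by
    rw [Real.dist_0_eq_abs, abs_of_pos hs0']; exact hs3)).1
  have hyr : D (x + s • v) ≤ r := by linarith
  have hyA : x + s • v ∈ A := by
    refine ⟨hcoreD _ hyin hyr, hyr, ?_⟩
    have h1 : w (x + s • v) ≤ w₀ := by linarith
    simp only [hw] at h1
    rw [div_le_iff₀ hs5] at h1
    linarith
  have hfin := hmin hyA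
  simp only [mem_ofPred_eq] at hfin
  have : lam * D (x + s • v) ≤ lam * (D x + s * k) := by gcongr
  nlinarith

end Toric

/-! ### Growth of `f` with the distance. -/

namespace Toric

open Filter Topology

variable {n : ℕ} {P : DelzantPolytope n} {u : E n → ℝ} {f : E n → ℝ} {X : E n → E n}

/-- Growth of `f` along a curve that is shorter than the distance to the boundary. -/
theorem DelzantPolytope.Guillemin.mul_sinh_le_of_conn (hu : P.Guillemin u)
    (hf : SinhConcave (hessForm u) P.inner f X) {p q : E n} {α L : ℝ}
    (hpα : ENNReal.ofReal α ≤ gDistBoundary P u p) (hL : 0 ≤ L) (hLα : L < α)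
    (hconn : Conn u P.inner p q (ENNReal.ofReal L)) :
    f q * Real.sinh (α - L) ≤ f p * Real.sinh α ∧ f p * Real.sinh (α - L) ≤ f q * Real.sinh α := by
  have hG := hu.hessMetric
  have hU := hG.metricOn
  obtain ⟨γ, a, b, hab, hγ, rfl, rfl, hm, hlen⟩ := hconn
  rw [hU.gLength_eq_arc hab hγ hm, ENNReal.ofReal_le_ofReal_iff hL] at hlen
  have hmono := hU.monotoneOn_arc hab hγ hm
  set σ := arc u γ a with hσ
  have hσa : σ a = 0 := arc_self u γ a
  have hσ0 : ∀ t ∈ Icc a b, 0 ≤ σ t := fun t ht => by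
    rw [← hσa]; exact hmono (left_mem_Icc.2 hab.le) ht ht.1
  have hσα : ∀ t ∈ Icc a b, 0 < α - σ t := fun t ht => by
    have := hmono ht (right_mem_Icc.2 hab.le) ht.2
    linarith
  have hσc : ContinuousOn σ (Icc a b) := hU.continuousOn_arc hab hγ hm
  obtain ⟨hc, s, hs⟩ := id hγ
  have hfc : ContinuousOn (fun t => f (γ t)) (Icc a b) := hf.smooth.continuousOn.comp hc hm
  have hder : ∀ t ∈ Ioo a b, t ∉ s → HasDerivAt (fun t => f (γ t)) (fderiv ℝ f (γ t) (deriv γ t)) t ∧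
      HasDerivAt (fun t => Real.sinh (α - σ t)) (Real.cosh (α - σ t) * -speed u γ t) t ∧
      |fderiv ℝ f (γ t) (deriv γ t)| * Real.sinh (α - σ t) ≤
        f (γ t) * Real.cosh (α - σ t) * speed u γ t := by
    intro t ht hts
    have htI := Ioo_subset_Icc_self ht
    have hγt := hm htI
    have hcd := contDiffAt_of_piecewise hs ht hts
    refine ⟨?_, ((hU.hasDerivAt_arc hγ hm ht hcd).const_sub α).sinh, ?_⟩
    · exact HasFDerivAt.comp_hasDerivAt t ((hf.smooth.contDiffAt
        (P.isOpen_inner.mem_nhds hγt)).differentiableAt (by simp)).hasFDerivAt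
        (hcd.differentiableAt (by simp)).hasDerivAt
    -- The gradient bound is used at `γ t`, whose distance to the boundary is at least `α - σ t`.
    · have hgd : ENNReal.ofReal (α - σ t) ≤ gDistBoundary P u (γ t) := by
        have h1 := Conn.of_curve (u := u) ht.1 (hγ.mono le_rfl ht.2.le)
          (hm.mono_left (Icc_subset_Icc le_rfl ht.2.le))
        have h2 := hpα.trans (gDistBoundary_le_add h1)
        rw [hU.gLength_eq_arc ht.1 (hγ.mono le_rfl ht.2.le)
          (hm.mono_left (Icc_subset_Icc le_rfl ht.2.le))] at h2
        rw [ENNReal.ofReal_sub _ (hσ0 t htI)]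
        exact tsub_le_iff_left.2 h2
      have hgrad := hu.gradient_le hf hγt (hσα t htI) hgd
      have hcs := hG.sq_le hγt (X (γ t)) (deriv γ t)
      have habs : |fderiv ℝ f (γ t) (deriv γ t)| ≤
          √(hessForm u (γ t) (X (γ t)) (X (γ t))) * speed u γ t := by
        rw [← hf.grad _ hγt, speed, hG.eq _ hγt, ← Real.sqrt_mul (hG.nonneg hγt _)]
        exact Real.abs_le_sqrt hcs
      have hsp := speed_nonneg u γ t
      have hsh : 0 ≤ Real.sinh (α - σ t) := Real.sinh_nonneg_iff.2 (hσα t htI).le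
      calc _ ≤ (√(hessForm u (γ t) (X (γ t)) (X (γ t))) * speed u γ t) * Real.sinh (α - σ t) := by
            gcongr
        _ = (√(hessForm u (γ t) (X (γ t)) (X (γ t))) * Real.sinh (α - σ t)) * speed u γ t := by ring
        _ ≤ _ := by gcongr
  have hsc : ContinuousOn (fun t => Real.sinh (α - σ t)) (Icc a b) :=
    Real.continuous_sinh.comp_continuousOn (continuousOn_const.sub hσc)
  have hfa := hf.pos _ (hm (left_mem_Icc.2 hab.le))
  have hfb := hf.pos _ (hm (right_mem_Icc.2 hab.le))
  have hsinh : Real.sinh (α - L) ≤ Real.sinh (α - σ b) := Real.sinh_le_sinh.2 (by linarith)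
  have hsb : 0 < Real.sinh (α - σ b) := Real.sinh_pos_iff.2 (hσα b (right_mem_Icc.2 hab.le))
  -- In arc length |(log f)'| ≤ coth(α - σ) = -(log sinh(α - σ))', so f sinh(α - σ) does not
  -- increase and f / sinh(α - σ) does not decrease.
  constructor
  · have h1 := le_of_hasDerivAt_nonneg_off_finset (a := a) (b := b)
      (h := fun t => -(f (γ t) * Real.sinh (α - σ t))) s (hfc.mul hsc).neg
      (fun t ht hts => by
        obtain ⟨d1, d2, d3⟩ := hder t ht hts
        refine ⟨(d1.mul d2).neg, ?_⟩
        have := mul_le_mul_of_nonneg_right (le_abs_self (fderiv ℝ f (γ t) (deriv γ t)))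
          (Real.sinh_nonneg_iff.2 (hσα t (Ioo_subset_Icc_self ht)).le)
        linarith)
      (left_mem_Icc.2 hab.le) (right_mem_Icc.2 hab.le) hab.le
    simp only [hσa, sub_zero, neg_le_neg_iff] at h1
    exact (mul_le_mul_of_nonneg_left hsinh hfb.le).trans h1
  · have h1 := le_of_hasDerivAt_nonneg_off_finset (a := a) (b := b)
      (h := fun t => f (γ t) / Real.sinh (α - σ t)) s
      (hfc.div hsc fun t ht => (Real.sinh_pos_iff.2 (hσα t ht)).ne')
      (fun t ht hts => by
        obtain ⟨d1, d2, d3⟩ := hder t ht hts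
        have hpos := Real.sinh_pos_iff.2 (hσα t (Ioo_subset_Icc_self ht))
        refine ⟨d1.div d2 hpos.ne', div_nonneg ?_ (sq_nonneg _)⟩
        have := mul_le_mul_of_nonneg_right (neg_abs_le (fderiv ℝ f (γ t) (deriv γ t))) hpos.le
        linarith)
      (left_mem_Icc.2 hab.le) (right_mem_Icc.2 hab.le) hab.le
    simp only [hσa, sub_zero] at h1
    have hsα : 0 < Real.sinh α := Real.sinh_pos_iff.2 (by linarith)
    rw [div_le_div_iff₀ hsα hsb] at h1
    exact (mul_le_mul_of_nonneg_left hsinh hfa.le).trans h1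

/-- The distance need not be attained by a curve; the estimate holds for all larger lengths `L < α`,
and `L` tends to the distance. -/
theorem DelzantPolytope.Guillemin.mul_sinh_le_of_rDist_lt (hu : P.Guillemin u)
    (hf : SinhConcave (hessForm u) P.inner f X) {p q : E n} (hp : p ∈ P.inner) (hq : q ∈ P.inner)
    {α : ℝ} (hpα : ENNReal.ofReal α ≤ gDistBoundary P u p) (hd : rDist P u p q < α) :
    f q * Real.sinh (α - rDist P u p q) ≤ f p * Real.sinh α ∧
      f p * Real.sinh (α - rDist P u p q) ≤ f q * Real.sinh α := by
  have hd0 := rDist_nonneg (P := P) (u := u) p q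
  have hev : ∀ᶠ L in 𝓝[>] (rDist P u p q), f q * Real.sinh (α - L) ≤ f p * Real.sinh α ∧
      f p * Real.sinh (α - L) ≤ f q * Real.sinh α := by
    filter_upwards [Ioo_mem_nhdsGT hd] with L hL
    exact hu.mul_sinh_le_of_conn hf hpα (hd0.trans hL.1.le) hL.2 (hu.conn_of_rDist_lt hp hq hL.1)
  have hlim : ∀ c : ℝ, Tendsto (fun L => c * Real.sinh (α - L)) (𝓝[>] (rDist P u p q))
      (𝓝 (c * Real.sinh (α - rDist P u p q))) := fun c => by
    have : Continuous fun L => c * Real.sinh (α - L) :=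
      continuous_const.mul (Real.continuous_sinh.comp (by fun_prop))
    exact (this.tendsto _).mono_left nhdsWithin_le_nhds
  exact ⟨le_of_tendsto (hlim _) (hev.mono fun _ h => h.1),
    le_of_tendsto (hlim _) (hev.mono fun _ h => h.2)⟩

set_option maxHeartbeats 400000 in
/-- Growth of `f` at an arbitrary distance. -/
theorem DelzantPolytope.Guillemin.mul_sinh_le (hu : P.Guillemin u)
    (hf : SinhConcave (hessForm u) P.inner f X) {F : E n → ℝ} {Y : E n → E n}
    (hF : SinhConcave (hessForm u) P.inner F Y)
    (hcpt : ∀ η > 0, IsCompact {x | x ∈ P.inner ∧ η ≤ F x})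
    {p q : E n} (hp : p ∈ P.inner) (hq : q ∈ P.inner) {α : ℝ} (hα : 0 < α)
    (hpα : ENNReal.ofReal α ≤ gDistBoundary P u p) :
    f q * Real.sinh α ≤ f p * Real.sinh (α + rDist P u p q) := by
  have hG := hu.hessMetric
  have hU := hG.metricOn
  set d := rDist P u p q with hd
  have hd0 : 0 ≤ d := rDist_nonneg _ _
  have hfp := hf.pos p hp
  rcases hd0.eq_or_lt with h0 | hdpos
  · have := (hu.mul_sinh_le_of_rDist_lt hf hp hq hpα (by rw [← hd, ← h0]; exact hα)).1
    rw [← hd, ← h0, sub_zero] at this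
    rwa [← h0, add_zero]
  -- `f` itself is not assumed to have compact superlevel sets; the proper function `F` is there to
  -- supply this compact set.
  obtain ⟨K, hKU, hK, hKconn⟩ := hG.exists_compact_conn hF hcpt hp hq (d + 1)
  obtain ⟨C, M, t₀, hC, ht₀, hgreen⟩ := hG.exists_curve_variation_green hf hK hKU (d + 1)
  -- the estimate for an intermediate point at distance `δ`
  have hδ : ∀ δ, 0 < δ → δ < d → δ < α →
      f q * Real.sinh (α - δ) ≤ f p * Real.sinh (α + d - δ) := by
    intro δ hδ0 hδd hδα
    have hsδ : 0 < Real.sinh δ := Real.sinh_pos_iff.2 hδ0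
    have hsαδ : 0 < Real.sinh (α - δ) := Real.sinh_pos_iff.2 (by linarith)
    -- At arc length δ on a nearly shortest curve, `f` is bounded above by the gradient estimate
    -- from `p`, and below by the comparison with its values at `p` and `q`. Eliminating this value
    -- bounds `f q`.
    have hev : ∀ᶠ t : ℝ in 𝓝[>] 0, Real.sinh δ * f q ≤
        f p * Real.sinh α / Real.sinh (α - δ) * Real.sinh (d + t ^ 2) -
          Real.sinh (d - δ) * f p + t * (1 + C * (d + 1)) := by
      filter_upwards [Ioo_mem_nhdsGT (lt_min ht₀ one_pos)] with t ht
      have ht0 : 0 < t := ht.1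
      have htt : t ≤ t₀ := ht.2.le.trans (min_le_left _ _)
      have ht1 : t ≤ 1 := ht.2.le.trans (min_le_right _ _)
      have ht2 : 0 < t ^ 2 := by positivity
      have ht21 : t ^ 2 ≤ 1 := by nlinarith
      obtain ⟨γ, a, b, hab, hγ, hγa, hγb, hm, hlen⟩ := hKconn (d + t ^ 2 / 2) (by positivity)
        (by linarith) (hu.conn_of_rDist_lt hp hq (by linarith)) (t ^ 2 / 2) (by positivity)
      have hmU := hm.mono_right hKU
      rw [hU.gLength_eq_arc hab hγ hmU, ENNReal.ofReal_le_ofReal_iff (by positivity)] at hlen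
      set L := arc u γ a b with hL
      have hLd : L ≤ d + t ^ 2 := by linarith
      have hdL : d ≤ L := by
        have h1 := gDist_le_of_conn (Conn.of_curve (u := u) hab hγ hmU)
        rw [hU.gLength_eq_arc hab hγ hmU, hγa, hγb] at h1
        exact ENNReal.toReal_le_of_le_ofReal (hU.arc_nonneg hab hγ hmU) h1
      obtain ⟨c, hc, hcδ⟩ := intermediate_value_Icc hab.le (hU.continuousOn_arc hab hγ hmU)
        (show δ ∈ Icc (arc u γ a a) (arc u γ a b) from
          ⟨by rw [arc_self]; exact hδ0.le, hδd.le.trans hdL⟩)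
      have hac : a < c := by
        refine hc.1.lt_of_ne fun h => ?_
        rw [← h, arc_self] at hcδ
        exact hδ0.ne hcδ
      have hcb : c < b := by
        refine hc.2.lt_of_ne fun h => ?_
        rw [h, ← hL] at hcδ
        linarith
      obtain ⟨hV0, hV⟩ := hgreen γ a b c hac hcb hγ hm (by rw [← hL]; linarith) t ⟨ht0.le, htt⟩
      have hsum := hU.arc_add hac hcb hγ hmU
      rw [hcδ, ← hL] at hsum
      have hcb' : arc u γ c b = L - δ := by linarith
      rw [hcδ, hcb', ← hL, hγa, hγb] at hV hV0
      have hdV := ENNReal.toReal_le_of_le_ofReal hV0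
        (gDist_le_of_conn (hV.mono inter_subset_left le_rfl))
      change d ≤ _ at hdV
      have hxc := (hu.mul_sinh_le_of_conn hf (q := γ c) hpα hδ0.le hδα (by
        have h1 := Conn.of_curve (u := u) hac (hγ.mono le_rfl hcb.le)
          (hmU.mono_left (Icc_subset_Icc le_rfl hcb.le))
        rwa [hU.gLength_eq_arc hac (hγ.mono le_rfl hcb.le)
          (hmU.mono_left (Icc_subset_Icc le_rfl hcb.le)), hcδ, hγa] at h1)).1
      have hΔ : -(1 + C * (d + 1)) * t ≤
          f (γ c) * Real.sinh L - Real.sinh (L - δ) * f p - Real.sinh δ * f q := by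
        have h4 : t * (-(1 + C * (d + 1)) * t) ≤
            t * (f (γ c) * Real.sinh L - Real.sinh (L - δ) * f p - Real.sinh δ * f q) := by
          have h5 : C * t ^ 2 * L ≤ C * t ^ 2 * (d + 1) := by gcongr; linarith
          have h6 : t * (-(1 + C * (d + 1)) * t) = -t ^ 2 - C * t ^ 2 * (d + 1) := by ring
          rw [h6]
          linarith
        exact le_of_mul_le_mul_left h4 ht0
      have h7 : f (γ c) ≤ f p * Real.sinh α / Real.sinh (α - δ) := by rwa [le_div_iff₀ hsαδ]
      have h8 : Real.sinh L ≤ Real.sinh (d + t ^ 2) := Real.sinh_le_sinh.2 hLd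
      have h9 : Real.sinh (d - δ) ≤ Real.sinh (L - δ) := Real.sinh_le_sinh.2 (by linarith)
      have h10 : f (γ c) * Real.sinh L ≤
          f p * Real.sinh α / Real.sinh (α - δ) * Real.sinh (d + t ^ 2) :=
        mul_le_mul h7 h8 (Real.sinh_nonneg_iff.2 (by linarith))
          ((hf.pos _ (hmU hc)).le.trans h7)
      have h11 := mul_le_mul_of_nonneg_right h9 hfp.le
      linarith
    have hlim : Tendsto (fun t : ℝ => f p * Real.sinh α / Real.sinh (α - δ) * Real.sinh (d + t ^ 2) -
          Real.sinh (d - δ) * f p + t * (1 + C * (d + 1))) (𝓝[>] 0)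
        (𝓝 (f p * Real.sinh α / Real.sinh (α - δ) * Real.sinh d - Real.sinh (d - δ) * f p)) := by
      have hc : Continuous fun t : ℝ => f p * Real.sinh α / Real.sinh (α - δ) *
          Real.sinh (d + t ^ 2) - Real.sinh (d - δ) * f p + t * (1 + C * (d + 1)) := by
        have : Continuous fun t : ℝ => Real.sinh (d + t ^ 2) :=
          Real.continuous_sinh.comp (by fun_prop)
        fun_prop
      have := (hc.tendsto 0).mono_left (nhdsWithin_le_nhds (s := Ioi 0))
      simpa using this
    have hle := ge_of_tendsto hlim hev
    have hid : Real.sinh α * Real.sinh d - Real.sinh (d - δ) * Real.sinh (α - δ) =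
        Real.sinh δ * Real.sinh (α + d - δ) := by
      have h1 : Real.sinh (α + d - δ) = Real.sinh (α + (d - δ)) := by ring_nf
      rw [h1, Real.sinh_add, Real.sinh_sub, Real.cosh_sub, Real.sinh_sub]
      linear_combination (-(Real.sinh α * Real.sinh d)) * Real.cosh_sq δ
    have h12 : Real.sinh δ * f q * Real.sinh (α - δ) ≤
        f p * (Real.sinh δ * Real.sinh (α + d - δ)) := by
      rw [← hid]
      have := mul_le_mul_of_nonneg_right hle hsαδ.le
      refine this.trans_eq ?_
      field_simp
    have h13 : Real.sinh δ * (f q * Real.sinh (α - δ)) ≤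
        Real.sinh δ * (f p * Real.sinh (α + d - δ)) := by linarith
    exact le_of_mul_le_mul_left h13 hsδ
  -- Letting δ tend to 0 amounts to using the bound on the slope at `p` itself.
  have hev : ∀ᶠ δ : ℝ in 𝓝[>] 0, f q * Real.sinh (α - δ) ≤ f p * Real.sinh (α + d - δ) := by
    filter_upwards [Ioo_mem_nhdsGT (lt_min hdpos hα)] with δ h
    exact hδ δ h.1 (h.2.trans_le (min_le_left _ _)) (h.2.trans_le (min_le_right _ _))
  have hlim : ∀ c r : ℝ, Tendsto (fun δ : ℝ => c * Real.sinh (r - δ)) (𝓝[>] 0)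
      (𝓝 (c * Real.sinh r)) := fun c r => by
    have hc : Continuous fun δ : ℝ => c * Real.sinh (r - δ) :=
      continuous_const.mul (Real.continuous_sinh.comp (by fun_prop))
    have := (hc.tendsto 0).mono_left (nhdsWithin_le_nhds (s := Ioi 0))
    simpa using this
  exact le_of_tendsto_of_tendsto (hlim _ _) (hlim _ _) hev

end Toric

/-! ### Cauchy-Schwarz for tensors; the inverse Hessian. -/

namespace Toric

open Filter Topology Matrix
open scoped Kronecker

variable {n : ℕ}

theorem posSemidef_dotProduct_mulVec_sq_le {ι : Type*} [Fintype ι] {M : Matrix ι ι ℝ}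
    (hM : M.PosSemidef) (x y : ι → ℝ) :
    (x ⬝ᵥ M *ᵥ y) ^ 2 ≤ (x ⬝ᵥ M *ᵥ x) * (y ⬝ᵥ M *ᵥ y) := by
  have hsymm : y ⬝ᵥ M *ᵥ x = x ⬝ᵥ M *ᵥ y := by
    have ht : Mᵀ = M := by simpa using hM.isHermitian.eq
    rw [dotProduct_mulVec, ← mulVec_transpose, ht, dotProduct_comm]
  have key : ∀ s : ℝ, 0 ≤ (y ⬝ᵥ M *ᵥ y) * (s * s) + (2 * (x ⬝ᵥ M *ᵥ y)) * s + x ⬝ᵥ M *ᵥ x := by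
    intro s
    have h := hM.dotProduct_mulVec_nonneg (x + s • y)
    simp only [star_trivial, mulVec_add, mulVec_smul, dotProduct_add, add_dotProduct,
      dotProduct_smul, smul_dotProduct, smul_eq_mul, hsymm] at h
    linarith
  have := discrim_le_zero key
  rw [discrim] at this
  nlinarith

theorem sum_four_mul (p q r s : Fin n → ℝ) :
    ∑ a, ∑ b, ∑ c, ∑ d, p a * q b * r c * s d =
      (∑ a, p a) * (∑ b, q b) * (∑ c, r c) * (∑ d, s d) := by
  simp only [← Finset.mul_sum, ← Finset.sum_mul]

/-- The Cauchy-Schwarz inequality for tensors of type `(2, 2)`. -/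
theorem tensor_contraction_sq_le {g h : Matrix (Fin n) (Fin n) ℝ} (hg : g.PosSemidef)
    (hh : h.PosSemidef) (A : Fin n → Fin n → Fin n → Fin n → ℝ) (w w' z z' : Fin n → ℝ) :
    (∑ i, ∑ j, ∑ k, ∑ l, A i j k l * ((g *ᵥ w) i * (g *ᵥ w') j * (h *ᵥ z) k * (h *ᵥ z') l)) ^ 2 ≤
      (∑ i, ∑ j, ∑ k, ∑ l, ∑ a, ∑ b, ∑ c, ∑ d,
        A i j k l * A a b c d * g i a * g j b * h k c * h l d) *
      ((w ⬝ᵥ g *ᵥ w) * (w' ⬝ᵥ g *ᵥ w') * (z ⬝ᵥ h *ᵥ z) * (z' ⬝ᵥ h *ᵥ z')) := by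
  -- The norm of the tensor is the quadratic form of g ⊗ g ⊗ h ⊗ h on its entries, so the claim is
  -- Cauchy-Schwarz for this form against the decomposable tensor w ⊗ w' ⊗ z ⊗ z'.
  have hM := (hg.kronecker hg).kronecker (hh.kronecker hh)
  set x : (Fin n × Fin n) × (Fin n × Fin n) → ℝ := fun I => A I.1.1 I.1.2 I.2.1 I.2.2 with hx
  set y : (Fin n × Fin n) × (Fin n × Fin n) → ℝ :=
    fun I => w I.1.1 * w' I.1.2 * z I.2.1 * z' I.2.2 with hy
  have hMy : ((g ⊗ₖ g) ⊗ₖ (h ⊗ₖ h)) *ᵥ y = fun I =>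
      (g *ᵥ w) I.1.1 * (g *ᵥ w') I.1.2 * (h *ᵥ z) I.2.1 * (h *ᵥ z') I.2.2 := by
    funext I
    simp only [mulVec, dotProduct, kroneckerMap_apply, Fintype.sum_prod_type, hy]
    rw [← sum_four_mul]
    refine Finset.sum_congr rfl fun a _ => Finset.sum_congr rfl fun b _ =>
      Finset.sum_congr rfl fun c _ => Finset.sum_congr rfl fun d _ => by ring
  have h1 := posSemidef_dotProduct_mulVec_sq_le hM x y
  have e1 : x ⬝ᵥ ((g ⊗ₖ g) ⊗ₖ (h ⊗ₖ h)) *ᵥ y = ∑ i, ∑ j, ∑ k, ∑ l,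
      A i j k l * ((g *ᵥ w) i * (g *ᵥ w') j * (h *ᵥ z) k * (h *ᵥ z') l) := by
    rw [hMy]
    simp only [dotProduct, Fintype.sum_prod_type, hx]
  have e2 : y ⬝ᵥ ((g ⊗ₖ g) ⊗ₖ (h ⊗ₖ h)) *ᵥ y =
      (w ⬝ᵥ g *ᵥ w) * (w' ⬝ᵥ g *ᵥ w') * (z ⬝ᵥ h *ᵥ z) * (z' ⬝ᵥ h *ᵥ z') := by
    rw [hMy]
    simp only [dotProduct, Fintype.sum_prod_type, hy]
    rw [← sum_four_mul]
    refine Finset.sum_congr rfl fun a _ => Finset.sum_congr rfl fun b _ =>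
      Finset.sum_congr rfl fun c _ => Finset.sum_congr rfl fun d _ => by ring
  have e3 : x ⬝ᵥ ((g ⊗ₖ g) ⊗ₖ (h ⊗ₖ h)) *ᵥ x = ∑ i, ∑ j, ∑ k, ∑ l, ∑ a, ∑ b, ∑ c, ∑ d,
        A i j k l * A a b c d * g i a * g j b * h k c * h l d := by
    simp only [dotProduct, mulVec, Fintype.sum_prod_type, hx, kroneckerMap_apply, Finset.mul_sum]
    refine Finset.sum_congr rfl fun i _ => Finset.sum_congr rfl fun j _ =>
      Finset.sum_congr rfl fun k _ => Finset.sum_congr rfl fun l _ =>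
      Finset.sum_congr rfl fun a _ => Finset.sum_congr rfl fun b _ =>
      Finset.sum_congr rfl fun c _ => Finset.sum_congr rfl fun d _ => by ring
  rwa [e1, e2, e3] at h1

variable {P : DelzantPolytope n} {u : E n → ℝ}

theorem hessForm_eq_sum {u : E n → ℝ} {x : E n} (hu : DifferentiableAt ℝ (fderiv ℝ u) x)
    (v w : E n) : hessForm u x v w = ∑ i, ∑ j, hess u x i j * v i * w j := by
  conv_lhs => rw [euclidean_eq_sum_single v, euclidean_eq_sum_single w]
  simp only [map_sum, map_smul, _root_.sum_apply, _root_.smul_apply, smul_eq_mul, Finset.mul_sum]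
  rw [Finset.sum_comm]
  refine Finset.sum_congr rfl fun i _ => Finset.sum_congr rfl fun j _ => ?_
  rw [hess_apply_eq hu]
  ring

theorem hessForm_eq_dotProduct {u : E n → ℝ} {x : E n} (hu : DifferentiableAt ℝ (fderiv ℝ u) x)
    (v w : E n) : hessForm u x v w = v.ofLp ⬝ᵥ hess u x *ᵥ w.ofLp := by
  rw [hessForm_eq_sum hu]
  simp only [dotProduct, mulVec, Finset.mul_sum]
  refine Finset.sum_congr rfl fun i _ => Finset.sum_congr rfl fun j _ => by ring

theorem DelzantPolytope.Guillemin.posDef_hess (hu : P.Guillemin u) {x : E n} (hx : x ∈ P.inner) :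
    (hess u x).PosDef := by
  have hd := hu.differentiableAt_fderiv hx
  refine Matrix.PosDef.of_dotProduct_mulVec_pos ?_ fun v hv => ?_
  · ext i j
    rw [conjTranspose_apply, star_trivial, hess_apply_eq hd, hess_apply_eq hd,
      hu.hessMetric.symm x hx]
  · have := hu.hessMetric.pos x hx (WithLp.toLp 2 v) (by simpa using hv)
    rw [hessForm_eq_dotProduct hd] at this
    simpa using this

theorem DelzantPolytope.Guillemin.posDef_invHess (hu : P.Guillemin u) {x : E n}
    (hx : x ∈ P.inner) : (invHess u x).PosDef := (hu.posDef_hess hx).inv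

theorem DelzantPolytope.Guillemin.hess_mul_invHess (hu : P.Guillemin u) {x : E n}
    (hx : x ∈ P.inner) : hess u x * invHess u x = 1 :=
  Matrix.mul_nonsing_inv _ (hu.posDef_hess hx).det_pos.ne'.isUnit

theorem contDiffAt_det {M : E n → Matrix (Fin n) (Fin n) ℝ} {x : E n}
    (h : ∀ i j, ContDiffAt ℝ ∞ (fun y => M y i j) x) : ContDiffAt ℝ ∞ (fun y => (M y).det) x := by
  simp only [Matrix.det_apply]
  exact ContDiffAt.sum fun σ _ => ContDiffAt.const_smul _ (contDiffAt_prod fun i _ => h _ _)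

theorem DelzantPolytope.Guillemin.contDiffAt_hess (hu : P.Guillemin u) {x : E n}
    (hx : x ∈ P.inner) (i j : Fin n) : ContDiffAt ℝ ∞ (fun y => hess u y i j) x := by
  have h1 : ContDiffAt ℝ ∞ (fun y => hessForm u y (EuclideanSpace.single i 1)
      (EuclideanSpace.single j 1)) x :=
    ((hu.hessMetric.smooth.contDiffAt (P.isOpen_inner.mem_nhds hx)).clm_apply
      contDiffAt_const).clm_apply contDiffAt_const
  refine h1.congr_of_eventuallyEq ?_
  filter_upwards [P.isOpen_inner.mem_nhds hx] with y hy
  exact hess_apply_eq (hu.differentiableAt_fderiv hy) i j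

/-- By Cramer's rule the entries are quotients of polynomials in the entries of the Hessian. -/
theorem DelzantPolytope.Guillemin.contDiffAt_invHess (hu : P.Guillemin u) {x : E n}
    (hx : x ∈ P.inner) (i j : Fin n) : ContDiffAt ℝ ∞ (fun y => invHess u y i j) x := by
  have hH := hu.contDiffAt_hess hx
  have h1 : ContDiffAt ℝ ∞ (fun y => ((hess u y).det)⁻¹ * (hess u y).adjugate i j) x := by
    refine ((contDiffAt_det hH).inv (hu.posDef_hess hx).det_pos.ne').mul ?_
    simp only [Matrix.adjugate_apply]
    refine contDiffAt_det fun k l => ?_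
    by_cases hk : k = j
    · subst hk
      simp only [Matrix.updateRow_self]
      exact contDiffAt_const
    · simp only [Matrix.updateRow_ne hk]
      exact hH k l
  refine h1.congr_of_eventuallyEq (Eventually.of_forall fun y => ?_)
  simp only [invHess, Matrix.inv_def, Matrix.smul_apply, smul_eq_mul, Ring.inverse_eq_inv]

/-- The vector dual to a covector in the metric `u_{ij}`. -/
noncomputable def sharp (u : E n → ℝ) (x : E n) (ξ : E n →L[ℝ] ℝ) : E n :=
  ∑ a, (∑ b, invHess u x a b * ξ (EuclideanSpace.single b 1)) • EuclideanSpace.single a 1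

theorem sharp_apply (u : E n → ℝ) (x : E n) (ξ : E n →L[ℝ] ℝ) (a : Fin n) :
    sharp u x ξ a = ∑ b, invHess u x a b * ξ (EuclideanSpace.single b 1) := by
  simp [sharp, Finset.sum_apply, Pi.single_apply]

theorem DelzantPolytope.Guillemin.hessForm_sharp (hu : P.Guillemin u) {x : E n}
    (hx : x ∈ P.inner) (ξ : E n →L[ℝ] ℝ) : hessForm u x (sharp u x ξ) = ξ := by
  have hG := hu.hessMetric
  ext w
  rw [hG.symm x hx, hessForm_eq_dotProduct (hu.differentiableAt_fderiv hx)]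
  have h1 : (sharp u x ξ).ofLp = invHess u x *ᵥ fun b => ξ (EuclideanSpace.single b 1) :=
    funext fun a => sharp_apply u x ξ a
  rw [h1, mulVec_mulVec, hu.hess_mul_invHess hx, one_mulVec]
  conv_rhs => rw [euclidean_eq_sum_single w]
  simp [dotProduct]

theorem DelzantPolytope.Guillemin.eq_sharp (hu : P.Guillemin u) {x : E n}
    (hx : x ∈ P.inner) {v : E n} {ξ : E n →L[ℝ] ℝ} (h : hessForm u x v = ξ) : v = sharp u x ξ := by
  by_contra hne
  have h1 := hu.hessMetric.pos x hx (v - sharp u x ξ) (sub_ne_zero.2 hne)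
  rw [(hessForm u x).map_sub, hu.hessForm_sharp hx, h, sub_self] at h1
  simp at h1

theorem DelzantPolytope.Guillemin.contDiffAt_sharp (hu : P.Guillemin u) {x : E n}
    (hx : x ∈ P.inner) {ξ : E n → E n →L[ℝ] ℝ} (hξ : ContDiffAt ℝ ∞ ξ x) :
    ContDiffAt ℝ ∞ (fun y => sharp u y (ξ y)) x := by
  simp only [sharp]
  refine ContDiffAt.sum fun a _ => ?_
  have h1 : ContDiffAt ℝ ∞
      (fun y => ∑ b, invHess u y a b * ξ y (EuclideanSpace.single b 1)) x :=
    ContDiffAt.sum fun b _ => (hu.contDiffAt_invHess hx a b).mul (hξ.clm_apply contDiffAt_const)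
  exact h1.smul contDiffAt_const

end Toric

/-! ### Derivatives of the inverse metric and the curvature inequality. -/

namespace Toric

open Filter Topology Matrix

variable {n : ℕ} {P : DelzantPolytope n} {u : E n → ℝ}

theorem hasDerivAt_line (x v : E n) : HasDerivAt (fun t : ℝ => x + t • v) v 0 := by
  simpa using ((hasDerivAt_id (0 : ℝ)).smul_const v).const_add x

theorem DifferentiableAt.hasDerivAt_line {F : Type*} [NormedAddCommGroup F] [NormedSpace ℝ F]
    {g : E n → F} {x : E n} (hg : DifferentiableAt ℝ g x) (v : E n) :
    HasDerivAt (fun t : ℝ => g (x + t • v)) (fderiv ℝ g x v) 0 := by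
  refine HasFDerivAt.comp_hasDerivAt (E := F) (0 : ℝ) ?_ (Toric.hasDerivAt_line x v)
  simpa using hg.hasFDerivAt

theorem eventually_line {U : Set (E n)} (hU : IsOpen U) {x : E n} (hx : x ∈ U) (v : E n) :
    ∀ᶠ t : ℝ in 𝓝 0, x + t • v ∈ U :=
  (Toric.hasDerivAt_line x v).continuousAt.preimage_mem_nhds
    (by simpa using hU.mem_nhds hx)

set_option synthInstance.maxHeartbeats 200000
set_option maxSynthPendingDepth 5

namespace DelzantPolytope.Guillemin

theorem contDiffAt_hessForm (hu : P.Guillemin u) {x : E n} (hx : x ∈ P.inner) :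
    ContDiffAt ℝ ∞ (hessForm u) x :=
  hu.hessMetric.smooth.contDiffAt (P.isOpen_inner.mem_nhds hx)

theorem differentiableAt_hessForm (hu : P.Guillemin u) {x : E n} (hx : x ∈ P.inner) :
    DifferentiableAt ℝ (hessForm u) x := (hu.contDiffAt_hessForm hx).differentiableAt (by simp)

theorem differentiableAt_fderiv_hessForm (hu : P.Guillemin u) {x : E n} (hx : x ∈ P.inner) :
    DifferentiableAt ℝ (fderiv ℝ (hessForm u)) x :=
  ((hu.contDiffAt_hessForm hx).fderiv_right (m := ∞) (by simp)).differentiableAt (by simp)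

/-- The third derivative is symmetric in the last two arguments. -/
theorem third_symm_right (hu : P.Guillemin u) {x : E n} (hx : x ∈ P.inner) (v a b : E n) :
    fderiv ℝ (hessForm u) x v a b = fderiv ℝ (hessForm u) x v b a := by
  have h := DifferentiableAt.hasDerivAt_line (F := E n →L[ℝ] E n →L[ℝ] ℝ)
    (hu.differentiableAt_hessForm hx) v
  have h1 := (h.clm_apply (hasDerivAt_const (0 : ℝ) a)).clm_apply (hasDerivAt_const (0 : ℝ) b)
  have h2 := (h.clm_apply (hasDerivAt_const (0 : ℝ) b)).clm_apply (hasDerivAt_const (0 : ℝ) a)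
  have he : (fun t : ℝ => hessForm u (x + t • v) a b) =ᶠ[𝓝 0]
      fun t : ℝ => hessForm u (x + t • v) b a := by
    filter_upwards [eventually_line P.isOpen_inner hx v] with t ht using hu.hessMetric.symm _ ht a b
  simpa using h1.unique (h2.congr_of_eventuallyEq he)

/-- The third derivative is symmetric in the first two arguments. -/
theorem third_symm_left (hu : P.Guillemin u) {x : E n} (hx : x ∈ P.inner) (v a : E n) :
    fderiv ℝ (hessForm u) x v a = fderiv ℝ (hessForm u) x a v := by
  have h : ContDiffAt ℝ ∞ (fderiv ℝ u) x :=
    hu.contDiffOn_fderiv.contDiffAt (P.isOpen_inner.mem_nhds hx)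
  exact (h.isSymmSndFDerivAt (by simpa using natCast_le_infty 2)) v a

/-- The fourth derivative is symmetric in the middle arguments. -/
theorem fourth_symm (hu : P.Guillemin u) {x : E n} (hx : x ∈ P.inner) (v a b : E n) :
    fderiv ℝ (fderiv ℝ (hessForm u)) x v a b = fderiv ℝ (fderiv ℝ (hessForm u)) x v b a := by
  have h := DifferentiableAt.hasDerivAt_line
    (F := E n →L[ℝ] E n →L[ℝ] E n →L[ℝ] ℝ) (hu.differentiableAt_fderiv_hessForm hx) v
  have h1 := (h.clm_apply (hasDerivAt_const (0 : ℝ) a)).clm_apply (hasDerivAt_const (0 : ℝ) b)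
  have h2 := (h.clm_apply (hasDerivAt_const (0 : ℝ) b)).clm_apply (hasDerivAt_const (0 : ℝ) a)
  have he : (fun t : ℝ => fderiv ℝ (hessForm u) (x + t • v) a b) =ᶠ[𝓝 0]
      fun t : ℝ => fderiv ℝ (hessForm u) (x + t • v) b a := by
    filter_upwards [eventually_line P.isOpen_inner hx v] with t ht using hu.third_symm_left ht a b
  simpa using h1.unique (h2.congr_of_eventuallyEq he)

theorem pairing_sharp_symm (hu : P.Guillemin u) {x : E n} (hx : x ∈ P.inner)
    (ξ η : E n →L[ℝ] ℝ) : ξ (sharp u x η) = η (sharp u x ξ) := by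
  conv_lhs => rw [← hu.hessForm_sharp hx ξ]
  conv_rhs => rw [← hu.hessForm_sharp hx η]
  exact hu.hessMetric.symm x hx _ _

theorem differentiableAt_sharp (hu : P.Guillemin u) {x : E n} (hx : x ∈ P.inner)
    (η : E n →L[ℝ] ℝ) : DifferentiableAt ℝ (fun y => sharp u y η) x :=
  (hu.contDiffAt_sharp hx contDiffAt_const).differentiableAt (by simp)

/-- The derivative of the inverse of the metric. -/
theorem fderiv_sharp (hu : P.Guillemin u) {x : E n} (hx : x ∈ P.inner) (η : E n →L[ℝ] ℝ)
    (v : E n) : fderiv ℝ (fun y => sharp u y η) x v =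
      -sharp u x (fderiv ℝ (hessForm u) x v (sharp u x η)) := by
  have h := DifferentiableAt.hasDerivAt_line (F := E n →L[ℝ] E n →L[ℝ] ℝ)
    (hu.differentiableAt_hessForm hx) v
  have h1 := DifferentiableAt.hasDerivAt_line (hu.differentiableAt_sharp hx η) v
  have h2 := h.clm_apply h1
  -- The derivative is found by differentiating the identity G(η^♯) = η.
  have he : (fun t : ℝ => hessForm u (x + t • v) (sharp u (x + t • v) η)) =ᶠ[𝓝 0] fun _ => η := by
    filter_upwards [eventually_line P.isOpen_inner hx v] with t ht using hu.hessForm_sharp ht η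
  have h3 := h2.unique ((hasDerivAt_const (0 : ℝ) η).congr_of_eventuallyEq he)
  simp only [zero_smul, add_zero] at h3
  rw [← neg_eq_iff_eq_neg]
  refine hu.eq_sharp hx ?_
  rw [(hessForm u x).map_neg]
  exact neg_eq_of_add_eq_zero_left h3

theorem fderiv_pairing (hu : P.Guillemin u) {x : E n} (hx : x ∈ P.inner) (ξ η : E n →L[ℝ] ℝ)
    (v : E n) : fderiv ℝ (fun y => ξ (sharp u y η)) x v =
      -fderiv ℝ (hessForm u) x v (sharp u x η) (sharp u x ξ) := by
  have h1 := DifferentiableAt.hasDerivAt_line (hu.differentiableAt_sharp hx η) v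
  have h2 := (hasDerivAt_const (0 : ℝ) ξ).clm_apply h1
  have hd : DifferentiableAt ℝ (fun y => ξ (sharp u y η)) x :=
    ξ.differentiableAt.comp x (hu.differentiableAt_sharp hx η)
  have h3 := (DifferentiableAt.hasDerivAt_line hd v).unique h2
  rw [h3, hu.fderiv_sharp hx]
  simp [hu.pairing_sharp_symm hx ξ]

theorem contDiffAt_pairing (hu : P.Guillemin u) {x : E n} (hx : x ∈ P.inner)
    (ξ η : E n →L[ℝ] ℝ) : ContDiffAt ℝ ∞ (fun y => ξ (sharp u y η)) x :=
  contDiffAt_const.clm_apply (hu.contDiffAt_sharp hx contDiffAt_const)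

/-- The second derivative of the inverse of the metric. -/
theorem hessForm_pairing (hu : P.Guillemin u) {x : E n} (hx : x ∈ P.inner) (ξ η : E n →L[ℝ] ℝ)
    (v w : E n) : hessForm (fun y => ξ (sharp u y η)) x v w =
      -(fderiv ℝ (fderiv ℝ (hessForm u)) x v w (sharp u x η) (sharp u x ξ) -
        fderiv ℝ (hessForm u) x w (sharp u x ξ)
          (sharp u x (fderiv ℝ (hessForm u) x v (sharp u x η))) -
        fderiv ℝ (hessForm u) x w (sharp u x η)
          (sharp u x (fderiv ℝ (hessForm u) x v (sharp u x ξ)))) := by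
  have hd : DifferentiableAt ℝ (fderiv ℝ fun y => ξ (sharp u y η)) x :=
    ((hu.contDiffAt_pairing hx ξ η).fderiv_right (m := ∞) (by simp)).differentiableAt (by simp)
  have h1 := (DifferentiableAt.hasDerivAt_line hd v).clm_apply (hasDerivAt_const (0 : ℝ) w)
  have h2 := (((DifferentiableAt.hasDerivAt_line
    (F := E n →L[ℝ] E n →L[ℝ] E n →L[ℝ] ℝ) (hu.differentiableAt_fderiv_hessForm hx) v).clm_apply
    (hasDerivAt_const (0 : ℝ) w)).clm_apply
    (DifferentiableAt.hasDerivAt_line (hu.differentiableAt_sharp hx η) v)).clm_apply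
    (DifferentiableAt.hasDerivAt_line (hu.differentiableAt_sharp hx ξ) v)
  have he : (fun t : ℝ => fderiv ℝ (fun y => ξ (sharp u y η)) (x + t • v) w) =ᶠ[𝓝 0]
      fun t : ℝ => -fderiv ℝ (hessForm u) (x + t • v) w (sharp u (x + t • v) η)
        (sharp u (x + t • v) ξ) := by
    filter_upwards [eventually_line P.isOpen_inner hx v] with t ht using
      hu.fderiv_pairing ht ξ η w
  have h3 := h1.unique (h2.neg.congr_of_eventuallyEq he)
  simp only [zero_smul, add_zero, map_zero, _root_.add_apply] at h3
  rw [hessForm, h3, hu.fderiv_sharp hx, hu.fderiv_sharp hx,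
    hu.third_symm_right hx w (sharp u x ξ)]
  simp only [map_neg, _root_.neg_apply]
  ring

/-- The contraction of the tensor `F` with two covectors and two vectors. -/
theorem sum_tensorF (hu : P.Guillemin u) {x : E n} (hx : x ∈ P.inner) (ξ η : E n →L[ℝ] ℝ)
    (v w : E n) : ∑ i, ∑ j, ∑ k, ∑ l, tensorF u x i j k l *
      (ξ (EuclideanSpace.single i 1) * η (EuclideanSpace.single j 1) * v k * w l) =
      -hessForm (fun y => ξ (sharp u y η)) x v w := by
  have hN : ∀ i j, DifferentiableAt ℝ (fderiv ℝ fun y => invHess u y i j) x := fun i j =>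
    ((hu.contDiffAt_invHess hx i j).fderiv_right (m := ∞) (by simp)).differentiableAt (by simp)
  have h1 : (fun y => ξ (sharp u y η)) = fun y => ∑ i, ∑ j,
      (ξ (EuclideanSpace.single i 1) * η (EuclideanSpace.single j 1)) * invHess u y i j := by
    funext y
    simp only [sharp, map_sum, map_smul, smul_eq_mul, Finset.sum_mul]
    refine Finset.sum_congr rfl fun i _ => Finset.sum_congr rfl fun j _ => by ring
  have h2 : hessForm (fun y => ξ (sharp u y η)) x = ∑ i, ∑ j,
      (ξ (EuclideanSpace.single i 1) * η (EuclideanSpace.single j 1)) •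
        hessForm (fun y => invHess u y i j) x := by
    have he : fderiv ℝ (fun y => ξ (sharp u y η)) =ᶠ[𝓝 x] fun y => ∑ i, ∑ j,
        (ξ (EuclideanSpace.single i 1) * η (EuclideanSpace.single j 1)) •
          fderiv ℝ (fun y => invHess u y i j) y := by
      filter_upwards [P.isOpen_inner.mem_nhds hx] with y hy
      rw [h1]
      refine HasFDerivAt.fderiv (HasFDerivAt.fun_sum fun i _ => HasFDerivAt.fun_sum fun j _ => ?_)
      exact (((hu.contDiffAt_invHess hy i j).differentiableAt (by simp)).hasFDerivAt).const_mul _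
    rw [hessForm, he.fderiv_eq]
    refine HasFDerivAt.fderiv (HasFDerivAt.fun_sum fun i _ => HasFDerivAt.fun_sum fun j _ => ?_)
    exact HasFDerivAt.const_smul (R := ℝ) (F := E n →L[ℝ] ℝ) (hN i j).hasFDerivAt _
  rw [h2]
  simp only [_root_.sum_apply, _root_.smul_apply, smul_eq_mul, hessForm_eq_sum (hN _ _),
    ← Finset.sum_neg_distrib, Finset.mul_sum]
  refine Finset.sum_congr rfl fun i _ => Finset.sum_congr rfl fun j _ =>
    Finset.sum_congr rfl fun k _ => Finset.sum_congr rfl fun l _ => ?_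
  simp only [tensorF, hess, Matrix.of_apply]
  ring

/-- The bound on `|F|` as a bound on its contractions. -/
theorem sq_contraction_le (hu : P.Guillemin u) {x : E n} (hx : x ∈ P.inner) (hF : normF u x ≤ 1)
    (a b v w : E n) : (hessForm (fun y => hessForm u x a (sharp u y (hessForm u x b))) x v w) ^ 2 ≤
      hessForm u x a a * hessForm u x b b * hessForm u x v v * hessForm u x w w := by
  have hd := hu.differentiableAt_fderiv hx
  -- The last two arguments are the covectors of `v` and `w`: the inverse Hessian turns them back
  -- into `v` and `w`, while the Hessian turns `a` and `b` into covectors, as the types of the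
  -- indices of F require.
  have hcs := tensor_contraction_sq_le (hu.posDef_hess hx).posSemidef
    (hu.posDef_invHess hx).posSemidef (tensorF u x) a.ofLp b.ofLp (hess u x *ᵥ v.ofLp)
    (hess u x *ᵥ w.ofLp)
  have hinv : invHess u x * hess u x = 1 :=
    Matrix.nonsing_inv_mul _ (hu.posDef_hess hx).det_pos.ne'.isUnit
  have hcov : ∀ (a : E n) (i : Fin n), (hess u x *ᵥ a.ofLp) i =
      hessForm u x a (EuclideanSpace.single i 1) := fun a i => by
    rw [hu.hessMetric.symm x hx, hessForm_eq_dotProduct hd]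
    simp
  have hdual : ∀ v : E n, (hess u x *ᵥ v.ofLp) ⬝ᵥ v.ofLp = hessForm u x v v := fun v => by
    rw [dotProduct_comm, hessForm_eq_dotProduct hd]
  simp only [mulVec_mulVec, hinv, one_mulVec, hdual, ← hessForm_eq_dotProduct hd] at hcs
  simp only [hcov] at hcs
  rw [hu.sum_tensorF hx (hessForm u x a) (hessForm u x b) v w, neg_sq] at hcs
  have hS := (Real.sqrt_le_left zero_le_one).1 hF
  rw [one_pow] at hS
  have hp : 0 ≤ hessForm u x a a * hessForm u x b b * hessForm u x v v * hessForm u x w w :=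
    mul_nonneg (mul_nonneg (mul_nonneg (hu.hessMetric.nonneg hx _) (hu.hessMetric.nonneg hx _))
      (hu.hessMetric.nonneg hx _)) (hu.hessMetric.nonneg hx _)
  exact hcs.trans (mul_le_of_le_one_left hp hS)

/-- The curvature inequality that follows from `|F| ≤ 1`. -/
theorem curvature_le (hu : P.Guillemin u) {x : E n} (hx : x ∈ P.inner) (hF : normF u x ≤ 1)
    (w v : E n) : -fderiv ℝ (fderiv ℝ (hessForm u)) x v v w w +
      1 / 2 * fderiv ℝ (hessForm u) x w w (sharp u x (fderiv ℝ (hessForm u) x v v)) ≤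
      hessForm u x w w * hessForm u x v v -
        3 / 2 * fderiv ℝ (hessForm u) x v w (sharp u x (fderiv ℝ (hessForm u) x v w)) := by
  have hs : ∀ a, sharp u x (hessForm u x a) = a := fun a => (hu.eq_sharp hx rfl).symm
  -- Write T and Q for the third and fourth derivatives of `u`, with products in the inverse metric.
  -- `h1` bounds Q(v,v,w,w) - 2|T(v,w)|²; `h2`, by symmetry of Q, bounds Q(v,v,w,w) - T(v,v)·T(w,w)
  -- - |T(v,w)|². The claim is the average of the two lower bounds.
  have h1 := hu.sq_contraction_le hx hF w w v v
  have h2 := hu.sq_contraction_le hx hF w v v w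
  rw [hu.hessForm_pairing hx] at h1 h2
  simp only [hs] at h1 h2
  rw [hu.fourth_symm hx v w v, hu.third_symm_left hx w v] at h2
  have hw := hu.hessMetric.nonneg hx w
  have hv := hu.hessMetric.nonneg hx v
  have e1 : hessForm u x w w * hessForm u x w w * hessForm u x v v * hessForm u x v v =
    (hessForm u x w w * hessForm u x v v) ^ 2 := by ring
  have e2 : hessForm u x w w * hessForm u x v v * hessForm u x v v * hessForm u x w w =
    (hessForm u x w w * hessForm u x v v) ^ 2 := by ring
  rw [e1] at h1
  rw [e2] at h2
  have k1 := (abs_le.1 (abs_le_of_sq_le_sq h1 (mul_nonneg hw hv))).2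
  have k2 := (abs_le.1 (abs_le_of_sq_le_sq h2 (mul_nonneg hw hv))).2
  linarith

end DelzantPolytope.Guillemin

end Toric

/-! ### The inverse square root of a trace of the metric. -/

namespace Toric

open Filter Topology

variable {n : ℕ} {P : DelzantPolytope n} {u : E n → ℝ} {ι : Type*} [Fintype ι]

set_option maxSynthPendingDepth 5

theorem hasFDerivAt_inv_sqrt {V : Type*} [NormedAddCommGroup V] [NormedSpace ℝ V] {S : V → ℝ}
    {S' : V →L[ℝ] ℝ} {x : V} (h : HasFDerivAt S S' x) (hS : 0 < S x) :
    HasFDerivAt (fun y => (√(S y))⁻¹) ((-(1 / 2) * (√(S x))⁻¹ ^ 3) • S') x := by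
  have h0 : √(S x) ≠ 0 := (Real.sqrt_pos.2 hS).ne'
  have h1 := (Real.hasDerivAt_sqrt hS.ne').inv h0
  have h2 := h1.comp_hasFDerivAt x h
  have e : -(1 / 2) * (√(S x))⁻¹ ^ 3 = -(1 / (2 * √(S x))) / √(S x) ^ 2 := by
    field_simp
  rw [e]
  exact h2

/-- The trace of the metric over a family of vectors. -/
noncomputable def traceForm (u : E n → ℝ) (W : ι → E n) (x : E n) : ℝ :=
  ∑ i, hessForm u x (W i) (W i)

namespace DelzantPolytope.Guillemin

theorem hasFDerivAt_traceForm (hu : P.Guillemin u) (W : ι → E n) {x : E n} (hx : x ∈ P.inner) :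
    HasFDerivAt (traceForm u W)
      (∑ i, fderiv ℝ (hessForm u) x (W i) (W i)) x := by
  refine HasFDerivAt.fun_sum fun i _ => ?_
  have h1 := ((hu.differentiableAt_hessForm hx).hasFDerivAt.clm_apply
    (hasFDerivAt_const (W i) x)).clm_apply (hasFDerivAt_const (W i) x)
  convert h1 using 1
  ext v
  simp [hu.third_symm_left hx v (W i), hu.third_symm_right hx (W i) v]

theorem contDiffOn_traceForm (hu : P.Guillemin u) (W : ι → E n) :
    ContDiffOn ℝ ∞ (traceForm u W) P.inner :=
  ContDiffOn.sum fun _ _ => (hu.hessMetric.smooth.clm_apply contDiffOn_const).clm_apply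
    contDiffOn_const

theorem hasFDerivAt_inv_sqrt_traceForm (hu : P.Guillemin u) {W : ι → E n} {x : E n}
    (hx : x ∈ P.inner) (hS : 0 < traceForm u W x) :
    HasFDerivAt (fun y => (√(traceForm u W y))⁻¹) ((-(1 / 2) * (√(traceForm u W x))⁻¹ ^ 3) •
      ∑ i, fderiv ℝ (hessForm u) x (W i) (W i)) x :=
  hasFDerivAt_inv_sqrt (hu.hasFDerivAt_traceForm W hx) hS

/-- The second derivative of the inverse square root of the trace of the metric. -/
theorem hessForm_inv_sqrt_traceForm (hu : P.Guillemin u) {W : ι → E n}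
    (hS : ∀ x ∈ P.inner, 0 < traceForm u W x) {x : E n} (hx : x ∈ P.inner) (v : E n) :
    hessForm (fun y => (√(traceForm u W y))⁻¹) x v v =
      3 / 4 * (√(traceForm u W x))⁻¹ ^ 5 * (∑ i, fderiv ℝ (hessForm u) x v (W i) (W i)) ^ 2 -
      1 / 2 * (√(traceForm u W x))⁻¹ ^ 3 *
        ∑ i, fderiv ℝ (fderiv ℝ (hessForm u)) x v v (W i) (W i) := by
  have hf : ContDiffAt ℝ ∞ (fun y => (√(traceForm u W y))⁻¹) x :=
    ((((hu.contDiffOn_traceForm W).contDiffAt (P.isOpen_inner.mem_nhds hx)).sqrt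
      (hS x hx).ne').inv (Real.sqrt_pos.2 (hS x hx)).ne')
  have hd : DifferentiableAt ℝ (fderiv ℝ fun y => (√(traceForm u W y))⁻¹) x :=
    (hf.fderiv_right (m := ∞) (by simp)).differentiableAt (by simp)
  have h1 := (DifferentiableAt.hasDerivAt_line hd v).clm_apply (hasDerivAt_const (0 : ℝ) v)
  have hT := DifferentiableAt.hasDerivAt_line
    (F := E n →L[ℝ] E n →L[ℝ] E n →L[ℝ] ℝ) (hu.differentiableAt_fderiv_hessForm hx) v
  have h2 : HasDerivAt (fun t : ℝ => ∑ i, fderiv ℝ (hessForm u) (x + t • v) v (W i) (W i))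
      (∑ i, fderiv ℝ (fderiv ℝ (hessForm u)) x v v (W i) (W i)) 0 := by
    refine HasDerivAt.fun_sum fun i _ => ?_
    simpa using ((hT.clm_apply (hasDerivAt_const (0 : ℝ) v)).clm_apply
      (hasDerivAt_const (0 : ℝ) (W i))).clm_apply (hasDerivAt_const (0 : ℝ) (W i))
  have hF := (hu.hasFDerivAt_inv_sqrt_traceForm hx (hS x hx)).differentiableAt
  have h3 := ((((DifferentiableAt.hasDerivAt_line hF v).fun_pow 3).const_mul (-(1 / 2))).mul h2)
  have he : ∀ y ∈ P.inner, fderiv ℝ (fun y => (√(traceForm u W y))⁻¹) y v =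
      -(1 / 2) * (√(traceForm u W y))⁻¹ ^ 3 * ∑ i, fderiv ℝ (hessForm u) y v (W i) (W i) := by
    intro y hy
    rw [(hu.hasFDerivAt_inv_sqrt_traceForm hy (hS y hy)).fderiv]
    simp only [_root_.smul_apply, _root_.sum_apply, smul_eq_mul]
    congr 1
    refine Finset.sum_congr rfl fun i _ => ?_
    rw [hu.third_symm_left hy v (W i), hu.third_symm_right hy (W i) v]
  have he' : (fun t : ℝ => fderiv ℝ (fun y => (√(traceForm u W y))⁻¹) (x + t • v) v) =ᶠ[𝓝 0]
      fun t : ℝ => -(1 / 2) * (√(traceForm u W (x + t • v)))⁻¹ ^ 3 *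
        ∑ i, fderiv ℝ (hessForm u) (x + t • v) v (W i) (W i) := by
    filter_upwards [eventually_line P.isOpen_inner hx v] with t ht using he _ ht
  have h4 := h1.unique (h3.congr_of_eventuallyEq he')
  simp only [zero_smul, add_zero, map_zero] at h4
  rw [hessForm, h4, he x hx]
  norm_num
  ring

/-- The inverse square root of the trace of the metric over a family of vectors, with its
gradient. -/
theorem sinhConcave_traceForm (hu : P.Guillemin u) (hF : ∀ x ∈ P.inner, normF u x ≤ 1)
    {W : ι → E n} (hS : ∀ x ∈ P.inner, 0 < traceForm u W x) :
    SinhConcave (hessForm u) P.inner (fun y => (√(traceForm u W y))⁻¹)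
      (fun y => sharp u y (fderiv ℝ (fun y => (√(traceForm u W y))⁻¹) y)) := by
  have hsm : ContDiffOn ℝ ∞ (fun y => (√(traceForm u W y))⁻¹) P.inner := fun x hx =>
    ((((hu.contDiffOn_traceForm W).contDiffAt (P.isOpen_inner.mem_nhds hx)).sqrt
      (hS x hx).ne').inv (Real.sqrt_pos.2 (hS x hx)).ne').contDiffWithinAt
  have hsX : ∀ x ∈ P.inner, ContDiffAt ℝ ∞
      (fun y => sharp u y (fderiv ℝ (fun y => (√(traceForm u W y))⁻¹) y)) x := fun x hx =>
    hu.contDiffAt_sharp hx (((hsm x hx).contDiffAt (P.isOpen_inner.mem_nhds hx)).fderiv_right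
      (m := ∞) (by simp))
  refine ⟨hsm, fun x hx => (hsX x hx).contDiffWithinAt,
    fun x hx => inv_pos.2 (Real.sqrt_pos.2 (hS x hx)),
    fun x hx v => by rw [hu.hessForm_sharp hx], fun x hx v => ?_⟩
  have hd : DifferentiableAt ℝ (fderiv ℝ fun y => (√(traceForm u W y))⁻¹) x :=
    ((((hsm x hx).contDiffAt (P.isOpen_inner.mem_nhds hx))).fderiv_right
      (m := ∞) (by simp)).differentiableAt (by simp)
  have hH := hu.hessForm_inv_sqrt_traceForm hS hx v
  set f : E n → ℝ := fun y => (√(traceForm u W y))⁻¹ with hf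
  set X : E n → E n := fun y => sharp u y (fderiv ℝ f y) with hX
  have h1 := (DifferentiableAt.hasDerivAt_line hd v).clm_apply (hasDerivAt_const (0 : ℝ) v)
  have h2 := ((DifferentiableAt.hasDerivAt_line (F := E n →L[ℝ] E n →L[ℝ] ℝ)
    (hu.differentiableAt_hessForm hx) v).clm_apply
    (DifferentiableAt.hasDerivAt_line ((hsX x hx).differentiableAt (by simp)) v)).clm_apply
    (hasDerivAt_const (0 : ℝ) v)
  have he : (fun t : ℝ => hessForm u (x + t • v) (X (x + t • v)) v) =ᶠ[𝓝 0]
      fun t : ℝ => fderiv ℝ f (x + t • v) v := by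
    filter_upwards [eventually_line P.isOpen_inner hx v] with t ht
    rw [hX, hu.hessForm_sharp ht]
  have h3 := h2.unique (h1.congr_of_eventuallyEq he)
  simp only [zero_smul, add_zero, map_zero, _root_.add_apply] at h3
  rw [hu.hessMetric.symm x hx (fderiv ℝ X x v) v] at h3
  have h4 : fderiv ℝ (hessForm u) x v (X x) v = fderiv ℝ (hessForm u) x (X x) v v := by
    rw [hu.third_symm_left hx]
  -- For a Hessian metric the Riemannian Hessian of `f` is D²f(v,v) - ½ D_X G(v,v); this is the
  -- Christoffel term written through the third derivatives of `u`.
  have h5 : fderiv ℝ (hessForm u) x (X x) v v = -(1 / 2) * f x ^ 3 *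
      ∑ i, fderiv ℝ (hessForm u) x (W i) (W i) (sharp u x (fderiv ℝ (hessForm u) x v v)) := by
    rw [← h4, hu.third_symm_right hx, hX, hu.pairing_sharp_symm hx,
      (hu.hasFDerivAt_inv_sqrt_traceForm hx (hS x hx)).fderiv]
    simp [hf]
  have hf0 : 0 < f x := inv_pos.2 (Real.sqrt_pos.2 (hS x hx))
  have hfS : f x ^ 2 * traceForm u W x = 1 := by
    rw [hf]
    simp only [inv_pow, Real.sq_sqrt (hS x hx).le]
    exact inv_mul_cancel₀ (hS x hx).ne'
  -- Cauchy-Schwarz twice: in the metric for each vector of the family, then over the family.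
  have hcs : (∑ i, fderiv ℝ (hessForm u) x v (W i) (W i)) ^ 2 ≤
      (∑ i, fderiv ℝ (hessForm u) x v (W i)
        (sharp u x (fderiv ℝ (hessForm u) x v (W i)))) * traceForm u W x := by
    refine Finset.sum_sq_le_sum_mul_sum_of_sq_le_mul _ (fun i _ => ?_)
      (fun i _ => hu.hessMetric.nonneg hx _) fun i _ => ?_
    · have := hu.hessMetric.nonneg hx (sharp u x (fderiv ℝ (hessForm u) x v (W i)))
      rwa [hu.hessForm_sharp hx] at this
    · have := hu.hessMetric.sq_le hx (sharp u x (fderiv ℝ (hessForm u) x v (W i))) (W i)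
      rwa [hu.hessForm_sharp hx] at this
  have hsum := Finset.sum_le_sum fun i (_ : i ∈ Finset.univ) =>
    hu.curvature_le hx (hF x hx) (W i) v
  simp only [Finset.sum_add_distrib, Finset.sum_sub_distrib, Finset.sum_neg_distrib,
    ← Finset.mul_sum, ← Finset.sum_mul] at hsum
  change _ ≤ traceForm u W x * _ - _ at hsum
  set h := ∑ i, fderiv ℝ (hessForm u) x v (W i) (sharp u x (fderiv ℝ (hessForm u) x v (W i)))
  set τ := ∑ i, fderiv ℝ (hessForm u) x v (W i) (W i)
  have hg := hu.hessMetric.nonneg hx v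
  -- The term ¾ f⁵ τ² of D²f is absorbed exactly by the term -¾ f³ h that comes from the curvature
  -- inequality. What remains is half of the bound to be proved.
  have k1 : f x ^ 5 * τ ^ 2 ≤ f x ^ 3 * h := by
    calc f x ^ 5 * τ ^ 2 ≤ f x ^ 5 * (h * traceForm u W x) := by gcongr
      _ = f x ^ 3 * h * (f x ^ 2 * traceForm u W x) := by ring
      _ = _ := by rw [hfS, mul_one]
  have k2 := mul_le_mul_of_nonneg_left hsum (pow_pos hf0 3).le
  have k3 : f x ^ 3 * (traceForm u W x * hessForm u x v v) = f x * hessForm u x v v := by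
    calc _ = f x * hessForm u x v v * (f x ^ 2 * traceForm u W x) := by ring
      _ = _ := by rw [hfS, mul_one]
  have k4 : 0 ≤ f x * hessForm u x v v := mul_nonneg hf0.le hg
  change _ = 3 / 4 * f x ^ 5 * τ ^ 2 - 1 / 2 * f x ^ 3 * _ at hH
  rw [hessForm] at hH
  change 1 / 2 * fderiv ℝ (hessForm u) x (X x) v v + hessForm u x v (fderiv ℝ X x v) ≤
    f x * hessForm u x v v
  rw [mul_sub, k3] at k2
  linarith

end DelzantPolytope.Guillemin

end Toric

/-! ### Comparison of the metrics and of their inverses. -/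

namespace Toric

open Filter Topology Matrix

variable {n : ℕ} {P : DelzantPolytope n} {u : E n → ℝ}

theorem mul_sq_le_of_inv_sqrt_mul_le {a b s t : ℝ} (ha : 0 < a) (hb : 0 < b) (hs : 0 ≤ s)
    (h : (√a)⁻¹ * s ≤ (√b)⁻¹ * t) : b * s ^ 2 ≤ a * t ^ 2 := by
  have h1 : √b * s ≤ √a * t := by
    rwa [inv_mul_eq_div, inv_mul_eq_div, div_le_div_iff₀ (Real.sqrt_pos.2 ha) (Real.sqrt_pos.2 hb),
      mul_comm s, mul_comm t] at h
  have h2 := pow_le_pow_left₀ (mul_nonneg (Real.sqrt_nonneg b) hs) h1 2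
  rwa [mul_pow, mul_pow, Real.sq_sqrt ha.le, Real.sq_sqrt hb.le] at h2

/-- The inequality `r A ≤ s B` of positive definite matrices is reversed by inversion. -/
theorem mul_inv_form_le {A B : Matrix (Fin n) (Fin n) ℝ} (hA : A.PosDef) (hB : B.PosDef)
    {r s : ℝ} (hr : 0 ≤ r) (hs : 0 ≤ s)
    (h : ∀ v, r * (v ⬝ᵥ A *ᵥ v) ≤ s * (v ⬝ᵥ B *ᵥ v)) (ξ : Fin n → ℝ) :
    r * (ξ ⬝ᵥ B⁻¹ *ᵥ ξ) ≤ s * (ξ ⬝ᵥ A⁻¹ *ᵥ ξ) := by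
  have ha : A *ᵥ A⁻¹ *ᵥ ξ = ξ := by
    rw [mulVec_mulVec, Matrix.mul_nonsing_inv _ hA.det_pos.ne'.isUnit, one_mulVec]
  have hb : B *ᵥ B⁻¹ *ᵥ ξ = ξ := by
    rw [mulVec_mulVec, Matrix.mul_nonsing_inv _ hB.det_pos.ne'.isUnit, one_mulVec]
  -- Cauchy-Schwarz for `A` reads (ξ·B⁻¹ξ)² ≤ (B⁻¹ξ·A B⁻¹ξ)(ξ·A⁻¹ξ). The hypothesis at B⁻¹ξ bounds
  -- the first factor by ξ·B⁻¹ξ, which then cancels.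
  have h1 := posSemidef_dotProduct_mulVec_sq_le hA.posSemidef (B⁻¹ *ᵥ ξ) (A⁻¹ *ᵥ ξ)
  have h2 := h (B⁻¹ *ᵥ ξ)
  rw [ha, dotProduct_comm _ ξ, dotProduct_comm _ ξ] at h1
  rw [hb, dotProduct_comm _ ξ] at h2
  have hx : 0 ≤ ξ ⬝ᵥ A⁻¹ *ᵥ ξ := by simpa using hA.inv.posSemidef.dotProduct_mulVec_nonneg ξ
  have hy : 0 ≤ ξ ⬝ᵥ B⁻¹ *ᵥ ξ := by simpa using hB.inv.posSemidef.dotProduct_mulVec_nonneg ξ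
  rcases hy.eq_or_lt with h0 | h0
  · rw [← h0, mul_zero]
    positivity
  · refine le_of_mul_le_mul_right ?_ h0
    nlinarith [mul_le_mul_of_nonneg_left h1 hr, mul_le_mul_of_nonneg_right h2 hx]

theorem posSemidef_of_forall_nonneg {M : Matrix (Fin n) (Fin n) ℝ} (hM : M.IsHermitian)
    (h : ∀ ξ, 0 ≤ ξ ⬝ᵥ M *ᵥ ξ) : M.PosSemidef :=
  Matrix.PosSemidef.of_dotProduct_mulVec_nonneg hM fun ξ => by simpa using h ξ

theorem posSemidef_smul_inv_sub {A B : Matrix (Fin n) (Fin n) ℝ} (hA : A.PosDef) (hB : B.PosDef)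
    {r s : ℝ} (hr : 0 < r) (hs : 0 ≤ s)
    (h : ∀ v, r * (v ⬝ᵥ A *ᵥ v) ≤ s * (v ⬝ᵥ B *ᵥ v)) : ((s / r) • A⁻¹ - B⁻¹).PosSemidef := by
  refine posSemidef_of_forall_nonneg ((hA.inv.isHermitian.smul (IsSelfAdjoint.all _)).sub
    hB.inv.isHermitian) fun ξ => ?_
  have := mul_inv_form_le hA hB hr.le hs h ξ
  rw [sub_mulVec, smul_mulVec, dotProduct_sub, dotProduct_smul, smul_eq_mul, sub_nonneg,
    div_mul_eq_mul_div, le_div_iff₀ hr]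
  linarith

theorem posSemidef_inv_sub_smul {A B : Matrix (Fin n) (Fin n) ℝ} (hA : A.PosDef) (hB : B.PosDef)
    {r s : ℝ} (hr : 0 ≤ r) (hs : 0 < s)
    (h : ∀ v, r * (v ⬝ᵥ A *ᵥ v) ≤ s * (v ⬝ᵥ B *ᵥ v)) : (A⁻¹ - (r / s) • B⁻¹).PosSemidef := by
  refine posSemidef_of_forall_nonneg (hA.inv.isHermitian.sub
    (hB.inv.isHermitian.smul (IsSelfAdjoint.all _))) fun ξ => ?_
  have := mul_inv_form_le hA hB hr hs.le h ξ
  rw [sub_mulVec, smul_mulVec, dotProduct_sub, dotProduct_smul, smul_eq_mul, sub_nonneg,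
    div_mul_eq_mul_div, div_le_iff₀ hs]
  linarith

namespace DelzantPolytope.Guillemin

theorem traceForm_single_pos (hu : P.Guillemin u) [Nonempty (Fin n)] {x : E n} (hx : x ∈ P.inner) :
    0 < traceForm u (fun i => EuclideanSpace.single i (1 : ℝ)) x :=
  Finset.sum_pos (fun i _ => hu.hessMetric.pos x hx _ (by simp)) Finset.univ_nonempty

/-- The trace of the metric is proper on the open polytope. -/
theorem isCompact_superlevel_traceForm (hu : P.Guillemin u) [Nonempty (Fin n)] {η : ℝ}
    (hη : 0 < η) : IsCompact {x | x ∈ P.inner ∧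
      η ≤ (√(traceForm u (fun i => EuclideanSpace.single i (1 : ℝ)) x))⁻¹} := by
  obtain ⟨C, hC, hb⟩ := hu.exists_hessForm_bound
  have hi : ∀ k, ∃ i : Fin n, P.normalForm k (EuclideanSpace.single i 1) ≠ 0 := fun k => by
    by_contra! h
    refine P.normalForm_ne_zero k (ContinuousLinearMap.ext fun w => ?_)
    rw [euclidean_eq_sum_single w]
    simp [h]
  choose i hi using hi
  -- On the superlevel set the trace is at most η⁻², and it is at least ν²/(2 l_k) - n C with ν a
  -- nonzero entry of the k-th normal. So `l_k` is at least ν²/(2M), where the summand 1 keeps `M`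
  -- positive.
  set M : ℝ := (η⁻¹) ^ 2 + n * C + 1 with hM
  have hM0 : 0 < M := by positivity
  obtain ⟨c, hc, hck⟩ := exists_pos_forall_le
    (fun k => P.normalForm k (EuclideanSpace.single (i k) 1) ^ 2 / (2 * M))
    fun k => by have := hi k; positivity
  have hsub : {x | x ∈ P.inner ∧
      η ≤ (√(traceForm u (fun i => EuclideanSpace.single i (1 : ℝ)) x))⁻¹} ⊆ P.core c := by
    rintro x ⟨hx, hxη⟩ k
    refine (hck k).trans ?_
    have hS := hu.traceForm_single_pos hx
    have h1 : traceForm u (fun i => EuclideanSpace.single i (1 : ℝ)) x ≤ (η⁻¹) ^ 2 := by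
      rw [← Real.sqrt_le_left (inv_pos.2 hη).le]
      exact (le_inv_comm₀ hη (Real.sqrt_pos.2 hS)).1 hxη
    have h2 : ∀ j : Fin n, (1 / 2) * ∑ k, P.normalForm k (EuclideanSpace.single j 1) ^ 2 / P.l k x ≤
        hessForm u x (EuclideanSpace.single j 1) (EuclideanSpace.single j 1) + C := fun j => by
      have := (abs_le.1 (hb x hx (EuclideanSpace.single j 1))).1
      simp only [PiLp.norm_single, norm_one, one_pow, mul_one] at this
      linarith
    have h3 : (1 / 2) * (P.normalForm k (EuclideanSpace.single (i k) 1) ^ 2 / P.l k x) ≤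
        traceForm u (fun i => EuclideanSpace.single i (1 : ℝ)) x + n * C := by
      have hpos : ∀ j k, 0 ≤ P.normalForm k (EuclideanSpace.single j 1) ^ 2 / P.l k x := fun j k =>
        div_nonneg (sq_nonneg _) (hx k).le
      calc _ ≤ (1 / 2) * ∑ k', P.normalForm k' (EuclideanSpace.single (i k) 1) ^ 2 / P.l k' x := by
            gcongr
            exact Finset.single_le_sum (f := fun k' =>
              P.normalForm k' (EuclideanSpace.single (i k) 1) ^ 2 / P.l k' x)
              (fun k' _ => hpos _ k') (Finset.mem_univ k)
        _ ≤ ∑ j, (1 / 2) * ∑ k', P.normalForm k' (EuclideanSpace.single j 1) ^ 2 / P.l k' x :=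
            Finset.single_le_sum (f := fun j =>
              (1 / 2) * ∑ k', P.normalForm k' (EuclideanSpace.single j 1) ^ 2 / P.l k' x)
              (fun j _ => mul_nonneg (by norm_num) (Finset.sum_nonneg fun k' _ => hpos j k'))
              (Finset.mem_univ (i k))
        _ ≤ ∑ j : Fin n, (hessForm u x (EuclideanSpace.single j 1)
              (EuclideanSpace.single j 1) + C) := Finset.sum_le_sum fun j _ => h2 j
        _ = _ := by simp [Finset.sum_add_distrib, traceForm]
    rw [div_le_iff₀ (by positivity)]
    have hl := hx k
    rw [← mul_div_assoc, div_le_iff₀ hl] at h3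
    nlinarith [mul_le_mul_of_nonneg_right h1 hl.le]
  have hcont : ContinuousOn
      (fun x => (√(traceForm u (fun i => EuclideanSpace.single i (1 : ℝ)) x))⁻¹) (P.core c) := by
    refine ContinuousOn.inv₀ (((hu.contDiffOn_traceForm _).continuousOn.mono
      (P.core_subset_inner hc)).sqrt) fun x hx => ?_
    exact (Real.sqrt_pos.2 (hu.traceForm_single_pos (P.core_subset_inner hc hx))).ne'
  refine (P.isCompact_core hc).of_isClosed_subset ?_ hsub
  convert hcont.preimage_isClosed_of_isClosed (P.isCompact_core hc).isClosed
    (isClosed_Ici (a := η)) using 1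
  ext x
  exact ⟨fun h => ⟨hsub h, h.2⟩, fun h => ⟨P.core_subset_inner hc h.1, h.2⟩⟩

/-- Comparison of the metrics at two points of the open polytope. -/
theorem hessForm_mul_sinh_sq_le (hu : P.Guillemin u) (hF : ∀ x ∈ P.inner, normF u x ≤ 1)
    {p q : E n} (hp : p ∈ P.inner) (hq : q ∈ P.inner) {α : ℝ} (hα : 0 < α)
    (hpα : ENNReal.ofReal α ≤ gDistBoundary P u p) (w : E n) :
    hessForm u p w w * Real.sinh α ^ 2 ≤
      hessForm u q w w * Real.sinh (α + rDist P u p q) ^ 2 := by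
  rcases eq_or_ne w 0 with rfl | hw
  · simp
  have hn : Nonempty (Fin n) := by
    by_contra h
    rw [not_nonempty_iff] at h
    exact hw (Subsingleton.elim _ _)
  have hW : ∀ x, traceForm u (fun _ : Unit => w) x = hessForm u x w w := fun x => by
    simp [traceForm]
  have hpos : ∀ x ∈ P.inner, 0 < traceForm u (fun _ : Unit => w) x := fun x hx => by
    rw [hW]; exact hu.hessMetric.pos x hx w hw
  -- The family with the single vector `w` gives the function to be compared; the standard basis
  -- gives the proper function.
  have h := hu.mul_sinh_le (hu.sinhConcave_traceForm hF hpos)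
    (hu.sinhConcave_traceForm hF fun x hx => hu.traceForm_single_pos hx)
    (fun η hη => hu.isCompact_superlevel_traceForm hη) hp hq hα hpα
  have h1 := mul_sq_le_of_inv_sqrt_mul_le (hpos q hq) (hpos p hp)
    (Real.sinh_nonneg_iff.2 hα.le) h
  rwa [hW, hW] at h1

/-- Comparison of the metrics at two points that are closer than the boundary. -/
theorem hessForm_mul_sinh_sub_sq_le (hu : P.Guillemin u) (hF : ∀ x ∈ P.inner, normF u x ≤ 1)
    {p q : E n} (hp : p ∈ P.inner) (hq : q ∈ P.inner) {α : ℝ}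
    (hpα : ENNReal.ofReal α ≤ gDistBoundary P u p) (hd : rDist P u p q < α) (w : E n) :
    hessForm u q w w * Real.sinh (α - rDist P u p q) ^ 2 ≤ hessForm u p w w * Real.sinh α ^ 2 := by
  rcases eq_or_ne w 0 with rfl | hw
  · simp
  have hW : ∀ x, traceForm u (fun _ : Unit => w) x = hessForm u x w w := fun x => by
    simp [traceForm]
  have hpos : ∀ x ∈ P.inner, 0 < traceForm u (fun _ : Unit => w) x := fun x hx => by
    rw [hW]; exact hu.hessMetric.pos x hx w hw
  have h := (hu.mul_sinh_le_of_rDist_lt (hu.sinhConcave_traceForm hF hpos) hp hq hpα hd).2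
  have h1 := mul_sq_le_of_inv_sqrt_mul_le (hpos p hp) (hpos q hq)
    (Real.sinh_nonneg_iff.2 (sub_pos.2 hd).le) h
  rwa [hW, hW] at h1

theorem posSemidef_smul_invHess_sub (hu : P.Guillemin u) (hF : ∀ x ∈ P.inner, normF u x ≤ 1)
    {p q : E n} (hp : p ∈ P.inner) (hq : q ∈ P.inner) {α : ℝ} (hα : 0 < α)
    (hpα : ENNReal.ofReal α ≤ gDistBoundary P u p) :
    ((Real.sinh (α + rDist P u p q) ^ 2 / Real.sinh α ^ 2) • invHess u p -
      invHess u q).PosSemidef := by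
  refine posSemidef_smul_inv_sub (hu.posDef_hess hp) (hu.posDef_hess hq)
    (pow_pos (Real.sinh_pos_iff.2 hα) 2) (sq_nonneg _) fun v => ?_
  have h := hu.hessForm_mul_sinh_sq_le hF hp hq hα hpα (WithLp.toLp 2 v)
  rw [hessForm_eq_dotProduct (hu.differentiableAt_fderiv hp),
    hessForm_eq_dotProduct (hu.differentiableAt_fderiv hq)] at h
  simpa only [mul_comm] using h

theorem posSemidef_invHess_sub_smul (hu : P.Guillemin u) (hF : ∀ x ∈ P.inner, normF u x ≤ 1)
    {p q : E n} (hp : p ∈ P.inner) (hq : q ∈ P.inner) {α : ℝ} (hα : 0 < α)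
    (hpα : ENNReal.ofReal α ≤ gDistBoundary P u p) (hd : rDist P u p q < α) :
    (invHess u q - (Real.sinh (α - rDist P u p q) ^ 2 / Real.sinh α ^ 2) •
      invHess u p).PosSemidef := by
  refine posSemidef_inv_sub_smul (hu.posDef_hess hq) (hu.posDef_hess hp) (sq_nonneg _)
    (pow_pos (Real.sinh_pos_iff.2 hα) 2) fun v => ?_
  have h := hu.hessForm_mul_sinh_sub_sq_le hF hp hq hpα hd (WithLp.toLp 2 v)
  rw [hessForm_eq_dotProduct (hu.differentiableAt_fderiv hp),
    hessForm_eq_dotProduct (hu.differentiableAt_fderiv hq)] at h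
  simpa only [mul_comm] using h

end DelzantPolytope.Guillemin

end Toric

/-! ### Metric balls and ellipsoids. -/

namespace Toric

open Filter Topology Matrix

variable {n : ℕ} {P : DelzantPolytope n} {u : E n → ℝ}

theorem sinh_sub_div_pos {α β : ℝ} (hβ : 0 ≤ β) (hβα : β < α) :
    0 < Real.sinh (α - β) / Real.sinh α :=
  div_pos (Real.sinh_pos_iff.2 (sub_pos.2 hβα)) (Real.sinh_pos_iff.2 (hβ.trans_lt hβα))

namespace DelzantPolytope.Guillemin

/-- The metric at points close to `p`. -/
theorem sqrt_metricForm_le_of_rDist_le (hu : P.Guillemin u) (hF : ∀ x ∈ P.inner, normF u x ≤ 1)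
    {p x : E n} (hp : p ∈ P.inner) (hx : x ∈ P.inner) {α δ : ℝ}
    (hpα : ENNReal.ofReal α ≤ gDistBoundary P u p) (hd : rDist P u p x ≤ δ) (hδ : δ < α) (w : E n) :
    √(metricForm u x w) ≤ √(metricForm u p w) / (Real.sinh (α - δ) / Real.sinh α) := by
  have hδ0 := (rDist_nonneg (P := P) (u := u) p x).trans hd
  have hα : 0 < Real.sinh α := Real.sinh_pos_iff.2 (hδ0.trans_lt hδ)
  have h := hu.hessForm_mul_sinh_sub_sq_le hF hp hx hpα (hd.trans_lt hδ) w
  have hs : Real.sinh (α - δ) ≤ Real.sinh (α - rDist P u p x) := Real.sinh_le_sinh.2 (by linarith)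
  have hs0 : 0 < Real.sinh (α - δ) := Real.sinh_pos_iff.2 (sub_pos.2 hδ)
  rw [← hu.hessMetric.eq x hx, ← hu.hessMetric.eq p hp] at h
  have hx0 : 0 ≤ metricForm u x w := by
    rw [hu.hessMetric.eq x hx]; exact hu.hessMetric.nonneg hx w
  have hp0 : 0 ≤ metricForm u p w := by
    rw [hu.hessMetric.eq p hp]; exact hu.hessMetric.nonneg hp w
  rw [div_div_eq_mul_div, le_div_iff₀ hs0]
  refine le_of_sq_le_sq ?_ (by positivity)
  rw [mul_pow, mul_pow, Real.sq_sqrt hx0, Real.sq_sqrt hp0]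
  exact (mul_le_mul_of_nonneg_left (pow_le_pow_left₀ hs0.le hs 2) hx0).trans h

/-- A segment of the open polytope that stays close to `p`. -/
theorem conn_line (hu : P.Guillemin u) (hF : ∀ x ∈ P.inner, normF u x ≤ 1)
    {p x v : E n} (hp : p ∈ P.inner) {α δ : ℝ} (hpα : ENNReal.ofReal α ≤ gDistBoundary P u p)
    (hδ : δ < α) (h : ∀ t ∈ Icc (0 : ℝ) 1, x + t • v ∈ P.inner ∧ rDist P u p (x + t • v) ≤ δ) :
    Conn u P.inner x (x + v)
      (ENNReal.ofReal (√(metricForm u p v) / (Real.sinh (α - δ) / Real.sinh α))) :=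
  Conn.segment (fun t ht => (h t ht).1) fun t ht =>
    hu.sqrt_metricForm_le_of_rDist_le hF hp (h t ht).1 hpα (h t ht).2 hδ v

theorem rDist_self {x : E n} (hx : x ∈ P.inner) : rDist P u x x = 0 := by
  rw [rDist, gDist_self hx, ENNReal.toReal_zero]

/-- Integrating over the whole segment yields only `≤ β`. The first half stays within distance β/2,
where the comparison has the better constant sinh(α - β/2)/sinh α, and this makes the inequality
strict. -/
theorem rDist_lt_of_forall_le (hu : P.Guillemin u) (hF : ∀ x ∈ P.inner, normF u x ≤ 1)
    {p x : E n} (hp : p ∈ P.inner) (hx : x ∈ P.inner) {α β : ℝ}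
    (hpα : ENNReal.ofReal α ≤ gDistBoundary P u p) (hβ : 0 < β) (hβα : β < α)
    (hxβ : √(metricForm u p (x - p)) ≤ Real.sinh (α - β) / Real.sinh α * β)
    (h : ∀ t ∈ Icc (0 : ℝ) 1, rDist P u p (p + t • (x - p)) ≤ β) : rDist P u p x < β := by
  set v := x - p with hv
  have hin : ∀ t ∈ Icc (0 : ℝ) 1, p + t • v ∈ P.inner := fun t ht =>
    P.add_smul_sub_mem hp hx ht
  have hcβ := sinh_sub_div_pos hβ.le hβα
  set N := √(metricForm u p v) with hN
  have hN0 : 0 ≤ N := Real.sqrt_nonneg _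
  have hhalf : ∀ w : ℝ, 0 ≤ w → √(metricForm u p (w • v)) = w * N := fun w hw =>
    sqrt_metricForm_smul u p v hw
  have hle : ∀ s ∈ Icc (0 : ℝ) (1 / 2), rDist P u p (p + s • v) ≤ β / 2 := by
    intro s hs
    have h1 := hu.conn_line hF (x := p) (v := s • v) hp hpα hβα fun t ht => by
      have hts : t * s ∈ Icc (0 : ℝ) 1 :=
        ⟨mul_nonneg ht.1 hs.1, mul_le_one₀ ht.2 hs.1 (by linarith [hs.2])⟩
      rw [smul_smul]
      exact ⟨hin _ hts, h _ hts⟩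
    rw [hhalf s hs.1] at h1
    have h2 := hu.rDist_le_add hp hp (div_nonneg (mul_nonneg hs.1 hN0) hcβ.le) h1
    rw [rDist_self hp, zero_add] at h2
    refine h2.trans ((div_le_iff₀ hcβ).2 ?_)
    calc s * N ≤ 1 / 2 * N := by gcongr; exact hs.2
      _ ≤ _ := by linarith
  have hc2 : Real.sinh (α - β) / Real.sinh α < Real.sinh (α - β / 2) / Real.sinh α := by
    have : 0 < Real.sinh α := Real.sinh_pos_iff.2 (hβ.trans hβα)
    gcongr
    exact Real.sinh_lt_sinh.2 (by linarith)
  have k1 := hu.conn_line hF (x := p) (v := (1 / 2 : ℝ) • v) hp hpα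
    (show β / 2 < α by linarith) fun t ht => by
      have hts : t * (1 / 2) ∈ Icc (0 : ℝ) (1 / 2) :=
        ⟨mul_nonneg ht.1 (by norm_num), by linarith [ht.2]⟩
      rw [smul_smul]
      exact ⟨hin _ ⟨hts.1, by linarith [hts.2]⟩, hle _ hts⟩
  have k2 := hu.conn_line hF (x := p + (1 / 2 : ℝ) • v) (v := (1 / 2 : ℝ) • v) hp hpα hβα
    fun t ht => by
      have hts : 1 / 2 + t * (1 / 2) ∈ Icc (0 : ℝ) 1 :=
        ⟨by linarith [ht.1], by linarith [ht.2]⟩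
      rw [smul_smul, add_assoc, ← add_smul]
      exact ⟨hin _ hts, h _ hts⟩
  have hm : p + (1 / 2 : ℝ) • v ∈ P.inner := hin _ (by norm_num)
  have e : p + (1 / 2 : ℝ) • v + (1 / 2 : ℝ) • v = x := by
    rw [add_assoc, ← add_smul]; norm_num [hv]
  rw [e] at k2
  rw [hhalf _ (by norm_num)] at k1 k2
  have r1 := hu.rDist_le_add hp hp (div_nonneg (by positivity) (hcβ.trans hc2).le) k1
  have r2 := hu.rDist_le_add hp hm (div_nonneg (by positivity) hcβ.le) k2
  rw [rDist_self hp, zero_add] at r1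
  have b1 : 1 / 2 * N / (Real.sinh (α - β / 2) / Real.sinh α) < β / 2 := by
    rw [div_lt_iff₀ (hcβ.trans hc2)]
    nlinarith
  have b2 : 1 / 2 * N / (Real.sinh (α - β) / Real.sinh α) ≤ β / 2 := by
    rw [div_le_iff₀ hcβ]
    linarith
  linarith

/-- A continuity argument: up to the first parameter `s` at which the segment is at distance β the
hypothesis of `rDist_lt_of_forall_le` holds, and its conclusion contradicts the choice of `s`. -/
theorem rDist_lt_of_metricForm_le (hu : P.Guillemin u) (hF : ∀ x ∈ P.inner, normF u x ≤ 1)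
    {p x : E n} (hp : p ∈ P.inner) (hx : x ∈ P.inner) {α β : ℝ}
    (hpα : ENNReal.ofReal α ≤ gDistBoundary P u p) (hβ : 0 < β) (hβα : β < α)
    (hxβ : √(metricForm u p (x - p)) ≤ Real.sinh (α - β) / Real.sinh α * β) :
    rDist P u p x < β := by
  by_contra! hcon
  set φ : ℝ → ℝ := fun t => rDist P u p (p + t • (x - p)) with hφ
  have hin : ∀ t ∈ Icc (0 : ℝ) 1, p + t • (x - p) ∈ P.inner := fun t ht =>
    P.add_smul_sub_mem hp hx ht
  have hφc : ContinuousOn φ (Icc 0 1) :=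
    (hu.continuousOn_rDist hp).comp (by fun_prop) hin
  have h0 : φ 0 = 0 := by simp [hφ, rDist_self hp]
  have h1 : β ≤ φ 1 := by simpa [hφ] using hcon
  have hcpt : IsCompact (Icc 0 1 ∩ φ ⁻¹' {β}) :=
    isCompact_Icc.of_isClosed_subset (hφc.preimage_isClosed_of_isClosed isClosed_Icc
      isClosed_singleton) inter_subset_left
  have hne : (Icc 0 1 ∩ φ ⁻¹' {β}).Nonempty := by
    obtain ⟨t, ht, hβt⟩ := intermediate_value_Icc zero_le_one hφc ⟨h0.trans_le hβ.le, h1⟩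
    exact ⟨t, ht, hβt⟩
  obtain ⟨s, ⟨hs, hsβ⟩, hmin⟩ := hcpt.exists_isLeast hne
  have hle : ∀ t ∈ Icc 0 s, φ t ≤ β := by
    intro t ht
    by_contra! hlt
    obtain ⟨r, hr, hrβ⟩ := intermediate_value_Icc ht.1
      (hφc.mono (Icc_subset_Icc le_rfl (ht.2.trans hs.2))) ⟨h0.trans_le hβ.le, hlt.le⟩
    have h2 : s ≤ r := hmin ⟨⟨hr.1, hr.2.trans (ht.2.trans hs.2)⟩, hrβ⟩
    have h3 : t = r := le_antisymm (ht.2.trans h2) hr.2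
    rw [h3, hrβ] at hlt
    exact lt_irrefl _ hlt
  have := hu.rDist_lt_of_forall_le hF hp (hin s hs) hpα hβ hβα (by
    rw [add_sub_cancel_left, sqrt_metricForm_smul u p _ hs.1]
    exact (mul_le_of_le_one_left (Real.sqrt_nonneg _) hs.2).trans hxβ) fun t ht => by
      rw [add_sub_cancel_left, smul_smul]
      exact hle _ ⟨mul_nonneg ht.1 hs.1, mul_le_of_le_one_left hs.1 ht.2⟩
  exact this.ne hsβ

/-- That the ellipsoid lies in the open polytope is part of the claim. Points of the segment from
`p` that are in the polytope are within β of `p`, hence in a compact core, so the segment meets the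
polytope in a relatively open and closed set and cannot leave it. -/
theorem ellipsoid_subset_gBall (hu : P.Guillemin u) (hF : ∀ x ∈ P.inner, normF u x ≤ 1)
    {p : E n} (hp : p ∈ P.inner) {α β : ℝ} (hpα : ENNReal.ofReal α ≤ gDistBoundary P u p)
    (hβ : 0 < β) (hβα : β < α) :
    ellipsoid u p (Real.sinh (α - β) / Real.sinh α * β) ⊆ gBall P u p β := by
  intro x hx
  have hr0 : 0 ≤ Real.sinh (α - β) / Real.sinh α * β :=
    mul_nonneg (sinh_sub_div_pos hβ.le hβα).le hβ.le
  have hN : √(metricForm u p (x - p)) ≤ Real.sinh (α - β) / Real.sinh α * β :=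
    (Real.sqrt_le_left hr0).2 hx
  have hclose : ∀ y ∈ segment ℝ p x, y ∈ P.inner → rDist P u p y < β := by
    intro y hy hyi
    rw [segment_eq_image'] at hy
    obtain ⟨t, ht, rfl⟩ := hy
    refine hu.rDist_lt_of_metricForm_le hF hp hyi hpα hβ hβα ?_
    simp only [add_sub_cancel_left]
    rw [sqrt_metricForm_smul u p _ ht.1]
    exact (mul_le_of_le_one_left (Real.sqrt_nonneg _) ht.2).trans hN
  have hxi : x ∈ P.inner := by
    obtain ⟨c, hc, hcore⟩ := hu.exists_mem_core hβ.le hβα hpα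
    have hmem : ∀ y ∈ segment ℝ p x, y ∈ P.inner → y ∈ P.core c := fun y hy hyi =>
      hcore y hyi (hu.conn_of_rDist_lt hp hyi (hclose y hy hyi))
    have hconn := isPreconnected_iff_subset_of_disjoint.1 (convex_segment p x).isPreconnected
      P.inner (P.core c)ᶜ P.isOpen_inner (P.isCompact_core hc).isClosed.isOpen_compl
      (fun y _ => by
        by_cases h : y ∈ P.core c
        · exact Or.inl (P.core_subset_inner hc h)
        · exact Or.inr h)
      (by
        ext y
        simp only [mem_inter_iff, mem_compl_iff, mem_empty_iff_false, iff_false, not_and, not_not]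
        exact hmem y)
    rcases hconn with h | h
    · exact h (right_mem_segment ℝ p x)
    · exact absurd (hmem p (left_mem_segment ℝ p x) hp) (h (left_mem_segment ℝ p x))
  refine ⟨hxi, ?_⟩
  rw [← hu.ofReal_rDist hp hxi]
  exact (ENNReal.ofReal_lt_ofReal_iff hβ).2 (hclose x (right_mem_segment ℝ p x) hxi)

/-- All points of the curve are within `L` of `p`, so velocities measured at `p` are at most `k`
times their g-length. Pairing with `q - p` in the inner product at `p` turns this into a bound on
the displacement. -/
theorem sqrt_metricForm_sub_le_of_conn (hu : P.Guillemin u) (hF : ∀ x ∈ P.inner, normF u x ≤ 1)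
    {p q : E n} (hp : p ∈ P.inner) {α L : ℝ} (hα : 0 < α)
    (hpα : ENNReal.ofReal α ≤ gDistBoundary P u p) (hL : 0 ≤ L)
    (hconn : Conn u P.inner p q (ENNReal.ofReal L)) :
    √(metricForm u p (q - p)) ≤ Real.sinh (α + L) / Real.sinh α * L := by
  have hG := hu.hessMetric
  have hU := hG.metricOn
  have hsα : 0 < Real.sinh α := Real.sinh_pos_iff.2 hα
  set k := Real.sinh (α + L) / Real.sinh α with hk
  have hk0 : 0 ≤ k := div_nonneg (Real.sinh_nonneg_iff.2 (by linarith)) hsα.le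
  obtain ⟨γ, a, b, hab, hγ, hγa, rfl, hm, hlen⟩ := hconn
  have hlen' := hlen
  rw [hU.gLength_eq_arc hab hγ hm, ENNReal.ofReal_le_ofReal_iff hL] at hlen
  have hmono := hU.monotoneOn_arc hab hγ hm
  set v := γ b - p with hv
  set N := √(metricForm u p v) with hN
  have hN0 : 0 ≤ N := Real.sqrt_nonneg _
  have hNsq : N ^ 2 = hessForm u p v v := by
    rw [hN, hG.eq p hp, Real.sq_sqrt (hG.nonneg hp v)]
  have hdist : ∀ t ∈ Ioo a b, rDist P u p (γ t) ≤ L := by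
    intro t ht
    have hm' := hm.mono_left (Icc_subset_Icc le_rfl ht.2.le)
    have hγ' := hγ.mono le_rfl ht.2.le
    have h1 := Conn.of_curve (u := u) ht.1 hγ' hm'
    rw [hγa, hU.gLength_eq_arc ht.1 hγ' hm'] at h1
    have h2 := h1.mono (K' := P.inner) subset_rfl (ENNReal.ofReal_le_ofReal
      ((hmono (Ioo_subset_Icc_self ht) (right_mem_Icc.2 hab.le) ht.2.le).trans hlen))
    simpa [rDist_self hp] using hu.rDist_le_add hp hp hL h2
  obtain ⟨hc, s, hs⟩ := id hγ
  have hmon : MonotoneOn (fun t => N * k * arc u γ a t - hessForm u p v (γ t)) (Icc a b) := by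
    refine le_of_hasDerivAt_nonneg_off_finset s
      (h' := fun t => N * k * speed u γ t - hessForm u p v (deriv γ t))
      ((continuousOn_const.mul (hU.continuousOn_arc hab hγ hm)).sub
        ((hessForm u p v).continuous.comp_continuousOn hc)) fun t ht hts => ?_
    have hcd := contDiffAt_of_piecewise hs ht hts
    have hγt := hm (Ioo_subset_Icc_self ht)
    refine ⟨((hU.hasDerivAt_arc hγ hm ht hcd).const_mul _).sub
      (HasFDerivAt.comp_hasDerivAt t (hessForm u p v).hasFDerivAt
        (hcd.differentiableAt (by simp)).hasDerivAt), ?_⟩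
    have h1 := hu.hessForm_mul_sinh_sq_le hF hp hγt hα hpα (deriv γ t)
    have h2 : Real.sinh (α + rDist P u p (γ t)) ≤ Real.sinh (α + L) :=
      Real.sinh_le_sinh.2 (by linarith [hdist t ht])
    have h20 : 0 ≤ Real.sinh (α + rDist P u p (γ t)) :=
      Real.sinh_nonneg_iff.2 (by linarith [rDist_nonneg (P := P) (u := u) p (γ t)])
    have h3 : hessForm u p (deriv γ t) (deriv γ t) ≤ (k * speed u γ t) ^ 2 := by
      have hsp : speed u γ t ^ 2 = hessForm u (γ t) (deriv γ t) (deriv γ t) := by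
        rw [speed, hG.eq _ hγt, Real.sq_sqrt (hG.nonneg hγt _)]
      rw [mul_pow, hsp, hk, div_pow, div_mul_eq_mul_div, le_div_iff₀ (pow_pos hsα 2), mul_comm (_ ^ 2)]
      refine h1.trans (mul_le_mul_of_nonneg_left (pow_le_pow_left₀ h20 h2 2) (hG.nonneg hγt _))
    have h4 := hG.sq_le hp v (deriv γ t)
    have h5 : hessForm u p v (deriv γ t) ≤ N * (k * speed u γ t) := by
      refine le_of_sq_le_sq ?_ (mul_nonneg hN0 (mul_nonneg hk0 (speed_nonneg u γ t)))
      rw [mul_pow, hNsq]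
      exact h4.trans (mul_le_mul_of_nonneg_left h3 (hG.nonneg hp v))
    linarith
  have h6 := hmon (left_mem_Icc.2 hab.le) (right_mem_Icc.2 hab.le) hab.le
  simp only [arc_self, mul_zero, zero_sub, hγa] at h6
  have h7 : hessForm u p v v = hessForm u p v (γ b) - hessForm u p v p := map_sub _ _ _
  have h8 : N ^ 2 ≤ N * (k * L) := by
    rw [hNsq, h7]
    have := mul_le_mul_of_nonneg_left hlen (mul_nonneg hN0 hk0)
    linarith
  rcases hN0.eq_or_lt with h0 | h0
  · rw [← h0]; positivity
  · rw [sq] at h8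
    exact le_of_mul_le_mul_left h8 h0

/-- A point at distance exactly β need not be reached by a curve of length β; lengths `L > β` are
used, and `L` tends to β. -/
theorem gClosedBall_subset_ellipsoid (hu : P.Guillemin u) (hF : ∀ x ∈ P.inner, normF u x ≤ 1)
    {p : E n} (hp : p ∈ P.inner) {α β : ℝ} (hα : 0 < α)
    (hpα : ENNReal.ofReal α ≤ gDistBoundary P u p) (hβ : 0 < β) :
    gClosedBall P u p β ⊆ ellipsoid u p (Real.sinh (α + β) / Real.sinh α * β) := by
  rintro q ⟨hq, hqβ⟩
  have hd : rDist P u p q ≤ β := ENNReal.toReal_le_of_le_ofReal hβ.le hqβ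
  have hev : ∀ᶠ L in 𝓝[>] β,
      √(metricForm u p (q - p)) ≤ Real.sinh (α + L) / Real.sinh α * L := by
    filter_upwards [self_mem_nhdsWithin] with L hL
    exact hu.sqrt_metricForm_sub_le_of_conn hF hp hα hpα (hβ.le.trans (le_of_lt hL))
      (hu.conn_of_rDist_lt hp hq (hd.trans_lt hL))
  have hcont : Continuous fun L : ℝ => Real.sinh (α + L) / Real.sinh α * L := by fun_prop
  have h := ge_of_tendsto ((hcont.tendsto β).mono_left nhdsWithin_le_nhds) hev
  have h0 : 0 ≤ Real.sinh (α + β) / Real.sinh α * β := (Real.sqrt_nonneg _).trans h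
  exact (Real.sqrt_le_left h0).1 h

end DelzantPolytope.Guillemin

open scoped MatrixOrder in
/-- The volume of an ellipsoid. -/
theorem volume_ellipsoid {p : E n} (hp : (hess u p).PosDef) {r : ℝ} (hr : 0 ≤ r) :
    volume (ellipsoid u p r) = ENNReal.ofReal (r ^ n * (hess u p).det ^ (-(1 / 2) : ℝ)) *
      volume (Metric.ball (0 : E n) 1) := by
  -- With the Hessian written as BᵀB, the ellipsoid is the preimage of a ball under `x ↦ B (x - p)`,
  -- and |det B| is the square root of the determinant of the Hessian.
  obtain ⟨B, hB⟩ := CStarAlgebra.nonneg_iff_eq_star_mul_self.1 hp.posSemidef.nonneg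
  rw [star_eq_conjTranspose] at hB
  have hdet : (hess u p).det = B.det ^ 2 := by
    rw [hB, Matrix.det_mul, Matrix.det_conjTranspose, star_trivial, sq]
  have hdp := hp.det_pos
  have hB0 : B.det ≠ 0 := fun h => by rw [hdet, h] at hdp; simp at hdp
  have hpow : (hess u p).det ^ (-(1 / 2) : ℝ) = |B.det⁻¹| := by
    rw [Real.rpow_neg hdp.le, ← Real.sqrt_eq_rpow, hdet, Real.sqrt_sq_eq_abs, abs_inv]
  have hform : ∀ w : E n, metricForm u p w = ‖Matrix.toEuclideanLin B w‖ ^ 2 := by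
    intro w
    have h1 : metricForm u p w = w.ofLp ⬝ᵥ hess u p *ᵥ w.ofLp := by
      simp only [metricForm, dotProduct, mulVec, Finset.mul_sum]
      exact Finset.sum_congr rfl fun i _ => Finset.sum_congr rfl fun j _ => by ring
    rw [h1, hB, ← mulVec_mulVec, dotProduct_mulVec, vecMul_conjTranspose, star_trivial,
      EuclideanSpace.real_norm_sq_eq]
    simp [dotProduct, sq]
  have hset : ellipsoid u p r = (fun x => x + -p) ⁻¹'
      (Matrix.toEuclideanLin B ⁻¹' Metric.closedBall 0 r) := by
    ext x
    simp only [ellipsoid, mem_ofPred_eq, mem_preimage, mem_closedBall_zero_iff, hform,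
      ← sub_eq_add_neg]
    exact sq_le_sq₀ (norm_nonneg _) hr
  have hdetL : LinearMap.det (Matrix.toEuclideanLin B) = B.det := by
    exact LinearMap.det_toLin (PiLp.basisFun 2 ℝ (Fin n)) B
  rw [hset, measure_preimage_add_right, Measure.addHaar_preimage_linearMap _ (by rwa [hdetL]),
    Measure.addHaar_closedBall _ _ hr, hdetL, finrank_euclideanSpace_fin, hpow, ← mul_assoc,
    ← ENNReal.ofReal_mul (abs_nonneg _), mul_comm (r ^ n)]

end Toric

theorem mainTheorem7 (n : ℕ) (P : Toric.DelzantPolytope n) (u : Toric.E n → ℝ)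
    (hu : P.Guillemin u) (hF : ∀ x ∈ P.inner, Toric.normF u x ≤ 1)
    (p : Toric.E n) (hp : p ∈ P.inner) (α : ℝ) (hα : 0 < α)
    (hpα : ENNReal.ofReal α ≤ Toric.gDistBoundary P u p) :
    (∀ q ∈ P.inner, ∀ d : ℝ, 0 ≤ d → Toric.gDist P u p q = ENNReal.ofReal d →
      ((Real.sinh (α + d) ^ 2 / Real.sinh α ^ 2) • Toric.invHess u p
          - Toric.invHess u q).PosSemidef ∧
      (d < α → (Toric.invHess u q
          - (Real.sinh (α - d) ^ 2 / Real.sinh α ^ 2) • Toric.invHess u p).PosSemidef)) ∧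
    (∀ β : ℝ, 0 < β → β < α →
      Toric.ellipsoid u p (Real.sinh (α - β) / Real.sinh α * β) ⊆ Toric.gBall P u p β ∧
      Toric.gClosedBall P u p β ⊆
        Toric.ellipsoid u p (Real.sinh (α + β) / Real.sinh α * β) ∧
      ENNReal.ofReal ((Real.sinh (α - β) / Real.sinh α) ^ n * β ^ n *
          (Toric.hess u p).det ^ (-(1 / 2) : ℝ)) *
            MeasureTheory.volume (Metric.ball (0 : Toric.E n) 1) ≤
        MeasureTheory.volume (Toric.gBall P u p β)) := by
  refine ⟨fun q hq d hd hpq => ?_, fun β hβ hβα => ?_⟩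
  · have hr : Toric.rDist P u p q = d := by rw [Toric.rDist, hpq, ENNReal.toReal_ofReal hd]
    subst hr
    exact ⟨hu.posSemidef_smul_invHess_sub hF hp hq hα hpα,
      hu.posSemidef_invHess_sub_smul hF hp hq hα hpα⟩
  · have hsub := hu.ellipsoid_subset_gBall hF hp hpα hβ hβα
    refine ⟨hsub, hu.gClosedBall_subset_ellipsoid hF hp hα hpα hβ, ?_⟩
    rw [← mul_pow, ← Toric.volume_ellipsoid (hu.posDef_hess hp)
      (mul_nonneg (Toric.sinh_sub_div_pos hβ.le hβα).le hβ.le)]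
    exact measure_mono hsub
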